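/- **Setting.** Let $N,m\ge 1$ be integers. For an open set $U\subset\mathbb R^N$, $W^{m,2}(U)$ is the space of real functions $u\in L^2(U)$ whose distributional derivatives $D^\alpha u$, $|\alpha|=m$, are in $L^2(U)$, with norm $\|u\|^2_{W^{m,2}(U)}=\|u\|^2_{L^2(U)}+\sum_{|\alpha|=m}\|D^\alpha u\|^2_{L^2(U)}$, and $W^{m,2}_0(U)$ is the closure in $W^{m,2}(U)$ of $C_c^\infty(U)$. Let $A_{\alpha\beta}=A_{\beta\alpha}$ ($|\alpha|=|\beta|=m$) be bounded measurable real functions on $\mathbb R^N$ such that, for some $\theta>0$, $\sum_{\alpha,\beta}A_{\alpha\beta}(x)\xi_\alpha\xi_\beta\ge\theta\sum_\alpha|\xi_\alpha|^2$ for all $x$ and $\xi$. Put $$Q_S(u,v)=\sum_{|\alpha|=|\beta|=m}\int_S A_{\alpha\beta}D^\alpha u\,D^\beta v\,dx+\int_S uv\,dx,\qquad Q_S(u)=Q_S(u,u).$$ Let $H_{W^{m,2}_0(U)}$ be the selfadjoint operator on $L^2(U)$ of the form $Q_U$ with form domain $W^{m,2}_0(U)$: $u\in\mathrm{Dom}\,H$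 and $Hu=f$ if and only if $u\in W^{m,2}_0(U)$ and $Q_U(u,v)=\langle f,v\rangle_{L^2(U)}$ for all $v\in W^{m,2}_0(U)$. Let $\mathcal E$ denote extension by zero to $\mathbb R^N$ (followed by restriction to the set under consideration). Let $D\subset\mathbb R^N$ be a bounded open set, and let $\Omega$ and $\Omega_\epsilon$ ($\epsilon>0$) be open subsets of $D$. All limits in $\epsilon$ are for $\epsilon\to0^+$. Functions are extended by zero to $D$ where needed. The spaces $W^{m,2}_0(\Omega_\epsilon)$ *converge in the sense of Mosco* to $W^{m,2}_0(\Omega)$ if - (M1) for every $\varphi\in W^{m,2}_0(\Omega)$ there are $\varphi_\epsilon\in W^{m,2}_0(\Omega_\epsilon)$ ($\epsilon>0$) with $\varphi_\epsilon\to\varphi$ in $W^{m,2}(D)$; - (M2) if $v\in W^{m,2}_0(D)$, $\epsilon_n\to0^+$, $v_n\in W^{m,2}_0(\Omega_{\epsilon_n})$ and $v_n\rightharpoonup v$ weakly in $W^{m,2}(D)$, then $v\in W^{m,2}_0(\Omega)$. **Theorem.** Suppose that $W^{m,2}_0(\Omega_\epsilon)$ converges to $W^{m,2}_0(\Omega)$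 in the sense of Mosco. Write $V(\Omega_\epsilon)=W^{m,2}_0(\Omega_\epsilon)$ and $V(\Omega)=W^{m,2}_0(\Omega)$. Then the following *condition (C)* holds: there are open sets $K_\epsilon\subset\Omega\cap\Omega_\epsilon$ ($\epsilon>0$) with $|\Omega\setminus K_\epsilon|\to0$ such that - (C1) if $v_\epsilon\in V(\Omega_\epsilon)$ and $\sup_{\epsilon>0}Q_{\Omega_\epsilon}(v_\epsilon)<\infty$, then $\|v_\epsilon\|_{L^2(\Omega_\epsilon\setminus K_\epsilon)}\to0$; - (C2) there are linear operators $T_\epsilon:V(\Omega)\to V(\Omega_\epsilon)$ such that for each $\varphi\in V(\Omega)$: (i) $Q_{K_\epsilon}(T_\epsilon\varphi-\varphi)\to0$; (ii) $Q_{\Omega_\epsilon\setminus K_\epsilon}(T_\epsilon\varphi)\to0$; (iii) $\sup_{\epsilon>0}\|T_\epsilon\varphi\|_{L^2(\Omega_\epsilon)}<\infty$; - (C3) there are linear operators $E_\epsilon:V(\Omega_\epsilon)\to W^{m,2}(\Omega)$ whose ranges are compactly embedded in $L^2(\Omega)$, uniformly in $\epsilon$ (every sequence in $\bigcup_{\epsilon>0}E_\epsilon(V(\Omega_\epsilon))$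 that is bounded in $W^{m,2}(\Omega)$ has a subsequence converging in $L^2(\Omega)$), and such that: (i) if $v_\epsilon\in V(\Omega_\epsilon)$ and $\sup_{\epsilon>0}Q_{\Omega_\epsilon}(v_\epsilon)<\infty$, then $Q_{K_\epsilon}(E_\epsilon v_\epsilon-v_\epsilon)\to0$; (ii) there is a constant $C$ with $\|E_\epsilon v\|_{W^{m,2}(\Omega)}\le C\,Q_{\Omega_\epsilon}(v)^{1/2}$ for all $\epsilon>0$ and $v\in V(\Omega_\epsilon)$; (iii) if $v_\epsilon\in V(\Omega_\epsilon)$, $\sup_{\epsilon>0}Q_{\Omega_\epsilon}(v_\epsilon)<\infty$, and $E_{\epsilon_n}v_{\epsilon_n}\to v$ in $L^2(\Omega)$ for some sequence $\epsilon_n\to0^+$, then $v\in V(\Omega)$. Moreover, the inverses $B_\epsilon=H^{-1}_{W^{m,2}_0(\Omega_\epsilon)}$ and $B=H^{-1}_{W^{m,2}_0(\Omega)}$ exist as bounded operators on $L^2(\Omega_\epsilon)$ and $L^2(\Omega)$, and $B_\epsilon$ *$\mathcal E$-compactly converges* to $B$, that is: every $B_\epsilon$ is compact; whenever $v_\epsilon\in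 L^2(\Omega_\epsilon)$, $v\in L^2(\Omega)$ and $\|v_\epsilon-\mathcal Ev\|_{L^2(\Omega_\epsilon)}\to0$, also $\|B_\epsilon v_\epsilon-\mathcal E Bv\|_{L^2(\Omega_\epsilon)}\to0$; and for every family $v_\epsilon\in L^2(\Omega_\epsilon)$ with $\|v_\epsilon\|_{L^2(\Omega_\epsilon)}\le1$, every sequence $\epsilon_n\to0^+$ has a subsequence along which $\|B_{\epsilon_n}v_{\epsilon_n}-\mathcal Ew\|_{L^2(\Omega_{\epsilon_n})}\to0$ for some $w\in L^2(\Omega)$. -/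

import Mathlib

open MeasureTheory TopologicalSpace Filter
open scoped Topology ContDiff

noncomputable section

namespace DomainPerturbation

/-- Euclidean space `ℝ^N`. -/
abbrev Space (N : ℕ) := EuclideanSpace ℝ (Fin N)

/-- The real Hilbert space `L²(U)`. -/
abbrev L2 {N : ℕ} (U : Opens (Space N)) := Lp ℝ 2 (volume.restrict (U : Set (Space N)))

/-! ### Derivatives, test functions, Sobolev spaces -/

/-- Multi-indices `α ∈ ℕ₀^N` of length `|α| = m`. -/
abbrev MultiIndex (N m : ℕ) := {α : Fin N → ℕ // ∑ i, α i = m}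

instance (N m : ℕ) : Fintype (MultiIndex N m) :=
  Fintype.subtype (Finset.piAntidiag Finset.univ m) (by simp)

/-- The classical partial derivative `∂φ/∂x_i`. -/
def partialDeriv {N : ℕ} (i : Fin N) (φ : Space N → ℝ) : Space N → ℝ :=
  fun x => fderiv ℝ φ x (EuclideanSpace.single i 1)

/-- The classical derivative `D^α φ = ∂_1^{α_1} ⋯ ∂_N^{α_N} φ`. -/
def multiDeriv {N : ℕ} (α : Fin N → ℕ) (φ : Space N → ℝ) : Space N → ℝ :=
  (List.finRange N).foldr (fun i ψ => (partialDeriv i)^[α i] ψ) φ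

/-- `φ` is a `C^∞` function with compact support in `U`. -/
structure IsTest {N : ℕ} (U : Opens (Space N)) (φ : Space N → ℝ) : Prop where
  contDiff : ContDiff ℝ ∞ φ
  hasCompactSupport : HasCompactSupport φ
  tsupport_subset : tsupport φ ⊆ U

theorem IsTest.partialDeriv {N : ℕ} {U : Opens (Space N)} {φ : Space N → ℝ}
    (h : IsTest U φ) (i : Fin N) : IsTest U (partialDeriv i φ) where
  contDiff := (h.contDiff.fderiv_right (m := ∞) (by simp)).clm_apply contDiff_const
  hasCompactSupport := h.hasCompactSupport.fderiv_apply (𝕜 := ℝ) _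
  tsupport_subset := (tsupport_fderiv_apply_subset ℝ _).trans h.tsupport_subset

theorem IsTest.multiDeriv {N : ℕ} {U : Opens (Space N)} {φ : Space N → ℝ}
    (h : IsTest U φ) (α : Fin N → ℕ) : IsTest U (multiDeriv α φ) := by
  unfold DomainPerturbation.multiDeriv
  induction List.finRange N with
  | nil => exact h
  | cons i l ih =>
    rw [List.foldr_cons]
    induction α i with
    | zero => exact ih
    | succ k ihk => rw [Function.iterate_succ_apply']; exact ihk.partialDeriv i

theorem IsTest.add {N : ℕ} {U : Opens (Space N)} {φ ψ : Space N → ℝ}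
    (hφ : IsTest U φ) (hψ : IsTest U ψ) : IsTest U (φ + ψ) where
  contDiff := hφ.contDiff.add hψ.contDiff
  hasCompactSupport := hφ.hasCompactSupport.add hψ.hasCompactSupport
  tsupport_subset :=
    (tsupport_add φ ψ).trans (Set.union_subset hφ.tsupport_subset hψ.tsupport_subset)

theorem IsTest.const_smul {N : ℕ} {U : Opens (Space N)} {φ : Space N → ℝ}
    (h : IsTest U φ) (c : ℝ) : IsTest U (c • φ) where
  contDiff := h.contDiff.const_smul c
  hasCompactSupport := h.hasCompactSupport.smul_left (f := fun _ => c)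
  tsupport_subset := (tsupport_smul_subset_right (fun _ => c) φ).trans h.tsupport_subset

theorem IsTest.zero {N : ℕ} (U : Opens (Space N)) : IsTest U (0 : Space N → ℝ) where
  contDiff := contDiff_const
  hasCompactSupport := HasCompactSupport.zero
  tsupport_subset := by simp [tsupport]

theorem IsTest.integrable_mul {N : ℕ} {U : Opens (Space N)} {φ : Space N → ℝ}
    (h : IsTest U φ) (u : L2 U) :
    Integrable (fun x => u x * φ x) (volume.restrict (U : Set (Space N))) :=
  MemLp.integrable_mul (p := 2) (q := 2) (Lp.memLp u)
    ((h.contDiff.continuous.memLp_of_hasCompactSupport h.hasCompactSupport).restrict _)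

/-- `g = D^α u` in `U` in the sense of distributions. -/
def HasWeakDeriv {N : ℕ} (U : Opens (Space N)) (α : Fin N → ℕ) (u g : L2 U) : Prop :=
  ∀ φ, IsTest U φ →
    ∫ x in (U : Set (Space N)), u x * multiDeriv α φ x =
      (-1) ^ (∑ i, α i) * ∫ x in (U : Set (Space N)), g x * φ x

theorem HasWeakDeriv.add {N : ℕ} {U : Opens (Space N)} {α : Fin N → ℕ} {u g u' g' : L2 U}
    (h : HasWeakDeriv U α u g) (h' : HasWeakDeriv U α u' g') :
    HasWeakDeriv U α (u + u') (g + g') := by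
  intro φ hφ
  have e : ∀ (a b : L2 U) (ψ : Space N → ℝ), IsTest U ψ →
      ∫ x in (U : Set (Space N)), (a + b : L2 U) x * ψ x =
        (∫ x in (U : Set (Space N)), a x * ψ x) + ∫ x in (U : Set (Space N)), b x * ψ x := by
    intro a b ψ hψ
    rw [← integral_add (hψ.integrable_mul a) (hψ.integrable_mul b)]
    refine integral_congr_ae ?_
    filter_upwards [Lp.coeFn_add a b] with x hx
    rw [hx, Pi.add_apply, add_mul]
  rw [e _ _ _ (hφ.multiDeriv α), e _ _ _ hφ, h φ hφ, h' φ hφ, mul_add]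

theorem HasWeakDeriv.const_smul {N : ℕ} {U : Opens (Space N)} {α : Fin N → ℕ} {u g : L2 U}
    (c : ℝ) (h : HasWeakDeriv U α u g) : HasWeakDeriv U α (c • u) (c • g) := by
  intro φ hφ
  have e : ∀ (a : L2 U) (ψ : Space N → ℝ),
      ∫ x in (U : Set (Space N)), (c • a : L2 U) x * ψ x =
        c * ∫ x in (U : Set (Space N)), a x * ψ x := by
    intro a ψ
    rw [← integral_const_mul]
    refine integral_congr_ae ?_
    filter_upwards [Lp.coeFn_smul c a] with x hx
    rw [hx, Pi.smul_apply, smul_eq_mul, mul_assoc]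
  rw [e, e, h φ hφ]
  ring

theorem HasWeakDeriv.zero {N : ℕ} (U : Opens (Space N)) (α : Fin N → ℕ) :
    HasWeakDeriv U α 0 0 := by
  have h : ∀ ψ : Space N → ℝ, ∫ x in (U : Set (Space N)), (0 : L2 U) x * ψ x = 0 := by
    intro ψ
    rw [← integral_zero (Space N) ℝ]
    refine integral_congr_ae ?_
    filter_upwards [Lp.coeFn_zero ℝ 2 (volume.restrict (U : Set (Space N)))] with x hx
    rw [hx, Pi.zero_apply, zero_mul]
  intro φ _
  rw [h, h, mul_zero]

/-- The Hilbert space of families `(u, (g_α)_{|α| = m})` of elements of `L²(U)`, with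
`‖(u, g)‖² = ‖u‖² + ∑_α ‖g_α‖²`. -/
abbrev Jet {N : ℕ} (m : ℕ) (U : Opens (Space N)) :=
  WithLp 2 (L2 U × PiLp 2 (fun _ : MultiIndex N m => L2 U))

/-- The Sobolev space `W^{m,2}(U)` of all `u ∈ L²(U)` whose distributional derivatives of order
`m` are in `L²(U)`. Since these derivatives are determined by `u`, it is realised as the space of
all `(u, (D^α u)_{|α| = m})`; the inherited norm is the Sobolev norm
`‖u‖² = ‖u‖²_{L²(U)} + ∑_{|α| = m} ‖D^α u‖²_{L²(U)}`. -/
def sobolev {N : ℕ} (m : ℕ) (U : Opens (Space N)) : Submodule ℝ (Jet m U) where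
  carrier := {J | ∀ α : MultiIndex N m, HasWeakDeriv U α.1 J.fst (J.snd α)}
  add_mem' h h' α := (h α).add (h' α)
  zero_mem' α := HasWeakDeriv.zero U α.1
  smul_mem' c _ h α := (h α).const_smul c

/-- `W^{m,2}(U)` as a type (a real inner product space). -/
abbrev W {N : ℕ} (m : ℕ) (U : Opens (Space N)) := sobolev m U

/-- The function `u ∈ L²(U)` underlying an element of `W^{m,2}(U)`. -/
def fn {N m : ℕ} {U : Opens (Space N)} (u : W m U) : L2 U := u.1.fst

/-- The distributional derivative `D^α u ∈ L²(U)`, `|α| = m`, of `u ∈ W^{m,2}(U)`. -/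
def weakDeriv {N m : ℕ} {U : Opens (Space N)} (u : W m U) (α : MultiIndex N m) : L2 U := u.1.snd α

/-- The elements of `W^{m,2}(U)` given by `C^∞` functions with compact support in `U`. -/
def testSpace {N : ℕ} (m : ℕ) (U : Opens (Space N)) : Submodule ℝ (W m U) where
  carrier := {u | ∃ φ, IsTest U φ ∧ fn u =ᵐ[volume.restrict (U : Set (Space N))] φ}
  add_mem' := by
    rintro u v ⟨φ, hφ, hu⟩ ⟨ψ, hψ, hv⟩
    exact ⟨φ + ψ, hφ.add hψ, (Lp.coeFn_add (fn u) (fn v)).trans (hu.add hv)⟩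
  zero_mem' := ⟨0, IsTest.zero U, Lp.coeFn_zero ℝ 2 _⟩
  smul_mem' := by
    rintro c u ⟨φ, hφ, hu⟩
    exact ⟨c • φ, hφ.const_smul c, (Lp.coeFn_smul c (fn u)).trans (hu.const_smul c)⟩

/-- `W^{m,2}_0(U)`, the closure in `W^{m,2}(U)` of the `C^∞` functions with compact support
in `U`. -/
def W0 {N : ℕ} (m : ℕ) (U : Opens (Space N)) : Submodule ℝ (W m U) :=
  (testSpace m U).topologicalClosure

/-! ### Extension by zero and Mosco convergence -/

/-- The operator `𝓔 : L²(U) → L²(U')`: extend by zero to `ℝ^N`, then restrict to `U'`. -/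
def zeroExt {N : ℕ} {U : Opens (Space N)} (U' : Opens (Space N)) (u : L2 U) : L2 U' :=
  MemLp.toLp ((U : Set (Space N)).indicator u)
    (((memLp_indicator_iff_restrict U.isOpen.measurableSet).2 (Lp.memLp u)).restrict
      (U' : Set (Space N)))

/-- The space `W^{m,2}_0(U)` seen inside `W^{m,2}(D)`, for `U ⊆ D`, by extending its elements by
zero. -/
def extendedW0 {N : ℕ} (m : ℕ) (D U : Opens (Space N)) : Set (W m D) :=
  {w | ∃ u ∈ W0 m U, fn w = zeroExt D (fn u)}

/-- Mosco convergence of `W^{m,2}_0(Ω_ε)` to `W^{m,2}_0(Ω)` as `ε → 0+`, all the open sets being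
contained in `D`. -/
structure MoscoConverges {N : ℕ} (m : ℕ) (D : Opens (Space N)) (Ωε : ℝ → Opens (Space N))
    (Ω : Opens (Space N)) : Prop where
  approx : ∀ φ ∈ extendedW0 m D Ω, ∃ φε : ℝ → W m D,
    (∀ ε > 0, φε ε ∈ extendedW0 m D (Ωε ε)) ∧ Tendsto φε (𝓝[>] 0) (𝓝 φ)
  weak_limit : ∀ v ∈ W0 m D, ∀ e : ℕ → ℝ, (∀ n, 0 < e n) → Tendsto e atTop (𝓝 0) →
    ∀ v' : ℕ → W m D, (∀ n, v' n ∈ extendedW0 m D (Ωε (e n))) →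
      (∀ l : W m D →L[ℝ] ℝ, Tendsto (fun n => l (v' n)) atTop (𝓝 (l v))) →
      v ∈ extendedW0 m D Ω

/-! ### The elliptic operators -/

/-- Bounded measurable symmetric coefficients `A_{αβ}`, `|α| = |β| = m`, on `ℝ^N`, with
`∑ A_{αβ}(x) ξ_α ξ_β ≥ θ |ξ|²` for some `θ > 0`. -/
structure IsEllipticCoeff {N m : ℕ} (A : MultiIndex N m → MultiIndex N m → Space N → ℝ) :
    Prop where
  measurable : ∀ α β, Measurable (A α β)
  bounded : ∀ α β, ∃ M : ℝ, ∀ x, |A α β x| ≤ M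
  symm : ∀ α β, A α β = A β α
  elliptic : ∃ θ : ℝ, 0 < θ ∧ ∀ (x : Space N) (ξ : MultiIndex N m → ℝ),
    θ * ∑ α, ξ α ^ 2 ≤ ∑ α, ∑ β, A α β x * ξ α * ξ β

/-- The pointwise data `x ↦ (u(x), (D^α u(x))_{|α| = m})` of `u ∈ W^{m,2}(U)`. -/
def jet {N m : ℕ} {U : Opens (Space N)} (u : W m U) :
    Space N → ℝ × (MultiIndex N m → ℝ) :=
  fun x => (fn u x, fun α => weakDeriv u α x)

/-- `Q_S(u, v) = ∑_{α, β} ∫_S A_{αβ} D^α u D^β v dx + ∫_S u v dx` in terms of the pointwise data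
of `u` and `v`. -/
def Q {N m : ℕ} (A : MultiIndex N m → MultiIndex N m → Space N → ℝ) (S : Set (Space N))
    (u v : Space N → ℝ × (MultiIndex N m → ℝ)) : ℝ :=
  (∑ α, ∑ β, ∫ x in S, A α β x * (u x).2 α * (v x).2 β) + ∫ x in S, (u x).1 * (v x).1

/-- `u ∈ Dom H_V` and `H_V u = f`, where `H_V` is the selfadjoint operator on `L²(U)` of the form
`Q_U` with form domain `V`: that is, `u ∈ V` and `Q_U(u, v) = ⟨f, v⟩` for all `v ∈ V`. -/
def OperatorEq {N m : ℕ} {U : Opens (Space N)}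
    (A : MultiIndex N m → MultiIndex N m → Space N → ℝ) (V : Submodule ℝ (W m U))
    (u f : L2 U) : Prop :=
  ∃ w ∈ V, fn w = u ∧ ∀ v ∈ V, Q A U (jet w) (jet v) = inner ℝ f (fn v)

/-- The bounded operator `B` is `H_V^{-1}`: one has `B f = u` exactly when `u ∈ Dom H_V` and
`H_V u = f`. -/
def IsInverseOperator {N m : ℕ} {U : Opens (Space N)}
    (A : MultiIndex N m → MultiIndex N m → Space N → ℝ) (V : Submodule ℝ (W m U))
    (B : L2 U →L[ℝ] L2 U) : Prop :=
  ∀ f u : L2 U, B f = u ↔ OperatorEq A V u f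

/-! ### `𝓔`-compact convergence -/

/-- `v_ε ∈ L²(Ω_ε)` `𝓔`-converges to `v ∈ L²(Ω)`. -/
def EConverges {N : ℕ} {Ωε : ℝ → Opens (Space N)} {Ω : Opens (Space N)}
    (v' : ∀ ε, L2 (Ωε ε)) (v : L2 Ω) : Prop :=
  Tendsto (fun ε => ‖v' ε - zeroExt (Ωε ε) v‖) (𝓝[>] 0) (𝓝 0)

/-- `𝓔`-compact convergence of the operators `B_ε` on `L²(Ω_ε)` to `B` on `L²(Ω)`. -/
structure ECompactConverges {N : ℕ} {Ωε : ℝ → Opens (Space N)} {Ω : Opens (Space N)}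
    (B' : ∀ ε, L2 (Ωε ε) →L[ℝ] L2 (Ωε ε)) (B : L2 Ω →L[ℝ] L2 Ω) : Prop where
  compact : ∀ ε > 0, IsCompactOperator (B' ε)
  convergence : ∀ (v' : ∀ ε, L2 (Ωε ε)) (v : L2 Ω), EConverges v' v →
    EConverges (fun ε => B' ε (v' ε)) (B v)
  subsequence : ∀ v' : ∀ ε, L2 (Ωε ε), (∀ ε > 0, ‖v' ε‖ ≤ 1) →
    ∀ e : ℕ → ℝ, (∀ n, 0 < e n) → Tendsto e atTop (𝓝 0) →
      ∃ k : ℕ → ℕ, StrictMono k ∧ ∃ w : L2 Ω,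
        Tendsto (fun n => ‖B' (e (k n)) (v' (e (k n))) - zeroExt (Ωε (e (k n))) w‖)
          atTop (𝓝 0)

/-! ### Condition (C) -/

/-- Condition (C2) for the open sets `K_ε` and the operators `T_ε : V(Ω) → V(Ω_ε)`. -/
structure ConditionC2 {N m : ℕ} (A : MultiIndex N m → MultiIndex N m → Space N → ℝ)
    {Ωε : ℝ → Opens (Space N)} {Ω : Opens (Space N)}
    (Vε : ∀ ε, Submodule ℝ (W m (Ωε ε))) (V : Submodule ℝ (W m Ω))
    (K : ℝ → Opens (Space N)) (T : ∀ ε, V →ₗ[ℝ] Vε ε) : Prop where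
  i : ∀ φ : V, Tendsto
    (fun ε => Q A (K ε) (jet (T ε φ).1 - jet φ.1) (jet (T ε φ).1 - jet φ.1)) (𝓝[>] 0) (𝓝 0)
  ii : ∀ φ : V, Tendsto
    (fun ε => Q A ((Ωε ε : Set (Space N)) \ K ε) (jet (T ε φ).1) (jet (T ε φ).1)) (𝓝[>] 0) (𝓝 0)
  iii : ∀ φ : V, ∃ M : ℝ, ∀ ε > 0, ‖fn (T ε φ).1‖ ≤ M

/-- Condition (C3) for the open sets `K_ε` and the operators `E_ε : V(Ω_ε) → W^{m,2}(Ω)`. -/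
structure ConditionC3 {N m : ℕ} (A : MultiIndex N m → MultiIndex N m → Space N → ℝ)
    {Ωε : ℝ → Opens (Space N)} {Ω : Opens (Space N)}
    (Vε : ∀ ε, Submodule ℝ (W m (Ωε ε))) (V : Submodule ℝ (W m Ω))
    (K : ℝ → Opens (Space N)) (E : ∀ ε, Vε ε →ₗ[ℝ] W m Ω) : Prop where
  /-- The ranges of the `E_ε`, with the norm of `W^{m,2}(Ω)`, embed compactly in `L²(Ω)`,
  uniformly in `ε` (for a single `ε`, take `e` constant). -/
  compact : ∀ e : ℕ → ℝ, (∀ n, 0 < e n) → ∀ v : ∀ n, Vε (e n),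
    (∃ M : ℝ, ∀ n, ‖E (e n) (v n)‖ ≤ M) →
      ∃ k : ℕ → ℕ, StrictMono k ∧ ∃ w : L2 Ω,
        Tendsto (fun n => fn (E (e (k n)) (v (k n)))) atTop (𝓝 w)
  i : ∀ v : ∀ ε, Vε ε, (∃ M : ℝ, ∀ ε > 0, Q A (Ωε ε) (jet (v ε).1) (jet (v ε).1) ≤ M) →
    Tendsto (fun ε => Q A (K ε) (jet (E ε (v ε)) - jet (v ε).1) (jet (E ε (v ε)) - jet (v ε).1))
      (𝓝[>] 0) (𝓝 0)
  ii : ∃ C : ℝ, ∀ ε > 0, ∀ v : Vε ε, ‖E ε v‖ ≤ C * √(Q A (Ωε ε) (jet v.1) (jet v.1))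
  iii : ∀ v : ∀ ε, Vε ε, (∃ M : ℝ, ∀ ε > 0, Q A (Ωε ε) (jet (v ε).1) (jet (v ε).1) ≤ M) →
    ∀ e : ℕ → ℝ, (∀ n, 0 < e n) → Tendsto e atTop (𝓝 0) →
      ∀ w : L2 Ω, Tendsto (fun n => fn (E (e n) (v (e n)))) atTop (𝓝 w) →
        ∃ u ∈ V, fn u = w

/-- Condition (C) for the open sets `Ω_ε`, `Ω` and the form domains `V(Ω_ε)`, `V(Ω)`. -/
def ConditionC {N m : ℕ} (A : MultiIndex N m → MultiIndex N m → Space N → ℝ)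
    {Ωε : ℝ → Opens (Space N)} {Ω : Opens (Space N)}
    (Vε : ∀ ε, Submodule ℝ (W m (Ωε ε))) (V : Submodule ℝ (W m Ω)) : Prop :=
  ∃ K : ℝ → Opens (Space N),
    (∀ ε > 0, K ε ≤ Ω ⊓ Ωε ε) ∧
    Tendsto (fun ε => volume ((Ω : Set (Space N)) \ K ε)) (𝓝[>] 0) (𝓝 0) ∧
    -- (C1)
    (∀ v : ∀ ε, Vε ε, (∃ M : ℝ, ∀ ε > 0, Q A (Ωε ε) (jet (v ε).1) (jet (v ε).1) ≤ M) →
      Tendsto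
        (fun ε => eLpNorm (fn (v ε).1) 2 (volume.restrict ((Ωε ε : Set (Space N)) \ K ε)))
        (𝓝[>] 0) (𝓝 0)) ∧
    (∃ T : ∀ ε, V →ₗ[ℝ] Vε ε, ConditionC2 A Vε V K T) ∧
    (∃ E : ∀ ε, Vε ε →ₗ[ℝ] W m Ω, ConditionC3 A Vε V K E)

end DomainPerturbation

end

/-!
All the spaces `W^{m,2}_0(U)` are embedded isometrically, by extension by zero, in the single
Hilbert space `GlobalJet N m` of families `(u, (g_α)_{|α| = m})` in `L²(ℝ^N)`; the image is the
closed subspace `globalW0 m U`. Let `P` and `P_ε` be the orthogonal projections onto the subspaces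
of `Ω` and `Ω_ε`. Mosco convergence says that `P_ε x → x` for `x ∈ W^{m,2}_0(Ω)`
(`MoscoConverges.tendsto_starProjection`) and, with Rellich's theorem, that a bounded sequence
`x_n ∈ W^{m,2}_0(Ω_{ε_n})` has a subsequence that converges weakly, and strongly in `L²`, to an
element of `W^{m,2}_0(Ω)` (`MoscoConverges.exists_subseq`). Rellich's theorem is proved for test
functions by the Fourier transform, in a form that also covers the derivatives of order less
than `m` (`tendsto_integral_iterPartial_sq`).

For condition (C) take `T_ε = P_ε` and `E_ε = P`. The range of `E_ε` lies in `W^{m,2}_0(Ω)`, which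
is compactly embedded in `L²` although nothing is assumed about the boundary of `Ω`, and then (C2)
is immediate. The point is (C3)(i): the energy of `P v - v` on `K_ε` has to tend to `0` for bounded
`v ∈ W^{m,2}_0(Ω_ε)`. A sequence of such differences `h_n = v_n - P v_n` is orthogonal to
`W^{m,2}_0(Ω)` and has a weakly null subsequence, since the `v_n` subconverge weakly in that space. Testing with `χ h_n`, where `χ` is a test function on `Ω`, gives
`∫ χ |h_n|² → 0`, because the commutator of `χ` with the derivatives of order `m` involves only
derivatives of lower order, which tend to `0` by Rellich's theorem (`tendsto_inner_mulOp`). Hence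
the energy of `P v - v` is uniformly small on any fixed set compactly inside `Ω`
(`MoscoConverges.eventually_norm_cut_le`), and so it is on sets `L_{J(ε)} ∩ Ω_ε` where the `L_j`
exhaust `Ω` and `J(ε) → ∞` slowly (`MoscoConverges.exists_fillsSlowly`). These sets are `K_ε`; that
`|L_j \ Ω_ε| → 0` for each `j` follows by applying `P_ε χ → χ` to a test function `χ ≥ 1` on `L_j`
(`MoscoConverges.eventually_volume_le`).

The inverse operators come from the Lax–Milgram theorem. The limit of solutions on `Ω_ε` is
identified by testing the equation on `Ω_ε` with `P_ε y`, `y ∈ W^{m,2}_0(Ω)`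
(`IsEllipticCoeff.eq_solve_of_weaklyTendsto`); with the compactness above this gives strong
resolvent convergence and the compact convergence of the inverses.
-/

noncomputable section

namespace DomainPerturbation

section

/-! ### Iterated partial derivatives of test functions -/

variable {N m : ℕ}

/-- The derivative `∂_{i₁} ⋯ ∂_{i_k} φ` along a list `[i₁, …, i_k]` of coordinate directions. Lists
are more convenient than multi-indices for inductions on the order of differentiation. -/
def iterPartial (l : List (Fin N)) (φ : Space N → ℝ) : Space N → ℝ :=
  l.foldr partialDeriv φ

@[simp] theorem iterPartial_nil (φ : Space N → ℝ) : iterPartial [] φ = φ := rfl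

@[simp] theorem iterPartial_cons (i : Fin N) (l : List (Fin N)) (φ : Space N → ℝ) :
    iterPartial (i :: l) φ = partialDeriv i (iterPartial l φ) := rfl

theorem iterPartial_append (l l' : List (Fin N)) (φ : Space N → ℝ) :
    iterPartial (l ++ l') φ = iterPartial l (iterPartial l' φ) := by
  simp [iterPartial, List.foldr_append]

theorem iterPartial_replicate (i : Fin N) (k : ℕ) (φ : Space N → ℝ) :
    iterPartial (List.replicate k i) φ = (partialDeriv i)^[k] φ := by
  induction k with
  | zero => rfl
  | succ k ih => rw [List.replicate_succ, iterPartial_cons, ih, Function.iterate_succ_apply']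

/-- The list of directions of the multi-index `α`. -/
def directions (α : Fin N → ℕ) : List (Fin N) :=
  (List.finRange N).flatMap fun i => List.replicate (α i) i

theorem length_directions (α : Fin N → ℕ) : (directions α).length = ∑ i, α i := by
  simp [directions, List.length_flatMap, Fin.sum_univ_def]

theorem multiDeriv_eq_iterPartial (α : Fin N → ℕ) (φ : Space N → ℝ) :
    multiDeriv α φ = iterPartial (directions α) φ := by
  unfold multiDeriv directions
  induction List.finRange N with
  | nil => rfl
  | cons i l ih =>
    rw [List.foldr_cons, List.flatMap_cons, iterPartial_append, ← ih, iterPartial_replicate]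

namespace IsTest

variable {U U' : Opens (Space N)} {φ ψ : Space N → ℝ}

theorem mono (h : U ≤ U') (hφ : IsTest U φ) : IsTest U' φ :=
  ⟨hφ.contDiff, hφ.hasCompactSupport, hφ.tsupport_subset.trans h⟩

theorem iterPartial (hφ : IsTest U φ) (l : List (Fin N)) : IsTest U (iterPartial l φ) := by
  induction l with
  | nil => exact hφ
  | cons i l ih => exact ih.partialDeriv i

theorem continuous (hφ : IsTest U φ) : Continuous φ := hφ.contDiff.continuous

theorem differentiable (hφ : IsTest U φ) : Differentiable ℝ φ :=
  hφ.contDiff.differentiable (by simp)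

theorem memLp (hφ : IsTest U φ) (p : ENNReal) : MemLp φ p :=
  hφ.continuous.memLp_of_hasCompactSupport hφ.hasCompactSupport

theorem eq_zero_of_notMem (hφ : IsTest U φ) {x : Space N} (hx : x ∉ U) : φ x = 0 :=
  image_eq_zero_of_notMem_tsupport fun h => hx (hφ.tsupport_subset h)

theorem mul_left (hφ : IsTest U φ) (hψ : IsTest U' ψ) : IsTest U (fun x => φ x * ψ x) where
  contDiff := hφ.contDiff.mul hψ.contDiff
  hasCompactSupport := hφ.hasCompactSupport.mul_right
  tsupport_subset := (tsupport_mul_subset_left).trans hφ.tsupport_subset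

theorem integrable_mul_test (hφ : IsTest U φ) (hψ : IsTest U' ψ) :
    Integrable fun x => φ x * ψ x :=
  memLp_one_iff_integrable.1 ((hφ.mul_left hψ).memLp 1)

theorem partialDeriv_mul (hφ : IsTest U φ) (hψ : IsTest U' ψ) (i : Fin N) :
    DomainPerturbation.partialDeriv i (fun x => φ x * ψ x) =
      (fun x => φ x * DomainPerturbation.partialDeriv i ψ x) +
        fun x => DomainPerturbation.partialDeriv i φ x * ψ x := by
  ext x
  have := fderiv_fun_mul (hφ.differentiable x) (hψ.differentiable x)
  simp [DomainPerturbation.partialDeriv, this, mul_comm]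

theorem partialDeriv_add (hφ : IsTest U φ) (hψ : IsTest U' ψ) (i : Fin N) :
    DomainPerturbation.partialDeriv i (φ + ψ) =
      DomainPerturbation.partialDeriv i φ + DomainPerturbation.partialDeriv i ψ := by
  ext x
  have := fderiv_add (hφ.differentiable x) (hψ.differentiable x)
  simp [DomainPerturbation.partialDeriv, this]

theorem iterPartial_add (hφ : IsTest U φ) (hψ : IsTest U' ψ) (l : List (Fin N)) :
    DomainPerturbation.iterPartial l (φ + ψ) =
      DomainPerturbation.iterPartial l φ + DomainPerturbation.iterPartial l ψ := by
  induction l with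
  | nil => rfl
  | cons i l ih =>
    rw [iterPartial_cons, ih, (hφ.iterPartial l).partialDeriv_add (hψ.iterPartial l)]
    rfl

theorem partialDeriv_smul (hφ : IsTest U φ) (c : ℝ) (i : Fin N) :
    DomainPerturbation.partialDeriv i (c • φ) = c • DomainPerturbation.partialDeriv i φ := by
  ext x
  have := fderiv_const_smul (hφ.differentiable x) c
  simp [DomainPerturbation.partialDeriv, this]

theorem iterPartial_smul (hφ : IsTest U φ) (c : ℝ) (l : List (Fin N)) :
    DomainPerturbation.iterPartial l (c • φ) = c • DomainPerturbation.iterPartial l φ := by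
  induction l with
  | nil => rfl
  | cons i l ih =>
    rw [iterPartial_cons, ih, (hφ.iterPartial l).partialDeriv_smul]
    rfl

theorem partialDeriv_comm (hφ : IsTest U φ) (i j : Fin N) :
    DomainPerturbation.partialDeriv i (DomainPerturbation.partialDeriv j φ) =
      DomainPerturbation.partialDeriv j (DomainPerturbation.partialDeriv i φ) := by
  have key : ∀ (i j : Fin N) (x : Space N),
      DomainPerturbation.partialDeriv i (DomainPerturbation.partialDeriv j φ) x =
        fderiv ℝ (fderiv ℝ φ) x (EuclideanSpace.single i 1) (EuclideanSpace.single j 1) := by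
    intro i j x
    have hd : DifferentiableAt ℝ (fderiv ℝ φ) x :=
      ((hφ.contDiff.fderiv_right (m := ∞) (by simp)).differentiable (by simp)) x
    have := fderiv_clm_apply hd
      (differentiableAt_const (𝕜 := ℝ) (EuclideanSpace.single j (1 : ℝ) : Space N))
    change fderiv ℝ (fun y => fderiv ℝ φ y (EuclideanSpace.single j 1)) x _ = _
    rw [this]
    simp
  ext x
  rw [key, key]
  refine (hφ.contDiff.contDiffAt.isSymmSndFDerivAt ?_) _ _
  rw [minSmoothness_of_isRCLikeNormedField]
  exact WithTop.coe_le_coe.2 (le_top : (2 : ℕ∞) ≤ ⊤)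

theorem iterPartial_perm (hφ : IsTest U φ) {l l' : List (Fin N)} (h : l.Perm l') :
    DomainPerturbation.iterPartial l φ = DomainPerturbation.iterPartial l' φ := by
  induction h with
  | nil => rfl
  | cons i _ ih => rw [iterPartial_cons, iterPartial_cons, ih]
  | swap i j l => exact (hφ.iterPartial l).partialDeriv_comm j i
  | trans _ _ ih ih' => exact ih.trans ih'

theorem integral_mul_partialDeriv (hφ : IsTest U φ) (hψ : IsTest U' ψ) (i : Fin N) :
    ∫ x, φ x * DomainPerturbation.partialDeriv i ψ x =
      -∫ x, DomainPerturbation.partialDeriv i φ x * ψ x :=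
  integral_mul_fderiv_eq_neg_fderiv_mul_of_integrable
    ((hφ.partialDeriv i).integrable_mul_test hψ) (hφ.integrable_mul_test (hψ.partialDeriv i))
    (hφ.integrable_mul_test hψ) (fun x _ => hφ.differentiable x) fun x _ => hψ.differentiable x

theorem integral_mul_iterPartial (hφ : IsTest U φ) (hψ : IsTest U' ψ) (l : List (Fin N)) :
    ∫ x, φ x * DomainPerturbation.iterPartial l ψ x =
      (-1) ^ l.length * ∫ x, DomainPerturbation.iterPartial l φ x * ψ x := by
  induction l generalizing φ with
  | nil => simp
  | cons i l ih =>
    rw [iterPartial_cons, hφ.integral_mul_partialDeriv (hψ.iterPartial l), ih (hφ.partialDeriv i),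
      hφ.iterPartial_perm ((List.perm_append_singleton i l).symm), iterPartial_append,
      List.length_cons, pow_succ]
    simp

theorem integral_mul_multiDeriv (hφ : IsTest U φ) (hψ : IsTest U' ψ) (α : Fin N → ℕ) :
    ∫ x, φ x * DomainPerturbation.multiDeriv α ψ x =
      (-1) ^ (∑ i, α i) * ∫ x, DomainPerturbation.multiDeriv α φ x * ψ x := by
  rw [multiDeriv_eq_iterPartial, multiDeriv_eq_iterPartial, hφ.integral_mul_iterPartial hψ,
    length_directions]

theorem setIntegral_mul (hψ : IsTest U ψ) (f : Space N → ℝ) :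
    ∫ x in (U : Set (Space N)), f x * ψ x = ∫ x, f x * ψ x :=
  setIntegral_eq_integral_of_forall_compl_eq_zero fun x hx => by
    rw [hψ.eq_zero_of_notMem hx, mul_zero]

end IsTest

/-- An element of `L²(U)` that is orthogonal to the test functions vanishes. -/
theorem L2_eq_of_integral_mul_test {U : Opens (Space N)} {g g' : L2 U}
    (h : ∀ ψ, IsTest U ψ → ∫ x in (U : Set (Space N)), g x * ψ x =
      ∫ x in (U : Set (Space N)), g' x * ψ x) : g = g' := by
  have hloc : LocallyIntegrableOn (g - g' : L2 U) (U : Set (Space N)) := by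
    refine locallyIntegrableOn_of_locallyIntegrable_restrict ?_
    exact (Lp.memLp (g - g')).locallyIntegrable (by norm_num)
  have := U.isOpen.ae_eq_zero_of_integral_contDiff_smul_eq_zero (μ := volume) hloc ?_
  · rw [← sub_eq_zero]
    refine Lp.ext ?_
    filter_upwards [ae_restrict_of_ae this, ae_restrict_mem U.isOpen.measurableSet,
      Lp.coeFn_zero ℝ 2 (volume.restrict (U : Set (Space N)))] with x hx hxU h0
    rw [hx hxU, h0]
    rfl
  · intro ψ h1 h2 h3
    have hψ : IsTest U ψ := ⟨h1, h2, h3⟩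
    have e : ∫ x, ψ x • (g - g' : L2 U) x =
        ∫ x in (U : Set (Space N)), (g - g' : L2 U) x * ψ x := by
      rw [hψ.setIntegral_mul]
      simp [mul_comm]
    rw [e, ← sub_eq_zero.2 (h ψ hψ), ← integral_sub (hψ.integrable_mul g) (hψ.integrable_mul g')]
    refine integral_congr_ae ?_
    filter_upwards [Lp.coeFn_sub g g'] with x hx
    rw [hx, Pi.sub_apply, sub_mul]

/-- Weak derivatives are unique. -/
theorem HasWeakDeriv.unique {U : Opens (Space N)} {α : Fin N → ℕ} {u g g' : L2 U}
    (h : HasWeakDeriv U α u g) (h' : HasWeakDeriv U α u g') : g = g' := by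
  refine L2_eq_of_integral_mul_test fun ψ hψ => ?_
  have := (h ψ hψ).symm.trans (h' ψ hψ)
  exact mul_left_cancel₀ (pow_ne_zero _ (by norm_num)) this

/-- The weak derivatives of a test function are its classical derivatives. -/
theorem IsTest.hasWeakDeriv {U U' : Opens (Space N)} {φ : Space N → ℝ} (hφ : IsTest U' φ)
    (α : Fin N → ℕ) {u g : L2 U} (hu : u =ᵐ[volume.restrict (U : Set (Space N))] φ)
    (hg : g =ᵐ[volume.restrict (U : Set (Space N))] DomainPerturbation.multiDeriv α φ) :
    HasWeakDeriv U α u g := by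
  intro ψ hψ
  have h1 : ∫ x in (U : Set (Space N)), u x * DomainPerturbation.multiDeriv α ψ x =
      ∫ x in (U : Set (Space N)), φ x * DomainPerturbation.multiDeriv α ψ x :=
    integral_congr_ae (by filter_upwards [hu] with x hx; rw [hx])
  have h2 : ∫ x in (U : Set (Space N)), g x * ψ x =
      ∫ x in (U : Set (Space N)), DomainPerturbation.multiDeriv α φ x * ψ x :=
    integral_congr_ae (by filter_upwards [hg] with x hx; rw [hx])
  rw [h1, h2, (hψ.multiDeriv α).setIntegral_mul, hψ.setIntegral_mul,
    hφ.integral_mul_multiDeriv hψ]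

end

section

/-! ### Compactness of lower order derivatives by the Fourier transform -/

variable {N m : ℕ}

open scoped FourierTransform SchwartzMap LineDeriv

/-- The squared modulus of the symbol of `∂_{i₁} ⋯ ∂_{i_k}`. -/
def symbolSq (l : List (Fin N)) (ξ : Space N) : ℝ :=
  (l.map fun i => (2 * Real.pi * ξ i) ^ 2).prod

namespace IsTest

variable {U : Opens (Space N)} {φ : Space N → ℝ}

/-- A test function as a complex valued Schwartz function. -/
def schwartz (hφ : IsTest U φ) : 𝓢(Space N, ℂ) :=
  HasCompactSupport.toSchwartzMap (f := fun x => (φ x : ℂ))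
    (hφ.hasCompactSupport.comp_left (g := fun t : ℝ => (t : ℂ)) Complex.ofReal_zero)
    (Complex.ofRealCLM.contDiff.comp hφ.contDiff)

theorem schwartz_apply (hφ : IsTest U φ) (x : Space N) : hφ.schwartz x = φ x := rfl

theorem schwartz_partialDeriv (hφ : IsTest U φ) (i : Fin N) :
    (hφ.partialDeriv i).schwartz = ∂_{(EuclideanSpace.single i (1 : ℝ) : Space N)} hφ.schwartz := by
  ext x
  rw [SchwartzMap.lineDerivOp_apply_eq_fderiv, schwartz_apply]
  have h : HasFDerivAt (fun y => (φ y : ℂ)) (Complex.ofRealCLM.comp (fderiv ℝ φ x)) x :=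
    Complex.ofRealCLM.hasFDerivAt.comp x (hφ.differentiable x).hasFDerivAt
  have h' : fderiv ℝ (hφ.schwartz : Space N → ℂ) x = Complex.ofRealCLM.comp (fderiv ℝ φ x) :=
    h.fderiv
  rw [h']
  rfl

theorem norm_sq_fourier_iterPartial (hφ : IsTest U φ) (l : List (Fin N)) (ξ : Space N) :
    ‖𝓕 (hφ.iterPartial l).schwartz ξ‖ ^ 2 = symbolSq l ξ * ‖𝓕 hφ.schwartz ξ‖ ^ 2 := by
  induction l with
  | nil => simp [symbolSq]
  | cons i l ih =>
    have e : (hφ.iterPartial (i :: l)).schwartz =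
        ((hφ.iterPartial l).partialDeriv i).schwartz := rfl
    have ht : (fun y : Space N =>
        inner ℝ y (EuclideanSpace.single i (1 : ℝ) : Space N)).HasTemperateGrowth :=
      ((innerSL ℝ).flip (EuclideanSpace.single i (1 : ℝ) : Space N)).hasTemperateGrowth
    rw [e, (hφ.iterPartial l).schwartz_partialDeriv, SchwartzMap.fourier_lineDerivOp_eq,
      _root_.smul_apply, SchwartzMap.smulLeftCLM_apply_apply ht, norm_smul, norm_smul, mul_pow,
      mul_pow, ih]
    simp [symbolSq, EuclideanSpace.inner_single_right, mul_pow]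
    ring

theorem integral_iterPartial_sq (hφ : IsTest U φ) (l : List (Fin N)) :
    ∫ x, DomainPerturbation.iterPartial l φ x ^ 2 =
      ∫ ξ, symbolSq l ξ * ‖𝓕 hφ.schwartz ξ‖ ^ 2 := by
  simp_rw [← hφ.norm_sq_fourier_iterPartial l]
  rw [SchwartzMap.integral_norm_sq_fourier]
  simp [schwartz_apply]

theorem integrable_symbolSq_mul (hφ : IsTest U φ) (l : List (Fin N)) :
    Integrable fun ξ => symbolSq l ξ * ‖𝓕 hφ.schwartz ξ‖ ^ 2 := by
  simp_rw [← hφ.norm_sq_fourier_iterPartial l]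
  exact ((𝓕 (hφ.iterPartial l).schwartz).memLp 2 volume).integrable_norm_pow (by norm_num)

theorem norm_fourier_le (hφ : IsTest U φ) (ξ : Space N) :
    ‖𝓕 hφ.schwartz ξ‖ ≤ ∫ x, |φ x| := by
  refine (SchwartzMap.norm_fourier_apply_le_toLp_one _ _).trans_eq ?_
  simp [SchwartzMap.norm_toLp_one, schwartz_apply]

theorem fourier_apply (hφ : IsTest U φ) (ξ : Space N) :
    𝓕 hφ.schwartz ξ =
      ∫ x, Complex.exp ((-2 * Real.pi * inner ℝ x ξ : ℝ) * Complex.I) * (φ x : ℂ) := by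
  rw [SchwartzMap.fourier_coe, Real.fourier_eq']
  rfl

theorem integrable_exp_mul (hφ : IsTest U φ) (ξ : Space N) :
    Integrable fun x => Complex.exp ((-2 * Real.pi * inner ℝ x ξ : ℝ) * Complex.I) * (φ x : ℂ) := by
  refine Integrable.bdd_mul (c := 1) (memLp_one_iff_integrable.1 (hφ.memLp 1)).ofReal ?_ ?_
  · exact Continuous.aestronglyMeasurable (by fun_prop)
  · exact ae_of_all _ fun x => (Complex.norm_exp_ofReal_mul_I _).le

theorem fourier_re (hφ : IsTest U φ) (ξ : Space N) :
    (𝓕 hφ.schwartz ξ).re = ∫ x, φ x * Real.cos (2 * Real.pi * inner ℝ x ξ) := by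
  rw [fourier_apply, ← Complex.reCLM_apply, ← Complex.reCLM.integral_comp_comm
    (hφ.integrable_exp_mul ξ)]
  refine integral_congr_ae (ae_of_all _ fun x => ?_)
  simp only [Complex.reCLM_apply, Complex.re_mul_ofReal, Complex.exp_ofReal_mul_I_re]
  rw [mul_comm, neg_mul, neg_mul, Real.cos_neg]

theorem fourier_im (hφ : IsTest U φ) (ξ : Space N) :
    (𝓕 hφ.schwartz ξ).im = -∫ x, φ x * Real.sin (2 * Real.pi * inner ℝ x ξ) := by
  rw [fourier_apply, ← Complex.imCLM_apply, ← Complex.imCLM.integral_comp_comm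
    (hφ.integrable_exp_mul ξ), ← integral_neg]
  refine integral_congr_ae (ae_of_all _ fun x => ?_)
  simp only [Complex.imCLM_apply, Complex.im_mul_ofReal, Complex.exp_ofReal_mul_I_im]
  rw [mul_comm, neg_mul, neg_mul, Real.sin_neg, mul_neg]

end IsTest

theorem symbolSq_nonneg (l : List (Fin N)) (ξ : Space N) : 0 ≤ symbolSq l ξ :=
  List.prod_nonneg (by simp only [List.mem_map]; rintro _ ⟨i, -, rfl⟩; positivity)

/-- The square of the rescaled frequency `2πξ`. -/
def freqSq (ξ : Space N) : ℝ := ∑ i, (2 * Real.pi * ξ i) ^ 2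

theorem freqSq_nonneg (ξ : Space N) : 0 ≤ freqSq ξ := Finset.sum_nonneg fun _ _ => by positivity

theorem continuous_freqSq : Continuous (freqSq (N := N)) := by
  unfold freqSq
  fun_prop

theorem symbolSq_le (l : List (Fin N)) (ξ : Space N) : symbolSq l ξ ≤ freqSq ξ ^ l.length := by
  induction l with
  | nil => simp [symbolSq]
  | cons i l ih =>
    have h1 : (2 * Real.pi * ξ i) ^ 2 ≤ freqSq ξ :=
      Finset.single_le_sum (f := fun i => (2 * Real.pi * ξ i) ^ 2) (fun _ _ => by positivity)
        (Finset.mem_univ i)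
    have h2 : symbolSq (i :: l) ξ = (2 * Real.pi * ξ i) ^ 2 * symbolSq l ξ := by simp [symbolSq]
    rw [h2, List.length_cons, pow_succ' (freqSq ξ)]
    exact mul_le_mul h1 ih (symbolSq_nonneg l ξ) (freqSq_nonneg ξ)

theorem isBounded_freqSq_lt (R : ℝ) : Bornology.IsBounded {ξ : Space N | freqSq ξ < R} := by
  refine (Metric.isBounded_ball (x := (0 : Space N)) (r := √R + 1)).subset fun ξ hξ => ?_
  have h1 : ‖ξ‖ ^ 2 ≤ freqSq ξ := by
    rw [EuclideanSpace.norm_sq_eq]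
    refine Finset.sum_le_sum fun i _ => ?_
    rw [mul_pow, Real.norm_eq_abs, sq_abs]
    have : 1 ≤ (2 * Real.pi) ^ 2 := one_le_pow₀ (by linarith [Real.pi_gt_three])
    nlinarith [sq_nonneg (ξ i)]
  rw [mem_ball_zero_iff]
  have : ‖ξ‖ ≤ √R := Real.le_sqrt_of_sq_le (h1.trans (le_of_lt hξ))
  linarith

/-- The multi-index `m e_i`. -/
def pureIndex (m : ℕ) (i : Fin N) : MultiIndex N m :=
  ⟨Pi.single i m, by simp⟩

theorem directions_pureIndex (i : Fin N) :
    directions (pureIndex m i).1 = List.replicate m i := by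
  refine List.eq_replicate_iff.2 ⟨?_, ?_⟩
  · rw [length_directions]
    exact (pureIndex m i).2
  · intro j hj
    obtain ⟨k, -, hk⟩ := List.mem_flatMap.1 hj
    obtain ⟨hne, rfl⟩ := List.mem_replicate.1 hk
    by_contra h
    exact hne (by simp [pureIndex, h])

theorem symbolSq_directions_pureIndex (i : Fin N) (ξ : Space N) :
    symbolSq (directions (pureIndex m i).1) ξ = ((2 * Real.pi * ξ i) ^ 2) ^ m := by
  unfold symbolSq
  rw [directions_pureIndex]
  simp

/-- At high frequencies the symbols of order `< m` are small compared with those of order `m`. -/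
theorem symbolSq_le_of_le_freqSq {l : List (Fin N)} (hl : l.length < m) {R : ℝ} (hR : 1 ≤ R)
    {ξ : Space N} (hξ : R ≤ freqSq ξ) :
    symbolSq l ξ ≤ (N : ℝ) ^ (m - 1) / R * ∑ i, symbolSq (directions (pureIndex m i).1) ξ := by
  obtain ⟨k, rfl⟩ : ∃ k, m = k + 1 := ⟨m - 1, by omega⟩
  have hR0 : 0 < R := by linarith
  simp_rw [symbolSq_directions_pureIndex]
  have hN : 0 < N := by
    rcases Nat.eq_zero_or_pos N with rfl | h
    · simp [freqSq] at hξ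
      linarith
    · exact h
  have h2 : freqSq ξ ^ (k + 1) ≤ (N : ℝ) ^ k * ∑ i, ((2 * Real.pi * ξ i) ^ 2) ^ (k + 1) := by
    have := pow_sum_div_card_le_sum_pow (s := Finset.univ)
      (f := fun i => (2 * Real.pi * ξ i) ^ 2) (fun _ _ => by positivity) k
    rw [div_le_iff₀ (by simp; positivity), Finset.card_univ, Fintype.card_fin] at this
    rw [mul_comm]
    exact this
  calc symbolSq l ξ ≤ freqSq ξ ^ l.length := symbolSq_le l ξ
    _ ≤ freqSq ξ ^ k := pow_le_pow_right₀ (hR.trans hξ) (by omega)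
    _ ≤ freqSq ξ ^ (k + 1) / R := by
      rw [le_div_iff₀ hR0, pow_succ]
      exact mul_le_mul_of_nonneg_left hξ (pow_nonneg (freqSq_nonneg _) _)
    _ ≤ ((N : ℝ) ^ k * ∑ i, ((2 * Real.pi * ξ i) ^ 2) ^ (k + 1)) / R := by gcongr
    _ = _ := by simp; ring

/-- Rellich's theorem: if test functions `φ_n` on a bounded open set `D` are bounded in
`W^{m,2}` and converge weakly to `0`, then all their derivatives of order less than `m` converge
to `0` in `L²`. -/
theorem tendsto_integral_iterPartial_sq {D : Opens (Space N)}
    (hD : Bornology.IsBounded (D : Set (Space N))) {φ : ℕ → Space N → ℝ}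
    (hφ : ∀ n, IsTest D (φ n)) {M : ℝ} (hM : ∀ n, ∫ x, φ n x ^ 2 ≤ M)
    (hMα : ∀ n (α : MultiIndex N m), ∫ x, multiDeriv α.1 (φ n) x ^ 2 ≤ M)
    (hw : ∀ g : Space N → ℝ, Continuous g →
      Tendsto (fun n => ∫ x, φ n x * g x) atTop (𝓝 0))
    {l : List (Fin N)} (hl : l.length < m) :
    Tendsto (fun n => ∫ x, iterPartial l (φ n) x ^ 2) atTop (𝓝 0) := by
  have hM0 : 0 ≤ M := (integral_nonneg fun _ => by positivity).trans (hM 0)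
  set f : ℕ → Space N → ℝ := fun n ξ => ‖𝓕 (hφ n).schwartz ξ‖ ^ 2 with hf
  -- Since the `φ n` live on a bounded set, their Fourier transforms are uniformly bounded.
  obtain ⟨L, hL⟩ : ∃ L : ℝ, ∀ n ξ, f n ξ ≤ L := by
    refine ⟨((volume.real (D : Set (Space N)) + M) / 2) ^ 2, fun n ξ => ?_⟩
    refine pow_le_pow_left₀ (norm_nonneg _) (((hφ n).norm_fourier_le ξ).trans ?_) 2
    have hfin : volume (D : Set (Space N)) ≠ ⊤ := hD.measure_lt_top.ne
    have hi1 : IntegrableOn (fun _ : Space N => (1 : ℝ)) (D : Set (Space N)) :=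
      integrableOn_const hfin
    have hi2 : Integrable fun x => φ n x ^ 2 := ((hφ n).memLp 2).integrable_sq
    calc ∫ x, |φ n x| = ∫ x in (D : Set (Space N)), |φ n x| := by
          rw [setIntegral_eq_integral_of_forall_compl_eq_zero]
          intro x hx
          rw [(hφ n).eq_zero_of_notMem hx, abs_zero]
      _ ≤ ∫ x in (D : Set (Space N)), (1 + φ n x ^ 2) / 2 := by
          refine integral_mono_of_nonneg (ae_of_all _ fun _ => abs_nonneg _)
            ((hi1.add hi2.integrableOn).div_const 2) (ae_of_all _ fun x => ?_)
          change |φ n x| ≤ (1 + φ n x ^ 2) / 2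
          nlinarith [sq_nonneg (|φ n x| - 1), sq_abs (φ n x)]
      _ = (volume.real (D : Set (Space N)) + ∫ x in (D : Set (Space N)), φ n x ^ 2) / 2 := by
          rw [integral_div, integral_add hi1 hi2.integrableOn]
          simp
      _ ≤ _ := by
          have : ∫ x in (D : Set (Space N)), φ n x ^ 2 ≤ ∫ x, φ n x ^ 2 :=
            setIntegral_le_integral hi2 (ae_of_all _ fun x => sq_nonneg _)
          linarith [hM n]
  have hf0 : ∀ n ξ, 0 ≤ f n ξ := fun n ξ => by positivity
  have hfc : ∀ n, Continuous (f n) := fun n => by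
    exact (SchwartzMap.continuous (𝓕 (hφ n).schwartz)).norm.pow 2
  have hlim : ∀ ξ, Tendsto (fun n => f n ξ) atTop (𝓝 0) := by
    intro ξ
    have h1 := hw (fun x => Real.cos (2 * Real.pi * inner ℝ x ξ)) (by fun_prop)
    have h2 := hw (fun x => Real.sin (2 * Real.pi * inner ℝ x ξ)) (by fun_prop)
    have e : ∀ n, f n ξ = (∫ x, φ n x * Real.cos (2 * Real.pi * inner ℝ x ξ)) ^ 2 +
        (∫ x, φ n x * Real.sin (2 * Real.pi * inner ℝ x ξ)) ^ 2 := by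
      intro n
      rw [hf]
      simp only [Complex.sq_norm, Complex.normSq_apply, (hφ n).fourier_re, (hφ n).fourier_im]
      ring
    simp_rw [e]
    simpa using (h1.pow 2).add (h2.pow 2)
  -- Low frequencies: dominated convergence on a bounded set.
  have hlow : ∀ R : ℝ, Tendsto (fun n => ∫ ξ in {ξ | freqSq ξ < R}, f n ξ) atTop (𝓝 0) := by
    intro R
    have hfin : volume {ξ : Space N | freqSq ξ < R} ≠ ⊤ :=
      (isBounded_freqSq_lt R).measure_lt_top.ne
    rw [← integral_zero (Space N) ℝ (μ := volume.restrict {ξ | freqSq ξ < R})]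
    refine tendsto_integral_of_dominated_convergence (fun _ => L)
      (fun n => (hfc n).aestronglyMeasurable) (integrableOn_const hfin) (fun n => ?_)
      (ae_of_all _ hlim)
    exact ae_of_all _ fun ξ => by rw [Real.norm_of_nonneg (hf0 n ξ)]; exact hL n ξ
  have hmeas : ∀ R : ℝ, MeasurableSet {ξ : Space N | freqSq ξ < R} := fun R =>
    (isOpen_lt continuous_freqSq continuous_const).measurableSet
  -- High frequencies are controlled, up to the factor `1 / R`, by the derivatives of order `m`.
  have hbound : ∀ R : ℝ, 1 ≤ R → ∀ n, ∫ x, iterPartial l (φ n) x ^ 2 ≤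
      R ^ m * (∫ ξ in {ξ | freqSq ξ < R}, f n ξ) + (N : ℝ) ^ (m - 1) / R * (N * M) := by
    intro R hR n
    have hint : ∀ i : Fin N, Integrable fun ξ =>
        symbolSq (directions (pureIndex m i).1) ξ * f n ξ :=
      fun i => (hφ n).integrable_symbolSq_mul _
    have hfi : Integrable (f n) := by simpa [symbolSq] using (hφ n).integrable_symbolSq_mul []
    have hs : ∀ i : Fin N, ∫ ξ, symbolSq (directions (pureIndex m i).1) ξ * f n ξ ≤ M := by
      intro i
      rw [← (hφ n).integral_iterPartial_sq, ← multiDeriv_eq_iterPartial]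
      exact hMα n _
    rw [(hφ n).integral_iterPartial_sq l]
    calc ∫ ξ, symbolSq l ξ * f n ξ ≤
        ∫ ξ, (R ^ m * {ξ | freqSq ξ < R}.indicator (f n) ξ + (N : ℝ) ^ (m - 1) / R *
          ∑ i, symbolSq (directions (pureIndex m i).1) ξ * f n ξ) := by
          refine integral_mono ((hφ n).integrable_symbolSq_mul l) ?_ fun ξ => ?_
          · exact ((hfi.indicator (hmeas R)).const_mul _).add
              ((integrable_finsetSum _ fun i _ => hint i).const_mul _)
          · have hsum : 0 ≤ (N : ℝ) ^ (m - 1) / R *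
                ∑ i, symbolSq (directions (pureIndex m i).1) ξ * f n ξ :=
              mul_nonneg (by positivity) (Finset.sum_nonneg fun i _ =>
                mul_nonneg (symbolSq_nonneg _ _) (hf0 n ξ))
            by_cases h : freqSq ξ < R
            · have h1 : symbolSq l ξ ≤ R ^ m := (symbolSq_le l ξ).trans
                ((pow_le_pow_left₀ (freqSq_nonneg ξ) h.le _).trans
                  (pow_le_pow_right₀ hR hl.le))
              have := mul_le_mul_of_nonneg_right h1 (hf0 n ξ)
              simp only [Set.indicator_of_mem (show ξ ∈ {ξ | freqSq ξ < R} from h)]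
              linarith
            · have h1 := mul_le_mul_of_nonneg_right
                (symbolSq_le_of_le_freqSq hl hR (not_lt.1 h)) (hf0 n ξ)
              rw [mul_assoc, Finset.sum_mul] at h1
              simp only [Set.indicator_of_notMem (show ξ ∉ {ξ | freqSq ξ < R} from h)]
              linarith
      _ = R ^ m * (∫ ξ in {ξ | freqSq ξ < R}, f n ξ) + (N : ℝ) ^ (m - 1) / R *
          ∑ i, ∫ ξ, symbolSq (directions (pureIndex m i).1) ξ * f n ξ := by
          rw [integral_add ((hfi.indicator (hmeas R)).const_mul _)
            ((integrable_finsetSum _ fun i _ => hint i).const_mul _), integral_const_mul,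
            integral_const_mul, integral_indicator (hmeas R),
            integral_finsetSum _ fun i _ => hint i]
      _ ≤ _ := by
          have : ∑ i : Fin N, ∫ ξ, symbolSq (directions (pureIndex m i).1) ξ * f n ξ ≤ N * M := by
            refine (Finset.sum_le_sum fun i _ => hs i).trans_eq ?_
            simp
          gcongr
  rw [Metric.tendsto_atTop]
  intro δ hδ
  obtain ⟨R, hR1, hR⟩ : ∃ R : ℝ, 1 ≤ R ∧ (N : ℝ) ^ (m - 1) / R * (N * M) < δ / 2 := by
    have : Tendsto (fun R : ℝ => (N : ℝ) ^ (m - 1) / R * (N * M)) atTop (𝓝 0) := by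
      simpa using (tendsto_const_nhds.div_atTop tendsto_id).mul_const ((N : ℝ) * M)
    obtain ⟨R, h1, h2⟩ := ((eventually_ge_atTop (1 : ℝ)).and
      (this.eventually_lt_const (half_pos hδ))).exists
    exact ⟨R, h1, h2⟩
  have h3 : Tendsto (fun n => R ^ m * (∫ ξ in {ξ | freqSq ξ < R}, f n ξ)) atTop (𝓝 0) := by
    simpa using (hlow R).const_mul (R ^ m)
  obtain ⟨n₀, hn₀⟩ := eventually_atTop.1 (h3.eventually_lt_const (half_pos hδ))
  refine ⟨n₀, fun n hn => ?_⟩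
  rw [Real.dist_eq, sub_zero, abs_of_nonneg (integral_nonneg fun _ => sq_nonneg _)]
  linarith [hbound R hR1 n, hn₀ n hn]

end

section

/-! ### Commutators of derivatives and cutoffs -/

variable {N m : ℕ}

theorem IsTest.eLpNorm_eq {U : Opens (Space N)} {φ : Space N → ℝ} (hφ : IsTest U φ) :
    eLpNorm φ 2 volume = ENNReal.ofReal √(∫ x, φ x ^ 2) := by
  rw [(hφ.memLp 2).eLpNorm_eq_integral_rpow_norm (by norm_num) (by norm_num), Real.sqrt_eq_rpow]
  simp

theorem IsTest.tendsto_eLpNorm_mul {U : Opens (Space N)} {χ : Space N → ℝ} (hχ : IsTest U χ)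
    {φ : ℕ → Space N → ℝ} (h : Tendsto (fun n => eLpNorm (φ n) 2 volume) atTop (𝓝 0)) :
    Tendsto (fun n => eLpNorm (fun x => χ x * φ n x) 2 volume) atTop (𝓝 0) := by
  obtain ⟨C, hC⟩ := hχ.hasCompactSupport.exists_bound_of_continuous hχ.continuous
  refine tendsto_of_tendsto_of_tendsto_of_le_of_le tendsto_const_nhds
    (h := fun n => ENNReal.ofReal C * eLpNorm (φ n) 2 volume) ?_ (fun _ => zero_le) fun n => ?_
  · simpa using ENNReal.Tendsto.const_mul h (Or.inr ENNReal.ofReal_ne_top)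
  · refine eLpNorm_le_mul_eLpNorm_of_ae_le_mul (ae_of_all _ fun x => ?_) 2
    rw [norm_mul]
    exact mul_le_mul_of_nonneg_right (hC x) (norm_nonneg _)

/-- If the derivatives of `φ_n` of order less than `|l|` tend to `0` in `L²`, then so does the
commutator of `∂_l` and the multiplication by a test function, applied to `φ_n`. -/
theorem IsTest.tendsto_eLpNorm_commutator {U D : Opens (Space N)} {χ : Space N → ℝ}
    (hχ : IsTest U χ) {φ : ℕ → Space N → ℝ} (hφ : ∀ n, IsTest D (φ n)) (l : List (Fin N))
    (h : ∀ l' : List (Fin N), l'.length < l.length →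
      Tendsto (fun n => eLpNorm (DomainPerturbation.iterPartial l' (φ n)) 2 volume) atTop (𝓝 0)) :
    Tendsto (fun n => eLpNorm (fun x => DomainPerturbation.iterPartial l (fun y => χ y * φ n y) x -
      χ x * DomainPerturbation.iterPartial l (φ n) x) 2 volume) atTop (𝓝 0) := by
  induction l using List.reverseRecOn generalizing χ φ with
  | nil => simp
  | append_singleton l i ih =>
    -- `[∂_l ∂_i, χ] φ = [∂_l, χ] ∂_i φ + [∂_l, ∂_i χ] φ + (∂_i χ) ∂_l φ`.
    have h1 := ih hχ (fun n => (hφ n).partialDeriv i) fun l' hl' => by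
      simpa only [iterPartial_append, iterPartial_cons, iterPartial_nil] using
        h (l' ++ [i]) (by simpa using hl')
    have h2 := ih (hχ.partialDeriv i) hφ fun l' hl' => h l' (by simp; omega)
    have h3 := (hχ.partialDeriv i).tendsto_eLpNorm_mul (h l (by simp))
    refine tendsto_of_tendsto_of_tendsto_of_le_of_le tendsto_const_nhds
      (by simpa using (h1.add h2).add h3) (fun _ => zero_le) fun n => ?_
    have c1 := ((hχ.mul_left ((hφ n).partialDeriv i)).iterPartial l).continuous
    have c2 := hχ.continuous.mul (((hφ n).partialDeriv i).iterPartial l).continuous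
    have c3 := (((hχ.partialDeriv i).mul_left (hφ n)).iterPartial l).continuous
    have c4 := (hχ.partialDeriv i).continuous.mul ((hφ n).iterPartial l).continuous
    refine le_trans (le_of_eq ?_) ((eLpNorm_add_le
      ((c1.sub c2).add (c3.sub c4)).aestronglyMeasurable c4.aestronglyMeasurable
        (by norm_num)).trans (add_le_add_left (eLpNorm_add_le (c1.sub c2).aestronglyMeasurable
          (c3.sub c4).aestronglyMeasurable (by norm_num)) _))
    congr 1
    ext x
    simp only [iterPartial_append, iterPartial_cons, iterPartial_nil]
    rw [hχ.partialDeriv_mul (hφ n) i, (hχ.mul_left ((hφ n).partialDeriv i)).iterPartial_add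
      ((hχ.partialDeriv i).mul_left (hφ n))]
    simp
    ring

end

section

/-! ### Families of functions on the whole space -/

theorem jet_ext {ι E : Type*} {x y : WithLp 2 (E × PiLp 2 (fun _ : ι => E))} (h : x.fst = y.fst)
    (h' : ∀ α, x.snd α = y.snd α) : x = y := by
  have h2 : x.snd = y.snd := by ext α; exact h' α
  obtain ⟨⟨x1, x2⟩⟩ := x
  obtain ⟨⟨y1, y2⟩⟩ := y
  cases h
  cases h2
  rfl

section JetMap

variable {ι E F : Type*} [NormedAddCommGroup E] [InnerProductSpace ℝ E]
  [NormedAddCommGroup F] [InnerProductSpace ℝ F]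

theorem jet_inner [Fintype ι] (x y : WithLp 2 (E × PiLp 2 (fun _ : ι => E))) :
    inner ℝ x y = inner ℝ x.fst y.fst + ∑ α, inner ℝ (x.snd α) (y.snd α) := by
  rw [WithLp.prod_inner_apply, PiLp.inner_apply]
  rfl

theorem jet_norm_sq [Fintype ι] (x : WithLp 2 (E × PiLp 2 (fun _ : ι => E))) :
    ‖x‖ ^ 2 = ‖x.fst‖ ^ 2 + ∑ α, ‖x.snd α‖ ^ 2 := by
  simp_rw [← real_inner_self_eq_norm_sq, jet_inner]

theorem jet_norm_fst_le [Fintype ι] (x : WithLp 2 (E × PiLp 2 (fun _ : ι => E))) : ‖x.fst‖ ≤ ‖x‖ := by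
  refine le_of_sq_le_sq ?_ (norm_nonneg _)
  rw [jet_norm_sq]
  exact le_add_of_nonneg_right (Finset.sum_nonneg fun _ _ => sq_nonneg _)

/-- The continuous projection of a family to its component of order zero. -/
def jetFst : WithLp 2 (E × PiLp 2 (fun _ : ι => E)) →L[ℝ] E :=
  (ContinuousLinearMap.fst ℝ E (PiLp 2 (fun _ : ι => E))).comp
    (WithLp.prodContinuousLinearEquiv 2 ℝ E (PiLp 2 (fun _ : ι => E))).toContinuousLinearMap

/-- The continuous projection of a family to its component with index `α`. -/
def jetSnd (α : ι) : WithLp 2 (E × PiLp 2 (fun _ : ι => E)) →L[ℝ] E :=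
  ((PiLp.proj 2 (fun _ : ι => E) α : PiLp 2 (fun _ : ι => E) →L[ℝ] E).comp
    (ContinuousLinearMap.snd ℝ E (PiLp 2 (fun _ : ι => E)))).comp
    (WithLp.prodContinuousLinearEquiv 2 ℝ E (PiLp 2 (fun _ : ι => E))).toContinuousLinearMap

@[simp] theorem jetFst_apply (x : WithLp 2 (E × PiLp 2 (fun _ : ι => E))) :
    jetFst x = x.fst := rfl

/-- The componentwise action of an operator on families `(u, (g_α))`. -/
def jetMap (T : E →L[ℝ] F) :
    WithLp 2 (E × PiLp 2 (fun _ : ι => E)) →L[ℝ] WithLp 2 (F × PiLp 2 (fun _ : ι => F)) :=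
  (WithLp.prodContinuousLinearEquiv 2 ℝ F (PiLp 2 (fun _ : ι => F))).symm.toContinuousLinearMap.comp
    ((T.comp jetFst).prod
      ((PiLp.continuousLinearEquiv 2 ℝ (fun _ : ι => F)).symm.toContinuousLinearMap.comp
        (ContinuousLinearMap.pi fun α => T.comp (jetSnd α))))

@[simp] theorem jetMap_fst (T : E →L[ℝ] F) (x : WithLp 2 (E × PiLp 2 (fun _ : ι => E))) :
    (jetMap T x).fst = T x.fst := rfl

@[simp] theorem jetMap_snd (T : E →L[ℝ] F) (x : WithLp 2 (E × PiLp 2 (fun _ : ι => E))) (α : ι) :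
    (jetMap T x).snd α = T (x.snd α) := rfl

theorem jetMap_norm_le [Fintype ι] {T : E →L[ℝ] F} (h : ∀ u, ‖T u‖ ≤ ‖u‖)
    (x : WithLp 2 (E × PiLp 2 (fun _ : ι => E))) : ‖jetMap T x‖ ≤ ‖x‖ := by
  refine le_of_sq_le_sq ?_ (norm_nonneg _)
  simp only [jet_norm_sq, jetMap_fst, jetMap_snd]
  gcongr <;> exact h _

theorem jetMap_norm [Fintype ι] {T : E →L[ℝ] F} (h : ∀ u, ‖T u‖ = ‖u‖)
    (x : WithLp 2 (E × PiLp 2 (fun _ : ι => E))) : ‖jetMap T x‖ = ‖x‖ := by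
  rw [← sq_eq_sq₀ (norm_nonneg _) (norm_nonneg _)]
  simp only [jet_norm_sq, jetMap_fst, jetMap_snd, h]

end JetMap

variable {N m : ℕ}

/-- The real Hilbert space `L²(ℝ^N)`. -/
abbrev GlobalL2 (N : ℕ) := Lp ℝ 2 (volume : Measure (Space N))

/-- Families `(u, (g_α)_{|α| = m})` of elements of `L²(ℝ^N)`. All the spaces `W^{m,2}_0(U)` are
isometrically embedded here by extension by zero, without any condition on `U`. -/
abbrev GlobalJet (N m : ℕ) := WithLp 2 (GlobalL2 N × PiLp 2 (fun _ : MultiIndex N m => GlobalL2 N))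

theorem L2_inner_eq {μ : Measure (Space N)} (f g : Lp ℝ 2 μ) :
    inner ℝ f g = ∫ x, f x * g x ∂μ := by
  rw [L2.inner_def]
  simp [mul_comm]

theorem L2_integrable_mul {μ : Measure (Space N)} (f g : Lp ℝ 2 μ) :
    Integrable (fun x => f x * g x) μ :=
  MemLp.integrable_mul (p := 2) (q := 2) (Lp.memLp f) (Lp.memLp g)

/-- `b` is measurable and bounded. -/
def IsBoundedMeasurable (b : Space N → ℝ) : Prop := Measurable b ∧ ∃ C : ℝ, ∀ x, |b x| ≤ C

theorem IsBoundedMeasurable.memLp_mul {b : Space N → ℝ} (hb : IsBoundedMeasurable b)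
    {f : Space N → ℝ} (hf : MemLp f 2) : MemLp (fun x => b x * f x) 2 := by
  obtain ⟨C, hC⟩ := hb.2
  refine hf.of_le_mul (c := C) (hb.1.aestronglyMeasurable.mul hf.1) (ae_of_all _ fun x => ?_)
  rw [norm_mul]
  exact mul_le_mul_of_nonneg_right (hC x) (norm_nonneg _)

/-- The multiplication by a bounded measurable function, as an operator on `L²(ℝ^N)`. -/
def mulOp (b : Space N → ℝ) (hb : IsBoundedMeasurable b) : GlobalL2 N →L[ℝ] GlobalL2 N :=
  LinearMap.mkContinuousOfExistsBound
    { toFun := fun f => (hb.memLp_mul (Lp.memLp f)).toLp _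
      map_add' := fun f g => by
        refine Lp.ext ?_
        filter_upwards [(hb.memLp_mul (Lp.memLp (f + g))).coeFn_toLp,
          (hb.memLp_mul (Lp.memLp f)).coeFn_toLp, (hb.memLp_mul (Lp.memLp g)).coeFn_toLp,
          Lp.coeFn_add f g, Lp.coeFn_add ((hb.memLp_mul (Lp.memLp f)).toLp _)
            ((hb.memLp_mul (Lp.memLp g)).toLp _)] with x h1 h2 h3 h4 h5
        rw [h1, h5, Pi.add_apply, h2, h3, h4, Pi.add_apply, mul_add]
      map_smul' := fun c f => by
        refine Lp.ext ?_
        filter_upwards [(hb.memLp_mul (Lp.memLp (c • f))).coeFn_toLp,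
          (hb.memLp_mul (Lp.memLp f)).coeFn_toLp, Lp.coeFn_smul c f,
          Lp.coeFn_smul c ((hb.memLp_mul (Lp.memLp f)).toLp _)] with x h1 h2 h3 h4
        rw [h1, RingHom.id_apply, h4, Pi.smul_apply, h2, h3, Pi.smul_apply, smul_eq_mul,
          smul_eq_mul, mul_left_comm] }
    (by
      obtain ⟨C, hC⟩ := hb.2
      refine ⟨C, fun f => ?_⟩
      refine Lp.norm_le_mul_norm_of_ae_le_mul ?_
      filter_upwards [(hb.memLp_mul (Lp.memLp f)).coeFn_toLp] with x h1
      change ‖(hb.memLp_mul (Lp.memLp f)).toLp _ x‖ ≤ _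
      rw [h1, norm_mul]
      exact mul_le_mul_of_nonneg_right (hC x) (norm_nonneg _))

theorem mulOp_ae {b : Space N → ℝ} (hb : IsBoundedMeasurable b) (f : GlobalL2 N) :
    mulOp b hb f =ᵐ[volume] fun x => b x * f x :=
  (hb.memLp_mul (Lp.memLp f)).coeFn_toLp

theorem mulOp_inner {b : Space N → ℝ} (hb : IsBoundedMeasurable b) (f g : GlobalL2 N) :
    inner ℝ (mulOp b hb f) g = ∫ x, b x * f x * g x := by
  rw [L2_inner_eq]
  refine integral_congr_ae ?_
  filter_upwards [mulOp_ae hb f] with x hx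
  rw [hx]

theorem mulOp_symm {b : Space N → ℝ} (hb : IsBoundedMeasurable b) (f g : GlobalL2 N) :
    inner ℝ (mulOp b hb f) g = inner ℝ f (mulOp b hb g) := by
  rw [mulOp_inner, real_inner_comm, mulOp_inner]
  exact integral_congr_ae (ae_of_all _ fun x => by ring)

theorem isBoundedMeasurable_indicator {S : Set (Space N)} (hS : MeasurableSet S) :
    IsBoundedMeasurable (S.indicator (1 : Space N → ℝ)) := by
  refine ⟨measurable_one.indicator hS, 1, fun x => ?_⟩
  by_cases h : x ∈ S <;> simp [h]

/-- The multiplication by the indicator function of `S`. -/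
def cut (S : Set (Space N)) (hS : MeasurableSet S) : GlobalL2 N →L[ℝ] GlobalL2 N :=
  mulOp _ (isBoundedMeasurable_indicator hS)

theorem cut_ae {S : Set (Space N)} (hS : MeasurableSet S) (f : GlobalL2 N) :
    cut S hS f =ᵐ[volume] S.indicator f := by
  filter_upwards [mulOp_ae (isBoundedMeasurable_indicator hS) f] with x hx
  rw [cut, hx]
  by_cases h : x ∈ S <;> simp [h]

theorem cut_norm_le {S : Set (Space N)} (hS : MeasurableSet S) (f : GlobalL2 N) :
    ‖cut S hS f‖ ≤ ‖f‖ := by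
  refine Lp.norm_le_norm_of_ae_le ?_
  filter_upwards [cut_ae hS f] with x hx
  rw [hx]
  exact norm_indicator_le_norm_self _ _

theorem cut_norm_sq {S : Set (Space N)} (hS : MeasurableSet S) (f : GlobalL2 N) :
    ‖cut S hS f‖ ^ 2 = ∫ x in S, f x ^ 2 := by
  rw [← real_inner_self_eq_norm_sq, L2_inner_eq, ← integral_indicator hS]
  refine integral_congr_ae ?_
  filter_upwards [cut_ae hS f] with x hx
  rw [hx]
  by_cases h : x ∈ S <;> simp [h, sq]

/-! ### Extension by zero and restriction -/

variable {U U' D : Opens (Space N)}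

theorem memLp_indicator_coe (u : L2 U) : MemLp ((U : Set (Space N)).indicator u) 2 volume :=
  (memLp_indicator_iff_restrict U.isOpen.measurableSet).2 (Lp.memLp u)

/-- Extension by zero `L²(U) → L²(ℝ^N)`. -/
def extL2 (U : Opens (Space N)) : L2 U →ₗᵢ[ℝ] GlobalL2 N where
  toFun u := (memLp_indicator_coe u).toLp _
  map_add' u v := by
    refine Lp.ext ?_
    filter_upwards [(memLp_indicator_coe (u + v)).coeFn_toLp, (memLp_indicator_coe u).coeFn_toLp,
      (memLp_indicator_coe v).coeFn_toLp,
      (ae_restrict_iff' U.isOpen.measurableSet).1 (Lp.coeFn_add u v),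
      Lp.coeFn_add ((memLp_indicator_coe u).toLp _) ((memLp_indicator_coe v).toLp _)]
      with x h1 h2 h3 h4 h5
    rw [h1, h5, Pi.add_apply, h2, h3]
    by_cases h : x ∈ (U : Set (Space N))
    · rw [Set.indicator_of_mem h, Set.indicator_of_mem h, Set.indicator_of_mem h, h4 h,
        Pi.add_apply]
    · simp [h]
  map_smul' c u := by
    refine Lp.ext ?_
    filter_upwards [(memLp_indicator_coe (c • u)).coeFn_toLp, (memLp_indicator_coe u).coeFn_toLp,
      (ae_restrict_iff' U.isOpen.measurableSet).1 (Lp.coeFn_smul c u),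
      Lp.coeFn_smul c ((memLp_indicator_coe u).toLp _)]
      with x h1 h2 h3 h4
    rw [h1, RingHom.id_apply, h4, Pi.smul_apply, h2]
    by_cases h : x ∈ (U : Set (Space N))
    · simp [h, h3 h]
    · simp [h]
  norm_map' u := by
    change ‖(memLp_indicator_coe u).toLp _‖ = ‖u‖
    rw [Lp.norm_toLp, eLpNorm_indicator_eq_eLpNorm_restrict U.isOpen.measurableSet, Lp.norm_def]

theorem extL2_ae (u : L2 U) : extL2 U u =ᵐ[volume] (U : Set (Space N)).indicator u :=
  (memLp_indicator_coe u).coeFn_toLp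

/-- Restriction `L²(ℝ^N) → L²(U)`. -/
def resL2 (U : Opens (Space N)) : GlobalL2 N →L[ℝ] L2 U :=
  LpToLpRestrictCLM (Space N) ℝ ℝ volume 2 U

theorem resL2_ae (f : GlobalL2 N) : resL2 U f =ᵐ[volume.restrict (U : Set (Space N))] f :=
  LpToLpRestrictCLM_coeFn ℝ _ f

theorem extL2_ae_restrict (u : L2 U) :
    extL2 U u =ᵐ[volume.restrict (U : Set (Space N))] u := by
  filter_upwards [ae_restrict_of_ae (extL2_ae u), ae_restrict_mem U.isOpen.measurableSet]
    with x h1 h2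
  rw [h1, Set.indicator_of_mem h2]

@[simp] theorem resL2_extL2 (u : L2 U) : resL2 U (extL2 U u) = u :=
  Lp.ext ((resL2_ae _).trans (extL2_ae_restrict u))

theorem extL2_resL2 (f : GlobalL2 N) :
    extL2 U (resL2 U f) = cut U U.isOpen.measurableSet f := by
  refine Lp.ext ?_
  filter_upwards [extL2_ae (resL2 U f), cut_ae U.isOpen.measurableSet f,
    (ae_restrict_iff' U.isOpen.measurableSet).1 (resL2_ae (U := U) f)] with x h1 h2 h3
  rw [h1, h2]
  by_cases h : x ∈ (U : Set (Space N))
  · simp [h, h3 h]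
  · simp [h]

theorem zeroExt_eq (u : L2 U) : zeroExt U' u = resL2 U' (extL2 U u) := by
  refine Lp.ext ?_
  have h : extL2 U u =ᵐ[volume.restrict (U' : Set (Space N))] (U : Set (Space N)).indicator u :=
    ae_restrict_of_ae (extL2_ae u)
  exact (MemLp.coeFn_toLp _).trans (h.symm.trans (resL2_ae _).symm)

end

section

/-! ### The spaces `W^{m,2}_0` inside one Hilbert space -/

variable {N m : ℕ} {U U' D : Opens (Space N)}

/-- The family `(φ, (D^α φ)_{|α| = m})` of a test function `φ`. -/
def IsTest.globalJet (m : ℕ) {φ : Space N → ℝ} (hφ : IsTest U φ) : GlobalJet N m :=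
  WithLp.toLp 2 ((hφ.memLp 2).toLp φ,
    WithLp.toLp 2 fun α : MultiIndex N m => ((hφ.multiDeriv α.1).memLp 2).toLp _)

theorem IsTest.globalJet_fst_ae (m : ℕ) {φ : Space N → ℝ} (hφ : IsTest U φ) :
    (hφ.globalJet m).fst =ᵐ[volume] φ := (hφ.memLp 2).coeFn_toLp

theorem IsTest.globalJet_snd_ae {φ : Space N → ℝ} (hφ : IsTest U φ) (α : MultiIndex N m) :
    (hφ.globalJet m).snd α =ᵐ[volume] DomainPerturbation.multiDeriv α.1 φ :=
  ((hφ.multiDeriv α.1).memLp 2).coeFn_toLp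

/-- The families given by test functions on `U`. -/
def globalTest (m : ℕ) (U : Opens (Space N)) : Submodule ℝ (GlobalJet N m) where
  carrier := {x | ∃ (φ : Space N → ℝ) (hφ : IsTest U φ), hφ.globalJet m = x}
  add_mem' := by
    rintro _ _ ⟨φ, hφ, rfl⟩ ⟨ψ, hψ, rfl⟩
    refine ⟨φ + ψ, hφ.add hψ, jet_ext (Lp.ext ?_) fun α => Lp.ext ?_⟩
    · filter_upwards [(hφ.add hψ).globalJet_fst_ae m, hφ.globalJet_fst_ae m,
        hψ.globalJet_fst_ae m,
        Lp.coeFn_add (hφ.globalJet m).fst (hψ.globalJet m).fst] with x h1 h2 h3 h4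
      rw [h1]
      refine Eq.trans ?_ h4.symm
      rw [Pi.add_apply, Pi.add_apply, h2, h3]
    · filter_upwards [(hφ.add hψ).globalJet_snd_ae α, hφ.globalJet_snd_ae α,
        hψ.globalJet_snd_ae α,
        Lp.coeFn_add ((hφ.globalJet m).snd α) ((hψ.globalJet m).snd α)] with x h1 h2 h3 h4
      rw [h1]
      refine Eq.trans ?_ h4.symm
      rw [Pi.add_apply, h2, h3]
      simp only [multiDeriv_eq_iterPartial, hφ.iterPartial_add hψ, Pi.add_apply]
  zero_mem' := by
    refine ⟨0, IsTest.zero U, jet_ext (Lp.ext ?_) fun α => Lp.ext ?_⟩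
    · exact ((IsTest.zero U).globalJet_fst_ae m).trans (Lp.coeFn_zero ℝ 2 _).symm
    · refine ((IsTest.zero U).globalJet_snd_ae α).trans
        (EventuallyEq.trans (EventuallyEq.of_eq ?_) (Lp.coeFn_zero ℝ 2 _).symm)
      have := (IsTest.zero U).iterPartial_smul 0 (directions α.1)
      rwa [zero_smul, zero_smul, ← multiDeriv_eq_iterPartial] at this
  smul_mem' := by
    rintro c _ ⟨φ, hφ, rfl⟩
    refine ⟨c • φ, hφ.const_smul c, jet_ext (Lp.ext ?_) fun α => Lp.ext ?_⟩
    · filter_upwards [(hφ.const_smul c).globalJet_fst_ae m, hφ.globalJet_fst_ae m,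
        Lp.coeFn_smul c (hφ.globalJet m).fst] with x h1 h2 h3
      rw [h1]
      refine Eq.trans ?_ h3.symm
      rw [Pi.smul_apply, Pi.smul_apply, h2]
    · filter_upwards [(hφ.const_smul c).globalJet_snd_ae α, hφ.globalJet_snd_ae α,
        Lp.coeFn_smul c ((hφ.globalJet m).snd α)] with x h1 h2 h3
      rw [h1]
      refine Eq.trans ?_ h3.symm
      rw [Pi.smul_apply, h2]
      simp only [multiDeriv_eq_iterPartial, hφ.iterPartial_smul, Pi.smul_apply]

/-- The image of `W^{m,2}_0(U)` under extension by zero (see `exists_toGlobal_eq`). -/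
def globalW0 (m : ℕ) (U : Opens (Space N)) : Submodule ℝ (GlobalJet N m) :=
  (globalTest m U).topologicalClosure

theorem isClosed_globalW0 (m : ℕ) (U : Opens (Space N)) :
    IsClosed (globalW0 m U : Set (GlobalJet N m)) :=
  Submodule.isClosed_topologicalClosure _

instance : CompleteSpace (globalW0 m U) := (isClosed_globalW0 m U).completeSpace_coe

theorem IsTest.globalJet_mem {φ : Space N → ℝ} (hφ : IsTest U φ) :
    hφ.globalJet m ∈ globalW0 m U :=
  Submodule.le_topologicalClosure _ ⟨φ, hφ, rfl⟩

theorem globalW0_mono (h : U ≤ U') : globalW0 m U ≤ globalW0 m U' := by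
  refine Submodule.topologicalClosure_mono ?_
  rintro _ ⟨φ, hφ, rfl⟩
  exact ⟨φ, hφ.mono h, rfl⟩

/-- Extension by zero `W^{m,2}(U) → L²(ℝ^N) × ∏_α L²(ℝ^N)`. -/
def toGlobal (m : ℕ) (U : Opens (Space N)) : W m U →ₗᵢ[ℝ] GlobalJet N m where
  toLinearMap := (jetMap (extL2 U).toContinuousLinearMap).toLinearMap.comp (sobolev m U).subtype
  norm_map' u := jetMap_norm (extL2 U).norm_map u.1

theorem toGlobal_eq (u : W m U) :
    toGlobal m U u = jetMap (extL2 U).toContinuousLinearMap u.1 := rfl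

@[simp] theorem toGlobal_fst (u : W m U) : (toGlobal m U u).fst = extL2 U (fn u) := rfl

theorem fn_injective : Function.Injective (fn : W m U → L2 U) := by
  intro u v h
  refine Subtype.ext (jet_ext h fun α => ?_)
  refine (u.2 α).unique ?_
  have := v.2 α
  rwa [show v.1.fst = u.1.fst from h.symm] at this

theorem isClosed_sobolev (m : ℕ) (U : Opens (Space N)) :
    IsClosed (sobolev m U : Set (Jet m U)) := by
  have hc : ∀ ψ, IsTest U ψ →
      Continuous fun u : L2 U => ∫ x in (U : Set (Space N)), u x * ψ x := by
    intro ψ hψ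
    have h2 : MemLp ψ 2 (volume.restrict (U : Set (Space N))) := (hψ.memLp 2).restrict _
    have : (fun u : L2 U => ∫ x in (U : Set (Space N)), u x * ψ x) =
        fun u => inner ℝ u (h2.toLp ψ) := by
      ext u
      rw [L2_inner_eq]
      refine integral_congr_ae ?_
      filter_upwards [h2.coeFn_toLp] with x hx
      rw [hx]
    rw [this]
    fun_prop
  have e : (sobolev m U : Set (Jet m U)) = ⋂ (α : MultiIndex N m) (φ : Space N → ℝ)
      (_ : IsTest U φ), {J | ∫ x in (U : Set (Space N)), J.fst x * multiDeriv α.1 φ x =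
        (-1) ^ (∑ i, α.1 i) * ∫ x in (U : Set (Space N)), J.snd α x * φ x} := by
    ext J
    simp only [Set.mem_iInter]
    rfl
  rw [e]
  refine isClosed_iInter fun α => isClosed_iInter fun φ => isClosed_iInter fun hφ =>
    isClosed_eq ?_ ?_
  · exact (hc _ (hφ.multiDeriv α.1)).comp jetFst.continuous
  · exact ((hc _ hφ).comp (jetSnd α).continuous).const_mul _

theorem toGlobal_mem_globalTest {u : W m U} (hu : u ∈ testSpace m U) :
    toGlobal m U u ∈ globalTest m U := by
  obtain ⟨φ, hφ, huφ⟩ := hu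
  have key : ∀ (v : L2 U) (ψ : Space N → ℝ) (f : GlobalL2 N), IsTest U ψ → f =ᵐ[volume] ψ →
      v =ᵐ[volume.restrict (U : Set (Space N))] ψ → f = extL2 U v := by
    intro v ψ f hψ hf hv
    refine Lp.ext ?_
    filter_upwards [hf, extL2_ae v, (ae_restrict_iff' U.isOpen.measurableSet).1 hv]
      with x h1 h2 h3
    rw [h1, h2]
    by_cases h : x ∈ (U : Set (Space N))
    · rw [Set.indicator_of_mem h, h3 h]
    · rw [Set.indicator_of_notMem h, hψ.eq_zero_of_notMem h]
  refine ⟨φ, hφ, jet_ext (key _ φ _ hφ (hφ.globalJet_fst_ae m) huφ) fun α =>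
    key _ _ _ (hφ.multiDeriv α.1) (hφ.globalJet_snd_ae α) ?_⟩
  have h2 : MemLp (multiDeriv α.1 φ) 2 (volume.restrict (U : Set (Space N))) :=
    ((hφ.multiDeriv α.1).memLp 2).restrict _
  have : weakDeriv u α = h2.toLp _ :=
    (u.2 α).unique (hφ.hasWeakDeriv α.1 huφ h2.coeFn_toLp)
  change (weakDeriv u α : Space N → ℝ) =ᵐ[_] _
  rw [this]
  exact h2.coeFn_toLp

theorem toGlobal_mem {u : W m U} (hu : u ∈ W0 m U) : toGlobal m U u ∈ globalW0 m U :=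
  map_mem_closure (toGlobal m U).continuous hu fun _ h => toGlobal_mem_globalTest h

theorem jetMap_res_mem_sobolev_of_test {x : GlobalJet N m} (hx : x ∈ globalTest m U) :
    jetMap (resL2 U') x ∈ sobolev m U' := by
  obtain ⟨φ, hφ, rfl⟩ := hx
  intro α
  refine hφ.hasWeakDeriv α.1 ?_ ?_
  · exact (resL2_ae _).trans (ae_restrict_of_ae (hφ.globalJet_fst_ae m))
  · exact (resL2_ae _).trans (ae_restrict_of_ae (hφ.globalJet_snd_ae α))

/-- The restriction of an element of `W^{m,2}_0(U)` to any open set is in `W^{m,2}`. -/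
theorem jetMap_res_mem_sobolev {x : GlobalJet N m} (hx : x ∈ globalW0 m U) :
    jetMap (resL2 U') x ∈ sobolev m U' := by
  have := map_mem_closure (jetMap (resL2 U')).continuous hx
    fun _ h => jetMap_res_mem_sobolev_of_test (U' := U') h
  rwa [SetLike.mem_coe.symm, ← (isClosed_sobolev m U').closure_eq]

/-- The element of `W^{m,2}(U)` whose extension by zero is a given element of `globalW0 m U`. -/
def ofGlobal (m : ℕ) (U : Opens (Space N)) : globalW0 m U →L[ℝ] W m U :=
  ((jetMap (resL2 U)).comp (globalW0 m U).subtypeL).codRestrict (sobolev m U)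
    fun x => jetMap_res_mem_sobolev x.2

theorem ofGlobal_coe (x : globalW0 m U) : (ofGlobal m U x).1 = jetMap (resL2 U) x.1 := rfl

theorem fn_ofGlobal (x : globalW0 m U) : fn (ofGlobal m U x) = resL2 U x.1.fst := rfl

theorem jetMap_cut_of_mem {x : GlobalJet N m} (hx : x ∈ globalW0 m U) :
    jetMap (cut U U.isOpen.measurableSet) x = x := by
  have hcl : IsClosed {x : GlobalJet N m | jetMap (cut U U.isOpen.measurableSet) x = x} :=
    isClosed_eq (by fun_prop) continuous_id
  refine closure_minimal ?_ hcl hx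
  rintro _ ⟨φ, hφ, rfl⟩
  have key : ∀ (f : GlobalL2 N) (ψ : Space N → ℝ), IsTest U ψ → f =ᵐ[volume] ψ →
      cut U U.isOpen.measurableSet f = f := by
    intro f ψ hψ hf
    refine Lp.ext ?_
    filter_upwards [cut_ae U.isOpen.measurableSet f, hf] with x h1 h2
    rw [h1]
    by_cases h : x ∈ (U : Set (Space N))
    · rw [Set.indicator_of_mem h]
    · rw [Set.indicator_of_notMem h, h2, hψ.eq_zero_of_notMem h]
  exact jet_ext (key _ φ hφ (hφ.globalJet_fst_ae m)) fun α =>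
    key _ _ (hφ.multiDeriv α.1) (hφ.globalJet_snd_ae α)

theorem toGlobal_ofGlobal (x : globalW0 m U) : toGlobal m U (ofGlobal m U x) = x := by
  rw [toGlobal_eq, ofGlobal_coe]
  conv_rhs => rw [← jetMap_cut_of_mem x.2]
  exact jet_ext (extL2_resL2 _) fun _ => extL2_resL2 _

theorem ofGlobal_mem (x : globalW0 m U) : ofGlobal m U x ∈ W0 m U := by
  have hx : x.1 ∈ closure (globalTest m U : Set (GlobalJet N m)) := x.2
  have hsub : (globalTest m U : Set (GlobalJet N m)) ⊆ globalW0 m U :=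
    (globalTest m U).le_topologicalClosure
  have hx' : x ∈ closure {y : globalW0 m U | y.1 ∈ globalTest m U} := by
    rw [closure_subtype]
    convert hx using 2
    ext y
    exact ⟨by rintro ⟨z, hz, rfl⟩; exact hz, fun hy => ⟨⟨y, hsub hy⟩, hy, rfl⟩⟩
  refine map_mem_closure (ofGlobal m U).continuous hx' ?_
  rintro ⟨_, _⟩ ⟨φ, hφ, rfl⟩
  exact ⟨φ, hφ, (resL2_ae _).trans (ae_restrict_of_ae (hφ.globalJet_fst_ae m))⟩

/-- `globalW0 m U` consists of extensions by zero of elements of `W^{m,2}_0(U)`. -/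
theorem exists_toGlobal_eq {x : GlobalJet N m} (hx : x ∈ globalW0 m U) :
    ∃ u ∈ W0 m U, toGlobal m U u = x :=
  ⟨ofGlobal m U ⟨x, hx⟩, ofGlobal_mem _, toGlobal_ofGlobal _⟩

theorem mem_extendedW0_iff (h : U ≤ D) {w : W m D} :
    w ∈ extendedW0 m D U ↔ toGlobal m D w ∈ globalW0 m U := by
  constructor
  · rintro ⟨u, hu, huw⟩
    have hx := toGlobal_mem hu
    have e : w = ofGlobal m D ⟨toGlobal m U u, globalW0_mono h hx⟩ := by
      refine fn_injective ?_
      rw [huw, fn_ofGlobal, zeroExt_eq]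
      rfl
    rw [e, toGlobal_ofGlobal]
    exact hx
  · intro hx
    refine ⟨ofGlobal m U ⟨_, hx⟩, ofGlobal_mem _, ?_⟩
    have h2 := congrArg (fun x => jetFst x) (toGlobal_ofGlobal ⟨_, hx⟩)
    simp only [jetFst_apply, toGlobal_fst] at h2
    rw [zeroExt_eq, h2, resL2_extL2]

end

section

/-! ### Weak sequential convergence in a Hilbert space -/

section Weak

variable {H H' : Type*} [NormedAddCommGroup H] [InnerProductSpace ℝ H]
  [NormedAddCommGroup H'] [InnerProductSpace ℝ H']

/-- Weak convergence of a sequence in a real Hilbert space. -/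
def WeaklyTendsto (x : ℕ → H) (x₀ : H) : Prop :=
  ∀ y, Tendsto (fun n => inner ℝ (x n) y) atTop (𝓝 (inner ℝ x₀ y))

namespace WeaklyTendsto

variable {x x' : ℕ → H} {x₀ x₀' : H}

theorem sub (h : WeaklyTendsto x x₀) (h' : WeaklyTendsto x' x₀') :
    WeaklyTendsto (fun n => x n - x' n) (x₀ - x₀') := fun y => by
  simpa only [inner_sub_left] using (h y).sub (h' y)

theorem of_tendsto (h : Tendsto x atTop (𝓝 x₀)) : WeaklyTendsto x x₀ := fun _ =>
  h.inner tendsto_const_nhds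

theorem congr_tendsto_sub (h : WeaklyTendsto x x₀)
    (h' : Tendsto (fun n => x n - x' n) atTop (𝓝 0)) : WeaklyTendsto x' x₀ := by
  simpa using h.sub (of_tendsto h')

theorem map [CompleteSpace H] [CompleteSpace H'] (h : WeaklyTendsto x x₀) (T : H →L[ℝ] H') :
    WeaklyTendsto (fun n => T (x n)) (T x₀) := fun y => by
  simpa only [← ContinuousLinearMap.adjoint_inner_right T] using h (T.adjoint y)

theorem mem {K : Submodule ℝ H} [K.HasOrthogonalProjection] (h : WeaklyTendsto x x₀)
    (hx : ∀ n, x n ∈ K) : x₀ ∈ K := by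
  rw [← K.orthogonal_orthogonal, Submodule.mem_orthogonal']
  intro y hy
  refine tendsto_nhds_unique (h y) ?_
  have : ∀ n, inner ℝ (x n) y = 0 := fun n => hy _ (hx n)
  simp [this]

theorem inner_tendsto (h : WeaklyTendsto x x₀) {C : ℝ} (hC : ∀ n, ‖x n‖ ≤ C) {y : ℕ → H} {y₀ : H}
    (hy : Tendsto y atTop (𝓝 y₀)) :
    Tendsto (fun n => inner ℝ (x n) (y n)) atTop (𝓝 (inner ℝ x₀ y₀)) := by
  have h1 : Tendsto (fun n => inner ℝ (x n) (y n - y₀)) atTop (𝓝 0) := by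
    refine squeeze_zero_norm (a := fun n => C * ‖y n - y₀‖) (fun n => ?_) ?_
    · exact (norm_inner_le_norm _ _).trans (mul_le_mul_of_nonneg_right (hC n) (norm_nonneg _))
    · have : Tendsto (fun n => ‖y n - y₀‖) atTop (𝓝 0) :=
        tendsto_iff_norm_sub_tendsto_zero.1 hy
      simpa using this.const_mul C
  have := (h y₀).add h1
  simp only [← inner_add_right, add_zero] at this
  simpa using this

end WeaklyTendsto

/-- Bounded sequences in a Hilbert space have weakly convergent subsequences. Separability is not
needed, because one may pass to the closed span of the sequence. -/
theorem exists_weaklyTendsto_subseq [CompleteSpace H] {x : ℕ → H} {C : ℝ}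
    (hC : ∀ n, ‖x n‖ ≤ C) :
    ∃ k : ℕ → ℕ, StrictMono k ∧ ∃ x₀, WeaklyTendsto (fun n => x (k n)) x₀ := by
  set K : Submodule ℝ H := (Submodule.span ℝ (Set.range x)).topologicalClosure with hK
  have hcl : IsClosed (K : Set H) := Submodule.isClosed_topologicalClosure _
  have : CompleteSpace K := hcl.completeSpace_coe
  have hxK : ∀ n, x n ∈ K := fun n =>
    Submodule.le_topologicalClosure _ (Submodule.subset_span ⟨n, rfl⟩)
  have hsep : IsSeparable (K : Set H) :=
    ((Set.countable_range x).isSeparable.span (R := ℝ)).closure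
  have : SeparableSpace K := hsep.separableSpace
  let F : ℕ → WeakDual ℝ K := fun n =>
    StrongDual.toWeakDual (InnerProductSpace.toDual ℝ K ⟨x n, hxK n⟩)
  have hF : ∀ n, F n ∈ WeakDual.toStrongDual ⁻¹' Metric.closedBall (0 : StrongDual ℝ K) C := by
    intro n
    refine (mem_closedBall_zero_iff (E := StrongDual ℝ K)).2 ?_
    exact ((InnerProductSpace.toDual ℝ K).norm_map ⟨x n, hxK n⟩).le.trans (hC n)
  obtain ⟨F₀, -, k, hk, hlim⟩ := WeakDual.isSeqCompact_closedBall ℝ K 0 C hF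
  refine ⟨k, hk, ((InnerProductSpace.toDual ℝ K).symm (WeakDual.toStrongDual F₀) : K), ?_⟩
  intro y
  have h1 := tendsto_iff_forall_eval_tendsto_topDualPairing.1 hlim (K.orthogonalProjectionOnto y)
  have e1 : ∀ z : K, inner ℝ (z : H) y = inner ℝ z (K.orthogonalProjectionOnto y) := by
    intro z
    exact (Submodule.inner_orthogonalProjectionOnto_eq_of_mem_left z y).symm
  have e2 : inner ℝ (((InnerProductSpace.toDual ℝ K).symm (WeakDual.toStrongDual F₀) : K) : H) y =
      F₀ (K.orthogonalProjectionOnto y) := by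
    rw [e1, InnerProductSpace.toDual_symm_apply]
    rfl
  rw [e2]
  refine h1.congr fun n => ?_
  exact (e1 ⟨x (k n), hxK (k n)⟩).symm

end Weak

end

section

/-! ### Compact embedding and interior convergence -/

variable {N m : ℕ} {U U' D : Opens (Space N)}

theorem jet_tendsto_zero {ι E : Type*} [Fintype ι] [NormedAddCommGroup E] [InnerProductSpace ℝ E]
    {x : ℕ → WithLp 2 (E × PiLp 2 (fun _ : ι => E))}
    (h : Tendsto (fun n => ‖(x n).fst‖) atTop (𝓝 0))
    (h' : ∀ α, Tendsto (fun n => ‖(x n).snd α‖) atTop (𝓝 0)) :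
    Tendsto x atTop (𝓝 0) := by
  rw [tendsto_zero_iff_norm_tendsto_zero]
  have h2 : Tendsto (fun n => ‖x n‖ ^ 2) atTop (𝓝 0) := by
    simp_rw [jet_norm_sq]
    simpa using (h.pow 2).add (tendsto_finsetSum Finset.univ fun α _ => (h' α).pow 2)
  simpa using h2.sqrt

theorem Lp_norm_eq_of_ae {f : GlobalL2 N} {φ : Space N → ℝ} (h : f =ᵐ[volume] φ) :
    ‖f‖ = (eLpNorm φ 2 volume).toReal := by
  rw [Lp.norm_def, eLpNorm_congr_ae h]

theorem Lp_norm_sq_eq_of_ae {f : GlobalL2 N} {φ : Space N → ℝ} (h : f =ᵐ[volume] φ) :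
    ‖f‖ ^ 2 = ∫ x, φ x ^ 2 := by
  rw [← real_inner_self_eq_norm_sq, L2_inner_eq]
  refine integral_congr_ae ?_
  filter_upwards [h] with x hx
  rw [hx, sq]

/-- A bounded weakly null sequence in `W^{m,2}_0(D)` is approximated in norm by test functions
all of whose derivatives of order less than `m` tend to `0` in `L²`. -/
theorem exists_test_approx (hD : Bornology.IsBounded (D : Set (Space N)))
    {h : ℕ → GlobalJet N m} (hmem : ∀ n, h n ∈ globalW0 m D) {C : ℝ} (hC : ∀ n, ‖h n‖ ≤ C)
    (hw : WeaklyTendsto h 0) :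
    ∃ (φ : ℕ → Space N → ℝ) (hφ : ∀ n, IsTest D (φ n)),
      Tendsto (fun n => h n - (hφ n).globalJet m) atTop (𝓝 0) ∧
      ∀ l : List (Fin N), l.length < m →
        Tendsto (fun n => eLpNorm (iterPartial l (φ n)) 2 volume) atTop (𝓝 0) := by
  have hex : ∀ n : ℕ, ∃ (φ : Space N → ℝ) (hφ : IsTest D φ),
      ‖h n - hφ.globalJet m‖ < 1 / ((n : ℝ) + 1) := by
    intro n
    obtain ⟨_, ⟨φ, hφ, rfl⟩, hlt⟩ :=
      Metric.mem_closure_iff.1 (hmem n) (1 / ((n : ℝ) + 1)) (by positivity)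
    exact ⟨φ, hφ, by rwa [← dist_eq_norm]⟩
  choose φ hφ hlt using hex
  have hlim : Tendsto (fun n => h n - (hφ n).globalJet m) atTop (𝓝 0) :=
    squeeze_zero_norm (fun n => (hlt n).le) tendsto_one_div_add_atTop_nhds_zero_nat
  refine ⟨φ, hφ, hlim, fun l hl => ?_⟩
  have hw' : WeaklyTendsto (fun n => (hφ n).globalJet m) 0 := hw.congr_tendsto_sub hlim
  have hbd : ∀ n, ‖(hφ n).globalJet m‖ ≤ C + 1 := by
    intro n
    have h1 : (1 : ℝ) / ((n : ℝ) + 1) ≤ 1 := by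
      rw [div_le_one (by positivity)]
      linarith [(Nat.cast_nonneg n : (0 : ℝ) ≤ n)]
    have h2 := norm_sub_norm_le ((hφ n).globalJet m) (h n)
    rw [norm_sub_rev] at h2
    linarith [hlt n, hC n]
  have hsq : ∀ n, ‖(hφ n).globalJet m‖ ^ 2 ≤ (C + 1) ^ 2 := fun n =>
    pow_le_pow_left₀ (norm_nonneg _) (hbd n) 2
  have key := tendsto_integral_iterPartial_sq (m := m) hD hφ (M := (C + 1) ^ 2)
    (fun n => by
      rw [← Lp_norm_sq_eq_of_ae ((hφ n).globalJet_fst_ae m)]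
      refine le_trans ?_ (hsq n)
      rw [jet_norm_sq]
      exact le_add_of_nonneg_right (Finset.sum_nonneg fun _ _ => sq_nonneg _))
    (fun n α => by
      rw [← Lp_norm_sq_eq_of_ae ((hφ n).globalJet_snd_ae α)]
      refine le_trans ?_ (hsq n)
      rw [jet_norm_sq]
      exact (Finset.single_le_sum (f := fun α => ‖((hφ n).globalJet m).snd α‖ ^ 2)
        (fun _ _ => sq_nonneg _) (Finset.mem_univ α)).trans
          (le_add_of_nonneg_left (sq_nonneg _)))
    (fun g hg => by
      -- The truncation of `g` to the bounded set `D` is square integrable.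
      have hgL : MemLp ((D : Set (Space N)).indicator g) 2 volume := by
        rw [memLp_indicator_iff_restrict D.isOpen.measurableSet]
        obtain ⟨B, hB⟩ := hD.isCompact_closure.exists_bound_of_continuousOn hg.continuousOn
        have : IsFiniteMeasure (volume.restrict (D : Set (Space N))) :=
          ⟨by rw [Measure.restrict_apply_univ]; exact hD.measure_lt_top⟩
        refine MemLp.of_bound hg.aestronglyMeasurable B ?_
        filter_upwards [ae_restrict_mem D.isOpen.measurableSet] with x hx
        exact hB x (subset_closure hx)
      have h1 := hw'.map (jetFst : GlobalJet N m →L[ℝ] GlobalL2 N) (hgL.toLp _)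
      rw [map_zero, inner_zero_left] at h1
      refine h1.congr fun n => ?_
      rw [L2_inner_eq]
      refine integral_congr_ae ?_
      filter_upwards [(hφ n).globalJet_fst_ae m, hgL.coeFn_toLp] with x h1 h2
      rw [h2, jetFst_apply, h1]
      by_cases hx : x ∈ (D : Set (Space N))
      · rw [Set.indicator_of_mem hx]
      · rw [Set.indicator_of_notMem hx, (hφ n).eq_zero_of_notMem hx, zero_mul, zero_mul])
    hl
  have e : ∀ n, eLpNorm (iterPartial l (φ n)) 2 volume =
      ENNReal.ofReal √(∫ x, iterPartial l (φ n) x ^ 2) := fun n =>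
    ((hφ n).iterPartial l).eLpNorm_eq
  simp_rw [e]
  simpa using ENNReal.tendsto_ofReal key.sqrt

/-- The embedding of `W^{m,2}_0(D)` into `L²` turns weak into strong convergence. -/
theorem tendsto_fst_of_weaklyTendsto (hm : 1 ≤ m) (hD : Bornology.IsBounded (D : Set (Space N)))
    {x : ℕ → GlobalJet N m} {x₀ : GlobalJet N m} (hmem : ∀ n, x n ∈ globalW0 m D) {C : ℝ}
    (hC : ∀ n, ‖x n‖ ≤ C) (hw : WeaklyTendsto x x₀) :
    Tendsto (fun n => (x n).fst) atTop (𝓝 x₀.fst) := by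
  have hx₀ : x₀ ∈ globalW0 m D := hw.mem hmem
  have hw0 : WeaklyTendsto (fun n => x n - x₀) 0 := by
    simpa using hw.sub (WeaklyTendsto.of_tendsto (tendsto_const_nhds (x := x₀)))
  obtain ⟨φ, hφ, h1, h2⟩ := exists_test_approx hD (fun n => sub_mem (hmem n) hx₀)
    (C := C + ‖x₀‖) (fun n => (norm_sub_le _ _).trans (by linarith [hC n])) hw0
  have h3 : Tendsto (fun n => ((hφ n).globalJet m).fst) atTop (𝓝 0) := by
    rw [tendsto_zero_iff_norm_tendsto_zero]
    simp_rw [fun n => Lp_norm_eq_of_ae ((hφ n).globalJet_fst_ae m)]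
    exact (ENNReal.tendsto_toReal ENNReal.zero_ne_top).comp
      (h2 [] (Nat.lt_of_lt_of_le Nat.zero_lt_one hm))
  have h4 : Tendsto (fun n => (x n - x₀ - (hφ n).globalJet m).fst) atTop (𝓝 0) := by
    have := ((jetFst : GlobalJet N m →L[ℝ] GlobalL2 N).continuous.tendsto 0).comp h1
    rw [map_zero] at this
    exact this
  have h5 := (h4.add h3).add_const x₀.fst
  simpa using h5

theorem IsTest.isBoundedMeasurable {χ : Space N → ℝ} (hχ : IsTest U χ) :
    IsBoundedMeasurable χ :=
  ⟨hχ.continuous.measurable, hχ.hasCompactSupport.exists_bound_of_continuous hχ.continuous⟩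

/-- The multiplication by a test function `χ` commutes with forming the family of derivatives up to
an error that tends to `0`. -/
theorem tendsto_globalJet_mul_sub {χ : Space N → ℝ} (hχ : IsTest U χ) {φ : ℕ → Space N → ℝ}
    (hφ : ∀ n, IsTest D (φ n)) (h : ∀ l : List (Fin N), l.length < m →
      Tendsto (fun n => eLpNorm (iterPartial l (φ n)) 2 volume) atTop (𝓝 0)) :
    Tendsto (fun n => (hχ.mul_left (hφ n)).globalJet m -
      jetMap (mulOp χ hχ.isBoundedMeasurable) ((hφ n).globalJet m)) atTop (𝓝 0) := by
  refine jet_tendsto_zero ?_ fun α => ?_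
  · have : ∀ n, ((hχ.mul_left (hφ n)).globalJet m -
        jetMap (mulOp χ hχ.isBoundedMeasurable) ((hφ n).globalJet m)).fst = 0 := by
      intro n
      rw [WithLp.sub_fst, sub_eq_zero]
      refine Lp.ext ?_
      filter_upwards [(hχ.mul_left (hφ n)).globalJet_fst_ae m, (hφ n).globalJet_fst_ae m,
        mulOp_ae hχ.isBoundedMeasurable ((hφ n).globalJet m).fst] with x e1 e2 e3
      rw [jetMap_fst, e3, e2]
      exact e1
    simp [this]
  · have hc := hχ.tendsto_eLpNorm_commutator hφ (directions α.1) fun l' hl' => h l' (by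
      rwa [length_directions, α.2] at hl')
    refine ((ENNReal.tendsto_toReal ENNReal.zero_ne_top).comp hc).congr fun n =>
      (Lp_norm_eq_of_ae ?_).symm
    rw [WithLp.sub_snd]
    filter_upwards [(hχ.mul_left (hφ n)).globalJet_snd_ae α, (hφ n).globalJet_snd_ae α,
      mulOp_ae hχ.isBoundedMeasurable (((hφ n).globalJet m).snd α),
      Lp.coeFn_sub (((hχ.mul_left (hφ n)).globalJet m).snd α)
        ((jetMap (mulOp χ hχ.isBoundedMeasurable) ((hφ n).globalJet m)).snd α)] with x e1 e2 e3 e4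
    refine e4.trans ?_
    rw [Pi.sub_apply, jetMap_snd, e3, e2, e1, multiDeriv_eq_iterPartial,
      multiDeriv_eq_iterPartial]

/-- If `h_n ∈ W^{m,2}_0(D)` is weakly null and orthogonal to `W^{m,2}_0(U)`, then the energy of
`h_n` tends to `0` locally in `U`: testing with `χ h_n` gives `∫ χ |h_n|²` up to a commutator, which
involves only derivatives of order less than `m`. -/
theorem tendsto_inner_mulOp (hD : Bornology.IsBounded (D : Set (Space N)))
    {χ : Space N → ℝ} (hχ : IsTest U χ) {h : ℕ → GlobalJet N m}
    (hmem : ∀ n, h n ∈ globalW0 m D) {C : ℝ} (hC : ∀ n, ‖h n‖ ≤ C)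
    (hw : WeaklyTendsto h 0) (horth : ∀ n, ∀ y ∈ globalW0 m U, inner ℝ (h n) y = 0) :
    Tendsto (fun n => inner ℝ (h n) (jetMap (mulOp χ hχ.isBoundedMeasurable) (h n)))
      atTop (𝓝 0) := by
  obtain ⟨φ, hφ, h1, h2⟩ := exists_test_approx hD hmem hC hw
  have hcomm := tendsto_globalJet_mul_sub hχ hφ h2
  have hmemU : ∀ n, (hχ.mul_left (hφ n)).globalJet m ∈ globalW0 m U := fun n =>
    (hχ.mul_left (hφ n)).globalJet_mem
  generalize jetMap (ι := MultiIndex N m) (mulOp χ hχ.isBoundedMeasurable) = M at hcomm ⊢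
  have h3 : Tendsto (fun n => M (h n - (hφ n).globalJet m)) atTop (𝓝 0) := by
    have := (M.continuous.tendsto 0).comp h1
    rw [map_zero] at this
    exact this
  have hz := hw.inner_tendsto hC (h3.sub hcomm)
  rw [inner_zero_left] at hz
  refine hz.congr fun n => ?_
  rw [map_sub, sub_sub_sub_comm, sub_self, sub_zero, inner_sub_right, horth n _ (hmemU n),
    sub_zero]

theorem cut_norm_sq_le_inner {χ : Space N → ℝ} (hχ : IsBoundedMeasurable χ) (hχ0 : ∀ x, 0 ≤ χ x)
    {K : Set (Space N)} (hK : MeasurableSet K) (hχK : ∀ x ∈ K, 1 ≤ χ x) (f : GlobalL2 N) :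
    ‖cut K hK f‖ ^ 2 ≤ inner ℝ f (mulOp χ hχ f) := by
  have hint : Integrable fun x => χ x * f x * f x := by
    refine (L2_integrable_mul (mulOp χ hχ f) f).congr ?_
    filter_upwards [mulOp_ae hχ f] with x hx
    rw [hx]
  rw [← mulOp_symm, mulOp_inner, cut_norm_sq hK, ← integral_indicator hK]
  refine integral_mono_of_nonneg (ae_of_all _ fun x => Set.indicator_nonneg
    (fun _ _ => sq_nonneg _) x) hint (ae_of_all _ fun x => ?_)
  by_cases hx : x ∈ K
  · simp only [Set.indicator_of_mem hx]
    nlinarith [hχK x hx, sq_nonneg (f x)]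
  · simp only [Set.indicator_of_notMem hx]
    have := mul_nonneg (hχ0 x) (sq_nonneg (f x))
    linarith

theorem tendsto_jetMap_cut (hD : Bornology.IsBounded (D : Set (Space N)))
    {χ : Space N → ℝ} (hχ : IsTest U χ) (hχ0 : ∀ x, 0 ≤ χ x)
    {K : Set (Space N)} (hK : MeasurableSet K) (hχK : ∀ x ∈ K, 1 ≤ χ x) {h : ℕ → GlobalJet N m}
    (hmem : ∀ n, h n ∈ globalW0 m D) {C : ℝ} (hC : ∀ n, ‖h n‖ ≤ C)
    (hw : WeaklyTendsto h 0) (horth : ∀ n, ∀ y ∈ globalW0 m U, inner ℝ (h n) y = 0) :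
    Tendsto (fun n => ‖jetMap (cut K hK) (h n)‖) atTop (𝓝 0) := by
  have h1 := tendsto_inner_mulOp hD hχ hmem hC hw horth
  have h2 : Tendsto (fun n => ‖jetMap (cut K hK) (h n)‖ ^ 2) atTop (𝓝 0) := by
    refine squeeze_zero (fun _ => sq_nonneg _) (fun n => ?_) h1
    rw [jet_norm_sq, jet_inner]
    simp only [jetMap_fst, jetMap_snd]
    gcongr <;> exact cut_norm_sq_le_inner _ hχ0 hK hχK _
  simpa using h2.sqrt

end

section

/-! ### The quadratic form and the solution operators -/

variable {N m : ℕ} {U U' D : Opens (Space N)}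
  {A : MultiIndex N m → MultiIndex N m → Space N → ℝ}

/-- The Lax–Milgram theorem on a closed subspace `K`, for right-hand sides `v ↦ ⟨f, F v⟩`. -/
theorem exists_solution_operator {H H' : Type*} [NormedAddCommGroup H] [InnerProductSpace ℝ H]
    [CompleteSpace H] [NormedAddCommGroup H'] [InnerProductSpace ℝ H'] [CompleteSpace H']
    (T : H →L[ℝ] H) (hT : ∃ c : ℝ, 0 < c ∧ ∀ x, c * ‖x‖ ^ 2 ≤ inner ℝ (T x) x)
    (K : Submodule ℝ H) [CompleteSpace K] (F : H →L[ℝ] H') :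
    ∃ S : H' →L[ℝ] K, ∀ f, ∀ y ∈ K, inner ℝ (T (S f)) y = inner ℝ f (F y) := by
  let b : K →L[ℝ] K →L[ℝ] ℝ := LinearMap.mkContinuous₂
    (LinearMap.mk₂ ℝ (fun x y : K => inner ℝ (T x) (y : H))
      (fun _ _ _ => by simp [inner_add_left]) (fun _ _ _ => by simp [inner_smul_left])
      (fun _ _ _ => by simp [inner_add_right]) (fun _ _ _ => by simp [inner_smul_right])) ‖T‖
    fun x y => (norm_inner_le_norm _ _).trans
      (mul_le_mul_of_nonneg_right (T.le_opNorm x) (norm_nonneg _))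
  have hb : ∀ x y : K, b x y = inner ℝ (T x) (y : H) := fun _ _ => rfl
  have hco : IsCoercive b := by
    obtain ⟨c, hc, h⟩ := hT
    exact ⟨c, hc, fun x => by rw [mul_assoc, ← sq, hb]; exact h x⟩
  refine ⟨hco.continuousLinearEquivOfBilin.symm.toContinuousLinearMap.comp
    (K.orthogonalProjectionOnto.comp (ContinuousLinearMap.adjoint F)), fun f y hy => ?_⟩
  have h1 := hco.continuousLinearEquivOfBilin_apply
    (hco.continuousLinearEquivOfBilin.symm (K.orthogonalProjectionOnto (F.adjoint f))) ⟨y, hy⟩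
  rw [ContinuousLinearEquiv.apply_symm_apply,
    Submodule.inner_orthogonalProjectionOnto_eq_of_mem_right,
    ContinuousLinearMap.adjoint_inner_left, hb] at h1
  exact h1.symm

theorem cut_extL2 (u : L2 U) :
    cut U U.isOpen.measurableSet (extL2 U u) = extL2 U u := by
  rw [← extL2_resL2, resL2_extL2]

theorem jetMap_cut_toGlobal (w : W m U) :
    jetMap (cut U U.isOpen.measurableSet) (toGlobal m U w) = toGlobal m U w :=
  jet_ext (cut_extL2 _) fun _ => cut_extL2 _

theorem jet_fst_ae {S : Set (Space N)} (hS : S ⊆ U) (w : W m U) :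
    ∀ᵐ z ∂volume.restrict S, (jet w z).1 = (toGlobal m U w).fst z :=
  ae_restrict_of_ae_restrict_of_subset hS
    ((extL2_ae_restrict (fn w)).mono fun _ h => h.symm)

theorem jet_snd_ae {S : Set (Space N)} (hS : S ⊆ U) (w : W m U)
    (α : MultiIndex N m) :
    ∀ᵐ z ∂volume.restrict S, (jet w z).2 α = (toGlobal m U w).snd α z :=
  ae_restrict_of_ae_restrict_of_subset hS
    ((extL2_ae_restrict (weakDeriv w α)).mono fun _ h => h.symm)

theorem IsEllipticCoeff.isBoundedMeasurable (hA : IsEllipticCoeff A) (α β : MultiIndex N m) :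
    IsBoundedMeasurable (A α β) := ⟨hA.measurable α β, hA.bounded α β⟩

/-- The operator on `L²(ℝ^N) × ∏_α L²(ℝ^N)` that represents the form `Q` on the whole space:
`(u, (g_α)) ↦ (u, (∑_α A_{αβ} g_α)_β)`. -/
def IsEllipticCoeff.op (hA : IsEllipticCoeff A) : GlobalJet N m →L[ℝ] GlobalJet N m :=
  (WithLp.prodContinuousLinearEquiv 2 ℝ (GlobalL2 N)
      (PiLp 2 (fun _ : MultiIndex N m => GlobalL2 N))).symm.toContinuousLinearMap.comp
    (jetFst.prod
      ((PiLp.continuousLinearEquiv 2 ℝ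
        (fun _ : MultiIndex N m => GlobalL2 N)).symm.toContinuousLinearMap.comp
        (ContinuousLinearMap.pi fun β =>
          ∑ α, (mulOp (A α β) (hA.isBoundedMeasurable α β)).comp (jetSnd α))))

/-- The form `Q` on the whole space. -/
def IsEllipticCoeff.form (hA : IsEllipticCoeff A) (x y : GlobalJet N m) : ℝ :=
  inner ℝ (hA.op x) y

namespace IsEllipticCoeff

variable (hA : IsEllipticCoeff A)

theorem form_eq (x y : GlobalJet N m) :
    hA.form x y = (∑ α, ∑ β, ∫ z, A α β z * x.snd α z * y.snd β z) + inner ℝ x.fst y.fst := by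
  have h2 : ∀ β, (hA.op x).snd β =
      ∑ α, mulOp (A α β) (hA.isBoundedMeasurable α β) (x.snd α) := by
    intro β
    have : (hA.op x).snd β =
      (∑ α, (mulOp (A α β) (hA.isBoundedMeasurable α β)).comp (jetSnd α)) x := rfl
    rw [this, _root_.sum_apply]
    rfl
  rw [form, jet_inner, add_comm]
  congr 1
  rw [Finset.sum_comm]
  refine Finset.sum_congr rfl fun β _ => ?_
  rw [h2, sum_inner]
  exact Finset.sum_congr rfl fun α _ => mulOp_inner _ _ _

theorem form_abs_le (x y : GlobalJet N m) : |hA.form x y| ≤ ‖hA.op‖ * ‖x‖ * ‖y‖ :=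
  (abs_real_inner_le_norm _ _).trans
    (mul_le_mul_of_nonneg_right (hA.op.le_opNorm x) (norm_nonneg _))

theorem integrable_form (hA : IsEllipticCoeff A) (x y : GlobalJet N m) (α β : MultiIndex N m) :
    Integrable fun z => A α β z * x.snd α z * y.snd β z := by
  refine (L2_integrable_mul (mulOp (A α β) (hA.isBoundedMeasurable α β) (x.snd α))
    (y.snd β)).congr ?_
  filter_upwards [mulOp_ae (hA.isBoundedMeasurable α β) (x.snd α)] with z hz
  rw [hz]

theorem exists_coercive :
    ∃ c : ℝ, 0 < c ∧ ∀ x : GlobalJet N m, c * ‖x‖ ^ 2 ≤ hA.form x x := by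
  obtain ⟨θ, hθ, hell⟩ := hA.elliptic
  refine ⟨min θ 1, lt_min hθ one_pos, fun x => ?_⟩
  have h1 : θ * ∑ α, ‖x.snd α‖ ^ 2 ≤ ∑ α, ∑ β, ∫ z, A α β z * x.snd α z * x.snd β z := by
    have hi : ∀ α, Integrable fun z => x.snd α z ^ 2 := fun α =>
      (Lp.memLp (x.snd α)).integrable_sq
    have e1 : θ * ∑ α, ‖x.snd α‖ ^ 2 = ∫ z, θ * ∑ α, x.snd α z ^ 2 := by
      rw [integral_const_mul, integral_finsetSum _ fun α _ => hi α]
      congr 1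
      exact Finset.sum_congr rfl fun α _ => Lp_norm_sq_eq_of_ae EventuallyEq.rfl
    have e2 : ∑ α, ∑ β, ∫ z, A α β z * x.snd α z * x.snd β z =
        ∫ z, ∑ α, ∑ β, A α β z * x.snd α z * x.snd β z := by
      rw [integral_finsetSum _ fun α _ => integrable_finsetSum _ fun β _ =>
        hA.integrable_form x x α β]
      exact Finset.sum_congr rfl fun α _ =>
        (integral_finsetSum _ fun β _ => hA.integrable_form x x α β).symm
    rw [e1, e2]
    refine integral_mono ((integrable_finsetSum _ fun α _ => hi α).const_mul _)
      (integrable_finsetSum _ fun α _ => integrable_finsetSum _ fun β _ =>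
        hA.integrable_form x x α β) fun z => hell z fun α => x.snd α z
  rw [form_eq, jet_norm_sq, real_inner_self_eq_norm_sq]
  have h2 : 0 ≤ ∑ α, ‖x.snd α‖ ^ 2 := Finset.sum_nonneg fun _ _ => sq_nonneg _
  have h3 : min θ 1 * ∑ α, ‖x.snd α‖ ^ 2 ≤ θ * ∑ α, ‖x.snd α‖ ^ 2 :=
    mul_le_mul_of_nonneg_right (min_le_left _ _) h2
  have h4 : min θ 1 * ‖x.fst‖ ^ 2 ≤ 1 * ‖x.fst‖ ^ 2 :=
    mul_le_mul_of_nonneg_right (min_le_right _ _) (sq_nonneg _)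
  linarith

theorem form_sub_left (x x' y : GlobalJet N m) :
    hA.form (x - x') y = hA.form x y - hA.form x' y := by
  simp only [form, map_sub, inner_sub_left]

theorem form_self_nonneg (x : GlobalJet N m) : 0 ≤ hA.form x x := by
  obtain ⟨c, hc, h⟩ := hA.exists_coercive
  exact le_trans (by positivity) (h x)

/-- The solution operator `f ↦ w` of the problem `w ∈ W^{m,2}_0(U)`, `Q(w, v) = ⟨f, v⟩` for all
`v ∈ W^{m,2}_0(U)`, for `f ∈ L²(ℝ^N)`. -/
def solve (U : Opens (Space N)) : GlobalL2 N →L[ℝ] globalW0 m U :=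
  (exists_solution_operator hA.op hA.exists_coercive (globalW0 m U) jetFst).choose

theorem form_solve (f : GlobalL2 N) {y : GlobalJet N m} (hy : y ∈ globalW0 m U) :
    hA.form (hA.solve U f) y = inner ℝ f y.fst :=
  (exists_solution_operator hA.op hA.exists_coercive (globalW0 m U) jetFst).choose_spec f y hy

/-- Solutions are unique, by coercivity. -/
theorem eq_of_form_eq {x x' : GlobalJet N m} (hx : x ∈ globalW0 m U) (hx' : x' ∈ globalW0 m U)
    (h : ∀ y ∈ globalW0 m U, hA.form x y = hA.form x' y) : x = x' := by
  obtain ⟨c, hc, hco⟩ := hA.exists_coercive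
  have h1 : hA.form (x - x') (x - x') = 0 := by
    rw [form_sub_left, h _ (sub_mem hx hx'), sub_self]
  have h2 := hco (x - x')
  rw [h1] at h2
  have h3 : ‖x - x'‖ ^ 2 ≤ 0 := by
    by_contra hcon
    exact absurd h2 (not_le.2 (mul_pos hc (not_le.1 hcon)))
  have h4 : ‖x - x'‖ = 0 := pow_eq_zero_iff (two_ne_zero) |>.1 (le_antisymm h3 (sq_nonneg _))
  exact sub_eq_zero.1 (norm_eq_zero.1 h4)

theorem exists_norm_solve_le : ∃ C : ℝ, 0 ≤ C ∧ ∀ (U : Opens (Space N)) (f : GlobalL2 N),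
    ‖(hA.solve U f : GlobalJet N m)‖ ≤ C * ‖f‖ := by
  obtain ⟨c, hc, hco⟩ := hA.exists_coercive
  refine ⟨c⁻¹, by positivity, fun U f => ?_⟩
  have h1 := hco (hA.solve U f)
  rw [hA.form_solve f (hA.solve U f).2] at h1
  generalize (hA.solve U f : GlobalJet N m) = s at h1 ⊢
  have h3 : c * ‖s‖ ^ 2 ≤ ‖f‖ * ‖s‖ :=
    h1.trans ((real_inner_le_norm _ _).trans (mul_le_mul_of_nonneg_left (jet_norm_fst_le s) (norm_nonneg _)))
  rw [inv_mul_eq_div, le_div_iff₀ hc]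
  rcases (norm_nonneg s).eq_or_lt with h0 | h0
  · rw [← h0]
    simp
  · refine le_of_mul_le_mul_right ?_ h0
    nlinarith

/-- `Q_S(g, h)` in terms of the cut-offs to `S` of families representing `g` and `h` on `S`. -/
theorem Q_eq_form {S : Set (Space N)} (hS : MeasurableSet S)
    {g h : Space N → ℝ × (MultiIndex N m → ℝ)} {x y : GlobalJet N m}
    (hg : ∀ᵐ z ∂volume.restrict S, (g z).1 = x.fst z)
    (hg' : ∀ α, ∀ᵐ z ∂volume.restrict S, (g z).2 α = x.snd α z)
    (hh : ∀ᵐ z ∂volume.restrict S, (h z).1 = y.fst z)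
    (hh' : ∀ α, ∀ᵐ z ∂volume.restrict S, (h z).2 α = y.snd α z) :
    Q A S g h = hA.form (jetMap (cut S hS) x) (jetMap (cut S hS) y) := by
  rw [form_eq, Q]
  congr 1
  · refine Finset.sum_congr rfl fun α _ => Finset.sum_congr rfl fun β _ => ?_
    rw [← integral_indicator hS]
    refine integral_congr_ae ?_
    filter_upwards [cut_ae hS (x.snd α), cut_ae hS (y.snd β),
      (ae_restrict_iff' hS).1 (hg' α), (ae_restrict_iff' hS).1 (hh' β)] with z h1 h2 h3 h4
    rw [jetMap_snd, jetMap_snd, h1, h2]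
    by_cases hz : z ∈ S
    · simp only [Set.indicator_of_mem hz]
      rw [h3 hz, h4 hz]
    · simp only [Set.indicator_of_notMem hz, mul_zero]
  · rw [L2_inner_eq, ← integral_indicator hS]
    refine integral_congr_ae ?_
    filter_upwards [cut_ae hS x.fst, cut_ae hS y.fst,
      (ae_restrict_iff' hS).1 hg, (ae_restrict_iff' hS).1 hh] with z h1 h2 h3 h4
    rw [jetMap_fst, jetMap_fst, h1, h2]
    by_cases hz : z ∈ S
    · simp only [Set.indicator_of_mem hz]
      rw [h3 hz, h4 hz]
    · simp only [Set.indicator_of_notMem hz, mul_zero]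

theorem Q_jet (w v : W m U) :
    Q A U (jet w) (jet v) = hA.form (toGlobal m U w) (toGlobal m U v) := by
  rw [hA.Q_eq_form U.isOpen.measurableSet (jet_fst_ae subset_rfl w) (jet_snd_ae subset_rfl w)
    (jet_fst_ae subset_rfl v) (jet_snd_ae subset_rfl v), jetMap_cut_toGlobal, jetMap_cut_toGlobal]

/-- The operator on `L²(ℝ^N)` that takes `f` to the solution `w ∈ W^{m,2}_0(U)` of `Q(w, v) = ⟨f, v⟩`
for all `v ∈ W^{m,2}_0(U)`, extended by zero. -/
def globalInverse (U : Opens (Space N)) : GlobalL2 N →L[ℝ] GlobalL2 N :=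
  jetFst.comp ((globalW0 m U).subtypeL.comp (hA.solve U))

theorem globalInverse_apply (f : GlobalL2 N) :
    hA.globalInverse U f = (hA.solve U f : GlobalJet N m).fst := rfl

/-- The inverse of the operator of the form `Q_U` with form domain `W^{m,2}_0(U)`. -/
def inverse (U : Opens (Space N)) : L2 U →L[ℝ] L2 U :=
  (resL2 U).comp ((hA.globalInverse U).comp (extL2 U).toContinuousLinearMap)

theorem inverse_apply (f : L2 U) :
    hA.inverse U f = resL2 U (hA.globalInverse U (extL2 U f)) := rfl

theorem extL2_inverse (f : L2 U) :
    extL2 U (hA.inverse U f) = hA.globalInverse U (extL2 U f) := by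
  rw [inverse_apply, extL2_resL2, globalInverse_apply, ← jetMap_fst,
    jetMap_cut_of_mem (hA.solve U (extL2 U f)).2]

theorem isInverseOperator_inverse (U : Opens (Space N)) :
    IsInverseOperator A (W0 m U) (hA.inverse U) := by
  intro f u
  constructor
  · rintro rfl
    refine ⟨ofGlobal m U (hA.solve U (extL2 U f)), ofGlobal_mem _, rfl, fun v hv => ?_⟩
    rw [hA.Q_jet, toGlobal_ofGlobal, hA.form_solve _ (toGlobal_mem hv), toGlobal_fst,
      (extL2 U).inner_map_map]
  · rintro ⟨w, hw, rfl, h⟩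
    have e : toGlobal m U w = hA.solve U (extL2 U f) := by
      refine hA.eq_of_form_eq (toGlobal_mem hw) (hA.solve U _).2 fun y hy => ?_
      obtain ⟨v, hv, rfl⟩ := exists_toGlobal_eq hy
      rw [← hA.Q_jet, h v hv, hA.form_solve _ hy, toGlobal_fst, (extL2 U).inner_map_map]
    rw [inverse_apply, globalInverse_apply, ← e, toGlobal_fst, resL2_extL2]

end IsEllipticCoeff

end

section

/-! ### Mosco convergence and the sets `K_ε` -/

variable {N m : ℕ} {U U' D Ω : Opens (Space N)} {Ωε : ℝ → Opens (Space N)}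

theorem norm_sub_starProjection_le {H : Type*} [NormedAddCommGroup H] [InnerProductSpace ℝ H]
    (K : Submodule ℝ H) [K.HasOrthogonalProjection] (x : H) {y : H} (hy : y ∈ K) :
    ‖x - K.starProjection x‖ ≤ ‖x - y‖ := by
  rw [K.starProjection_minimal]
  exact ciInf_le (f := fun z : K => ‖x - z‖) ⟨0, by rintro _ ⟨z, rfl⟩; exact norm_nonneg _⟩ ⟨y, hy⟩

/-- The recovery sequences of Mosco convergence may be taken to be orthogonal projections. -/
theorem MoscoConverges.tendsto_starProjection (hM : MoscoConverges m D Ωε Ω) (hΩ : Ω ≤ D)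
    (hΩε : ∀ ε > 0, Ωε ε ≤ D) {x : GlobalJet N m} (hx : x ∈ globalW0 m Ω) :
    Tendsto (fun ε => (globalW0 m (Ωε ε)).starProjection x) (𝓝[>] 0) (𝓝 x) := by
  set w : W m D := ofGlobal m D ⟨x, globalW0_mono hΩ hx⟩ with hw
  have hwx : toGlobal m D w = x := toGlobal_ofGlobal _
  obtain ⟨φ, hφ, hlim⟩ := hM.approx w ((mem_extendedW0_iff hΩ).2 (by rwa [hwx]))
  have h1 : Tendsto (fun ε => ‖x - toGlobal m D (φ ε)‖) (𝓝[>] 0) (𝓝 0) := by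
    have h2 := ((toGlobal m D).continuous.tendsto w).comp hlim
    rw [hwx] at h2
    simpa using ((tendsto_const_nhds (x := x)).sub h2).norm
  rw [tendsto_iff_norm_sub_tendsto_zero]
  refine squeeze_zero' (Eventually.of_forall fun _ => norm_nonneg _) ?_ h1
  filter_upwards [self_mem_nhdsWithin] with ε hε
  rw [norm_sub_rev]
  exact norm_sub_starProjection_le _ _ ((mem_extendedW0_iff (hΩε ε hε)).1 (hφ ε hε))

theorem MoscoConverges.mem_of_weaklyTendsto (hM : MoscoConverges m D Ωε Ω) (hΩ : Ω ≤ D)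
    (hΩε : ∀ ε > 0, Ωε ε ≤ D) {e : ℕ → ℝ} (he0 : ∀ n, 0 < e n) (he : Tendsto e atTop (𝓝 0))
    {x : ℕ → GlobalJet N m} (hx : ∀ n, x n ∈ globalW0 m (Ωε (e n))) {x₀ : GlobalJet N m}
    (hw : WeaklyTendsto x x₀) : x₀ ∈ globalW0 m Ω := by
  have hxD : ∀ n, x n ∈ globalW0 m D := fun n => globalW0_mono (hΩε _ (he0 n)) (hx n)
  have hx₀ : x₀ ∈ globalW0 m D := hw.mem hxD
  have h1 := hM.weak_limit (ofGlobal m D ⟨x₀, hx₀⟩) (ofGlobal_mem _) e he0 he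
    (fun n => ofGlobal m D ⟨x n, hxD n⟩)
    (fun n => (mem_extendedW0_iff (hΩε _ (he0 n))).2 (by rw [toGlobal_ofGlobal]; exact hx n))
    (fun l => by
      -- A functional on `W^{m,2}(D)` is extended through the orthogonal projection.
      let L : GlobalJet N m →L[ℝ] ℝ :=
        (l.comp (ofGlobal m D)).comp (globalW0 m D).orthogonalProjectionOnto
      have hL : ∀ y (hy : y ∈ globalW0 m D), inner ℝ y ((InnerProductSpace.toDual ℝ _).symm L) =
          l (ofGlobal m D ⟨y, hy⟩) := by
        intro y hy
        rw [real_inner_comm, InnerProductSpace.toDual_symm_apply]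
        change l (ofGlobal m D ((globalW0 m D).orthogonalProjectionOnto y)) = _
        rw [Submodule.orthogonalProjectionOnto_mem_subspace_eq_self (⟨y, hy⟩ : globalW0 m D)]
      have h2 := hw ((InnerProductSpace.toDual ℝ _).symm L)
      rw [hL x₀ hx₀] at h2
      exact h2.congr fun n => hL _ (hxD n))
  rwa [mem_extendedW0_iff hΩ, toGlobal_ofGlobal] at h1

/-- Bounded sequences in the varying spaces `W^{m,2}_0(Ω_{ε_n})`, `ε_n → 0+`, are relatively compact
for weak convergence in `W^{m,2}` and for convergence in `L²`, with limits in `W^{m,2}_0(Ω)`. -/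
theorem MoscoConverges.exists_subseq (hM : MoscoConverges m D Ωε Ω) (hm : 1 ≤ m)
    (hD : Bornology.IsBounded (D : Set (Space N))) (hΩ : Ω ≤ D)
    (hΩε : ∀ ε > 0, Ωε ε ≤ D) {e : ℕ → ℝ} (he0 : ∀ n, 0 < e n) (he : Tendsto e atTop (𝓝 0))
    {x : ℕ → GlobalJet N m} (hx : ∀ n, x n ∈ globalW0 m (Ωε (e n))) {C : ℝ}
    (hC : ∀ n, ‖x n‖ ≤ C) :
    ∃ k : ℕ → ℕ, StrictMono k ∧ ∃ x₀ ∈ globalW0 m Ω, WeaklyTendsto (fun n => x (k n)) x₀ ∧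
      Tendsto (fun n => (x (k n)).fst) atTop (𝓝 x₀.fst) := by
  obtain ⟨k, hk, x₀, hw⟩ := exists_weaklyTendsto_subseq hC
  refine ⟨k, hk, x₀, hM.mem_of_weaklyTendsto hΩ hΩε (fun n => he0 (k n))
    (he.comp hk.tendsto_atTop) (fun n => hx (k n)) hw, hw, ?_⟩
  exact tendsto_fst_of_weaklyTendsto hm hD
    (fun n => globalW0_mono (hΩε _ (he0 (k n))) (hx (k n))) (fun n => hC (k n)) hw

theorem cut_norm_mono {S T : Set (Space N)} (hS : MeasurableSet S) (hT : MeasurableSet T)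
    (h : S ⊆ T) (f : GlobalL2 N) : ‖cut S hS f‖ ≤ ‖cut T hT f‖ := by
  refine Lp.norm_le_norm_of_ae_le ?_
  filter_upwards [cut_ae hS f, cut_ae hT f] with x h1 h2
  rw [h1, h2]
  exact norm_indicator_le_of_subset h _ _

theorem jetMap_cut_norm_mono {S T : Set (Space N)} (hS : MeasurableSet S) (hT : MeasurableSet T)
    (h : S ⊆ T) (x : GlobalJet N m) : ‖jetMap (cut S hS) x‖ ≤ ‖jetMap (cut T hT) x‖ := by
  refine le_of_sq_le_sq ?_ (norm_nonneg _)
  simp only [jet_norm_sq, jetMap_fst, jetMap_snd]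
  gcongr <;> exact cut_norm_mono hS hT h _

theorem cut_cut {S T : Set (Space N)} (hS : MeasurableSet S) (hT : MeasurableSet T)
    (f : GlobalL2 N) : cut S hS (cut T hT f) = cut (S ∩ T) (hS.inter hT) f := by
  refine Lp.ext ?_
  filter_upwards [cut_ae hS (cut T hT f), cut_ae hT f, cut_ae (hS.inter hT) f] with x h1 h2 h3
  rw [h1, h3, ← Set.indicator_indicator]
  by_cases hx : x ∈ S
  · rw [Set.indicator_of_mem hx, Set.indicator_of_mem hx, h2]
  · rw [Set.indicator_of_notMem hx, Set.indicator_of_notMem hx]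

/-- Elements of `W^{m,2}_0(U)` only see the part of `S` inside `U`. -/
theorem jetMap_cut_norm_le_of_mem {S T : Set (Space N)} (hS : MeasurableSet S)
    (hT : MeasurableSet T) (h : S ∩ U ⊆ T) {x : GlobalJet N m} (hx : x ∈ globalW0 m U) :
    ‖jetMap (cut S hS) x‖ ≤ ‖jetMap (cut T hT) x‖ := by
  have e : jetMap (cut S hS) x = jetMap (cut (S ∩ U) (hS.inter U.isOpen.measurableSet)) x := by
    conv_lhs => rw [← jetMap_cut_of_mem hx]
    exact jet_ext (cut_cut hS U.isOpen.measurableSet _)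
      fun _ => cut_cut hS U.isOpen.measurableSet _
  rw [e]
  exact jetMap_cut_norm_mono _ _ h x

/-- The energy of a fixed family on sets of small measure is small. -/
theorem tendsto_jetMap_cut_of_volume {ι : Type*} {l : Filter ι} {S : ι → Set (Space N)}
    (hS : ∀ i, MeasurableSet (S i)) (h : Tendsto (fun i => volume (S i)) l (𝓝 0))
    (x : GlobalJet N m) : Tendsto (fun i => ‖jetMap (cut (S i) (hS i)) x‖) l (𝓝 0) := by
  have h1 : ∀ f : GlobalL2 N, Tendsto (fun i => ‖cut (S i) (hS i) f‖ ^ 2) l (𝓝 0) := by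
    intro f
    simp_rw [cut_norm_sq]
    exact (Lp.memLp f).integrable_sq.tendsto_setIntegral_nhds_zero h
  have h2 : Tendsto (fun i => ‖jetMap (cut (S i) (hS i)) x‖ ^ 2) l (𝓝 0) := by
    simp_rw [jet_norm_sq, jetMap_fst, jetMap_snd]
    simpa using (h1 x.fst).add (tendsto_finsetSum Finset.univ fun α _ => h1 (x.snd α))
  simpa using h2.sqrt

/-- A test function on `Ω` that exceeds `1` on a given compact subset of `Ω`. -/
theorem exists_test_gt_one {F : Set (Space N)} (hF : IsCompact F) (hFΩ : F ⊆ Ω) :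
    ∃ χ : Space N → ℝ, IsTest Ω χ ∧ (∀ x, 0 ≤ χ x) ∧ ∀ x ∈ F, 1 < χ x := by
  obtain ⟨L, hL, hFL, hLΩ⟩ := exists_compact_between hF Ω.isOpen hFΩ
  obtain ⟨f, hsupp, hf, hrange⟩ := (isOpen_interior (s := L)).exists_contDiff_support_eq (n := ⊤)
  have hnn : ∀ x, 0 ≤ f x := fun x => (hrange ⟨x, rfl⟩).1
  have htL : tsupport f ⊆ L := by
    rw [tsupport, hsupp]
    exact closure_minimal interior_subset hL.isClosed
  have htest : IsTest Ω f := ⟨hf, hL.of_isClosed_subset (isClosed_tsupport f) htL, htL.trans hLΩ⟩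
  rcases F.eq_empty_or_nonempty with rfl | hne
  · exact ⟨f, htest, hnn, by simp⟩
  · obtain ⟨x₀, hx₀, hmin⟩ := hF.exists_isMinOn hne hf.continuous.continuousOn
    have hpos : 0 < f x₀ := (hnn x₀).lt_of_ne' (by
      have : x₀ ∈ Function.support f := by rw [hsupp]; exact hFL hx₀
      exact this)
    refine ⟨(2 / f x₀) • f, htest.const_smul _, fun x => ?_, fun x hx => ?_⟩
    · exact mul_nonneg (by positivity) (hnn x)
    · have h1 : f x₀ ≤ f x := hmin hx
      change 1 < 2 / f x₀ * f x
      rw [div_mul_eq_mul_div, lt_div_iff₀ hpos]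
      linarith

/-- A diagonal argument: properties that hold eventually for every `j` hold eventually for some
`j = J a → ∞`. -/
theorem exists_tendsto_atTop_of_forall_eventually {α : Type*} {l : Filter α} {u : α → ℕ}
    (hu : Tendsto u l atTop) {p : ℕ → α → Prop} (hp : ∀ j, ∀ᶠ a in l, p j a) :
    ∃ J : α → ℕ, Tendsto J l atTop ∧ ∀ᶠ a in l, p (J a) a := by
  classical
  refine ⟨fun a => Nat.findGreatest (fun j => p j a) (u a), tendsto_atTop.2 fun j => ?_, ?_⟩
  · filter_upwards [hp j, hu.eventually_ge_atTop j] with a h1 h2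
    exact Nat.le_findGreatest h2 h1
  · filter_upwards [hp 0] with a h
    exact Nat.findGreatest_spec (P := fun j => p j a) (Nat.zero_le _) h

/-- On sets compactly inside `Ω`, the elements of `W^{m,2}_0(Ω_ε)` are approximated in energy by
their projections to `W^{m,2}_0(Ω)`, uniformly on bounded sets. -/
theorem MoscoConverges.eventually_norm_cut_le (hM : MoscoConverges m D Ωε Ω) (hm : 1 ≤ m)
    (hD : Bornology.IsBounded (D : Set (Space N))) (hΩ : Ω ≤ D)
    (hΩε : ∀ ε > 0, Ωε ε ≤ D) {χ : Space N → ℝ} (hχ : IsTest Ω χ) (hχ0 : ∀ x, 0 ≤ χ x)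
    {K : Set (Space N)} (hK : MeasurableSet K) (hχK : ∀ x ∈ K, 1 ≤ χ x) {δ : ℝ} (hδ : 0 < δ) :
    ∀ᶠ ε in 𝓝[>] (0 : ℝ), ∀ v ∈ globalW0 m (Ωε ε),
      ‖jetMap (cut K hK) (v - (globalW0 m Ω).starProjection v)‖ ≤ δ * ‖v‖ := by
  -- Otherwise there are normalised counterexamples `y n`; along a subsequence they converge weakly
  -- to an element of `W^{m,2}_0(Ω)`, so that `y n - P (y n)` is weakly null.
  by_contra hcon
  have hfreq := (not_eventually.1 hcon).and_eventually
    (self_mem_nhdsWithin (a := (0 : ℝ)) (s := Set.Ioi 0))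
  obtain ⟨e, he, hall⟩ := exists_seq_forall_of_frequently hfreq
  have he0 : ∀ n, 0 < e n := fun n => (hall n).2
  have he' : Tendsto e atTop (𝓝 0) := he.mono_right nhdsWithin_le_nhds
  have hex : ∀ n, ∃ y ∈ globalW0 m (Ωε (e n)), ‖y‖ = 1 ∧
      δ < ‖jetMap (cut K hK) (y - (globalW0 m Ω).starProjection y)‖ := by
    intro n
    have h1 := (hall n).1
    push Not at h1
    obtain ⟨v, hv, hlt⟩ := h1
    have hv0 : 0 < ‖v‖ := by
      refine (norm_nonneg v).lt_of_ne' fun h0 => ?_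
      rw [norm_eq_zero.1 h0] at hlt
      simp at hlt
    refine ⟨‖v‖⁻¹ • v, Submodule.smul_mem _ _ hv, ?_, ?_⟩
    · rw [norm_smul, norm_inv, norm_norm, inv_mul_cancel₀ hv0.ne']
    · rw [map_smul, ← smul_sub, map_smul, norm_smul, norm_inv, norm_norm, inv_mul_eq_div,
        lt_div_iff₀ hv0]
      exact hlt
  choose y hy hy1 hyδ using hex
  obtain ⟨k, hk, w, hwΩ, hw, -⟩ := hM.exists_subseq hm hD hΩ hΩε he0 he' hy fun n => (hy1 n).le
  set P := (globalW0 m Ω).starProjection with hP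
  have hPw : P w = w := (globalW0 m Ω).starProjection_eq_self_iff.2 hwΩ
  have hweak : WeaklyTendsto (fun n => y (k n) - P (y (k n))) 0 := by
    have := hw.sub (hw.map P)
    rwa [hPw, sub_self] at this
  have hlim := tendsto_jetMap_cut (C := 1) hD hχ hχ0 hK hχK
    (fun n => sub_mem (globalW0_mono (hΩε _ (he0 (k n))) (hy (k n)))
      (globalW0_mono hΩ ((globalW0 m Ω).starProjection_apply_mem (y (k n)))))
    (fun n => (norm_sub_starProjection_le _ _ (zero_mem (globalW0 m Ω))).trans
      (by rw [sub_zero, hy1]))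
    hweak (fun n z hz => (globalW0 m Ω).starProjection_inner_eq_zero _ _ hz)
  exact absurd (ge_of_tendsto' hlim fun n => (hyδ (k n)).le) (not_le.2 hδ)

/-- Mosco convergence implies that compact parts of `Ω` are asymptotically covered by `Ω_ε`: the
projection of `χ` to `W^{m,2}_0(Ω_ε)` is close to `χ` and vanishes outside `Ω_ε`. -/
theorem MoscoConverges.eventually_volume_le (hM : MoscoConverges m D Ωε Ω)
    (hΩ : Ω ≤ D) (hΩε : ∀ ε > 0, Ωε ε ≤ D) {χ : Space N → ℝ} (hχ : IsTest Ω χ)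
    {K : Set (Space N)} (hK : MeasurableSet K) (hχK : ∀ x ∈ K, 1 ≤ χ x)
    (hKfin : volume K ≠ ⊤) {δ : ℝ} (hδ : 0 < δ) :
    ∀ᶠ ε in 𝓝[>] (0 : ℝ), volume.real (K \ Ωε ε) ≤ δ := by
  have h1 := hM.tendsto_starProjection hΩ hΩε (hχ.globalJet_mem (m := m))
  have h2 : Tendsto (fun ε => ‖hχ.globalJet m -
      (globalW0 m (Ωε ε)).starProjection (hχ.globalJet m)‖ ^ 2) (𝓝[>] 0) (𝓝 0) := by
    simpa using ((tendsto_const_nhds (x := hχ.globalJet m)).sub h1).norm.pow 2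
  filter_upwards [h2.eventually_lt_const hδ] with ε hε
  refine le_trans ?_ hε.le
  set p := (globalW0 m (Ωε ε)).starProjection (hχ.globalJet m) with hp
  have hpm : p ∈ globalW0 m (Ωε ε) := Submodule.starProjection_apply_mem _ _
  have hp0 : cut (Ωε ε) (Ωε ε).isOpen.measurableSet p.fst = p.fst :=
    congrArg (fun x => jetFst x) (jetMap_cut_of_mem hpm)
  have hS : MeasurableSet (K \ Ωε ε) := hK.diff (Ωε ε).isOpen.measurableSet
  have hSfin : volume (K \ Ωε ε) ≠ ⊤ :=
    ((measure_mono Set.sdiff_subset).trans_lt hKfin.lt_top).ne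
  calc volume.real (K \ Ωε ε) = ∫ _ in K \ Ωε ε, (1 : ℝ) := by simp
    _ ≤ ∫ x in K \ Ωε ε, (hχ.globalJet m - p).fst x ^ 2 := by
        refine integral_mono_ae (integrableOn_const hSfin)
          (Lp.memLp _).integrable_sq.integrableOn ?_
        filter_upwards [ae_restrict_mem hS, ae_restrict_of_ae (hχ.globalJet_fst_ae m),
          ae_restrict_of_ae (cut_ae (Ωε ε).isOpen.measurableSet p.fst),
          ae_restrict_of_ae (Lp.coeFn_sub (hχ.globalJet m).fst p.fst)] with x hx e1 e2 e3
        have e4 : (hχ.globalJet m - p).fst x = χ x := by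
          refine e3.trans ?_
          rw [hp0, Set.indicator_of_notMem hx.2] at e2
          rw [Pi.sub_apply, e1, e2, sub_zero]
        rw [e4]
        exact one_le_pow₀ (hχK x hx.1)
    _ = ‖cut _ hS (hχ.globalJet m - p).fst‖ ^ 2 := (cut_norm_sq hS _).symm
    _ ≤ ‖hχ.globalJet m - p‖ ^ 2 :=
        pow_le_pow_left₀ (norm_nonneg _) ((cut_norm_le hS _).trans (jet_norm_fst_le _)) 2

/-- The open sets `K_ε ⊆ Ω ∩ Ω_ε` fill `Ω`, but so slowly that the elements of `W^{m,2}_0(Ω_ε)` are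
approximated on `K_ε` by their projections to `W^{m,2}_0(Ω)`. -/
structure FillsSlowly (m : ℕ) (Ωε : ℝ → Opens (Space N)) (Ω : Opens (Space N))
    (K : ℝ → Opens (Space N)) : Prop where
  le : ∀ ε, K ε ≤ Ω ⊓ Ωε ε
  tendsto_volume : Tendsto (fun ε => volume ((Ω : Set (Space N)) \ K ε)) (𝓝[>] 0) (𝓝 0)
  approx : ∃ δ : ℝ → ℝ, Tendsto δ (𝓝[>] 0) (𝓝 0) ∧ (∀ ε, 0 ≤ δ ε) ∧ ∀ᶠ ε in 𝓝[>] (0 : ℝ),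
    ∀ v ∈ globalW0 m (Ωε ε), ‖jetMap (cut (K ε) (K ε).isOpen.measurableSet)
      (v - (globalW0 m Ω).starProjection v)‖ ≤ δ ε * ‖v‖

theorem MoscoConverges.exists_fillsSlowly (hM : MoscoConverges m D Ωε Ω) (hm : 1 ≤ m)
    (hD : Bornology.IsBounded (D : Set (Space N))) (hΩ : Ω ≤ D) (hΩε : ∀ ε > 0, Ωε ε ≤ D) :
    ∃ K : ℝ → Opens (Space N), FillsSlowly m Ωε Ω K := by
  obtain ⟨F, hFc, hFΩ, hFU, hFm⟩ := Ω.isOpen.exists_iUnion_isClosed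
  have hΩb : Bornology.IsBounded (Ω : Set (Space N)) := hD.subset hΩ
  have hex : ∀ j, ∃ χ : Space N → ℝ, IsTest Ω χ ∧ (∀ x, 0 ≤ χ x) ∧ ∀ x ∈ F j, 1 < χ x :=
    fun j => exists_test_gt_one (Metric.isCompact_of_isClosed_isBounded (hFc j)
      (hΩb.subset (hFΩ j))) (hFΩ j)
  choose χ hχ hχ0 hχF using hex
  -- The open sets `L j` lie compactly in `Ω` and contain the members `F j` of an exhaustion of `Ω`.
  let L : ℕ → Opens (Space N) := fun j => ⟨{x | 1 < χ j x},
    isOpen_lt continuous_const (hχ j).continuous⟩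
  have hLΩ : ∀ j, L j ≤ Ω := by
    intro j x hx
    by_contra hxΩ
    have h0 := (hχ j).eq_zero_of_notMem hxΩ
    have h1 : 1 < χ j x := hx
    linarith
  have hL1 : ∀ j, ∀ x ∈ (L j : Set (Space N)), 1 ≤ χ j x := fun j x hx => le_of_lt hx
  have hLfin : ∀ j, volume (L j : Set (Space N)) ≠ ⊤ := fun j =>
    (hΩb.subset (hLΩ j)).measure_lt_top.ne
  have hpos : ∀ j : ℕ, (0 : ℝ) < 1 / ((j : ℝ) + 1) := fun j => by positivity
  have hu : Tendsto (fun ε : ℝ => ⌊ε⁻¹⌋₊) (𝓝[>] 0) atTop :=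
    tendsto_nat_floor_atTop.comp tendsto_inv_nhdsGT_zero
  obtain ⟨J, hJ, hev⟩ := exists_tendsto_atTop_of_forall_eventually hu fun j =>
    (hM.eventually_norm_cut_le hm hD hΩ hΩε (hχ j) (hχ0 j) (L j).isOpen.measurableSet (hL1 j)
      (hpos j)).and (hM.eventually_volume_le hΩ hΩε (hχ j) (L j).isOpen.measurableSet (hL1 j)
        (hLfin j) (hpos j))
  have hδ : Tendsto (fun ε => 1 / ((J ε : ℝ) + 1)) (𝓝[>] 0) (𝓝 0) :=
    tendsto_one_div_add_atTop_nhds_zero_nat.comp hJ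
  -- Both smallness conditions hold with bound `1 / (j + 1)` for `j = J ε`.
  refine ⟨fun ε => L (J ε) ⊓ Ωε ε, fun ε => inf_le_inf_right _ (hLΩ _), ?_,
    fun ε => 1 / ((J ε : ℝ) + 1), hδ, fun ε => (hpos _).le, ?_⟩
  · have h1 : Tendsto (fun j => volume ((Ω : Set (Space N)) \ F j)) atTop (𝓝 0) := by
      have := tendsto_measure_iInter_atTop (μ := volume)
        (s := fun j => (Ω : Set (Space N)) \ F j)
        (fun j => (Ω.isOpen.measurableSet.diff (hFc j).measurableSet).nullMeasurableSet)
        (fun i j hij => Set.sdiff_subset_sdiff_right (hFm hij))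
        ⟨0, ((measure_mono Set.sdiff_subset).trans_lt hΩb.measure_lt_top).ne⟩
      rwa [← Set.sdiff_iUnion, hFU, Set.sdiff_self, measure_empty] at this
    have h2 : Tendsto (fun ε => volume ((Ω : Set (Space N)) \ F (J ε)) +
        ENNReal.ofReal (1 / ((J ε : ℝ) + 1))) (𝓝[>] 0) (𝓝 0) := by
      simpa using (h1.comp hJ).add (ENNReal.tendsto_ofReal hδ)
    refine tendsto_of_tendsto_of_tendsto_of_le_of_le' tendsto_const_nhds h2
      (Eventually.of_forall fun _ => zero_le) ?_
    filter_upwards [hev] with ε hε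
    have hsub : (Ω : Set (Space N)) \ (L (J ε) ⊓ Ωε ε : Opens (Space N)) ⊆
        ((Ω : Set (Space N)) \ F (J ε)) ∪ ((L (J ε) : Set (Space N)) \ Ωε ε) := by
      rintro x ⟨hx1, hx2⟩
      by_cases hxF : x ∈ F (J ε)
      · have hxL : x ∈ L (J ε) := hχF _ x hxF
        exact Or.inr ⟨hxL, fun hxε => hx2 ⟨hxL, hxε⟩⟩
      · exact Or.inl ⟨hx1, hxF⟩
    refine (measure_mono hsub).trans ((measure_union_le _ _).trans (add_le_add le_rfl ?_))
    have hfin : volume ((L (J ε) : Set (Space N)) \ Ωε ε) ≠ ⊤ :=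
      ((measure_mono Set.sdiff_subset).trans_lt (hLfin _).lt_top).ne
    rw [← ENNReal.ofReal_toReal hfin]
    exact ENNReal.ofReal_le_ofReal hε.2
  · filter_upwards [hev] with ε hε v hv
    exact (jetMap_cut_norm_mono _ (L (J ε)).isOpen.measurableSet (fun x hx => hx.1) _).trans
      (hε.1 v hv)

end

section

/-! ### Condition (C) -/

variable {N m : ℕ} {U U' D Ω : Opens (Space N)} {Ωε : ℝ → Opens (Space N)}
  {A : MultiIndex N m → MultiIndex N m → Space N → ℝ}

/-- The operator `W^{m,2}_0(U) → W^{m,2}_0(U')` that extends by zero and projects orthogonally. It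
serves as `T_ε` in one direction and as `E_ε` in the other. -/
def transfer (m : ℕ) (U U' : Opens (Space N)) : W0 m U →ₗ[ℝ] W0 m U' :=
  ((ofGlobal m U').toLinearMap.comp ((globalW0 m U').orthogonalProjectionOnto.toLinearMap.comp
    ((toGlobal m U).toLinearMap.comp (W0 m U).subtype))).codRestrict (W0 m U')
      fun _ => ofGlobal_mem _

theorem toGlobal_transfer (v : W0 m U) :
    toGlobal m U' (transfer m U U' v).1 = (globalW0 m U').starProjection (toGlobal m U v.1) :=
  toGlobal_ofGlobal _

-- All that matters about `transfer` is `toGlobal_transfer`.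
attribute [local irreducible] transfer

theorem tendsto_zero_of_le_mul_sq {ι : Type*} {l : Filter ι} {q a : ι → ℝ} {c : ℝ}
    (h0 : ∀ i, 0 ≤ q i) (h : ∀ᶠ i in l, q i ≤ c * a i ^ 2) (ha : Tendsto a l (𝓝 0)) :
    Tendsto q l (𝓝 0) :=
  squeeze_zero' (Eventually.of_forall h0) h (by simpa using (ha.pow 2).const_mul c)

theorem tendsto_zero_add {ι : Type*} {l : Filter ι} {a b : ι → ℝ} (ha : Tendsto a l (𝓝 0))
    (hb : Tendsto b l (𝓝 0)) : Tendsto (fun i => a i + b i) l (𝓝 0) := by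
  simpa using ha.add hb

theorem norm_fn_le (u : W m U) : ‖fn u‖ ≤ ‖toGlobal m U u‖ := by
  rw [← (extL2 U).norm_map, ← toGlobal_fst]
  exact jet_norm_fst_le _

theorem fn_eq_resL2 (u : W m U) : fn u = resL2 U (toGlobal m U u).fst := by
  rw [toGlobal_fst, resL2_extL2]

theorem norm_map_le_add {H H' : Type*} [NormedAddCommGroup H] [InnerProductSpace ℝ H]
    [NormedAddCommGroup H'] [InnerProductSpace ℝ H'] {T : H →L[ℝ] H'} (hT : ∀ u, ‖T u‖ ≤ ‖u‖)
    (x y : H) : ‖T x‖ ≤ ‖x - y‖ + ‖T y‖ := by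
  have h : T x = T (x - y) + T y := by rw [map_sub, sub_add_cancel]
  rw [h]
  exact (norm_add_le _ _).trans (add_le_add (hT _) le_rfl)

theorem jetMap_cut_norm_le {S : Set (Space N)} (hS : MeasurableSet S) (x : GlobalJet N m) :
    ‖jetMap (cut S hS) x‖ ≤ ‖x‖ := jetMap_norm_le (cut_norm_le hS) x

theorem jetMap_cut_norm_le_add {S : Set (Space N)} (hS : MeasurableSet S) (x y : GlobalJet N m) :
    ‖jetMap (cut S hS) x‖ ≤ ‖x - y‖ + ‖jetMap (cut S hS) y‖ :=
  norm_map_le_add (jetMap_cut_norm_le hS) x y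

theorem jetMap_cut_norm_sub_rev {S : Set (Space N)} (hS : MeasurableSet S) (x y : GlobalJet N m) :
    ‖jetMap (cut S hS) (x - y)‖ = ‖jetMap (cut S hS) (y - x)‖ := by
  rw [← norm_neg, ← map_neg, neg_sub]

theorem norm_toGlobal (u : W m U) : ‖toGlobal m U u‖ = ‖u‖ := (toGlobal m U).norm_map u

namespace IsEllipticCoeff

theorem Q_nonneg_le (hA : IsEllipticCoeff A) {S : Set (Space N)} (hS : MeasurableSet S)
    (hSU : S ⊆ U) (w : W m U) {x : GlobalJet N m} (hx : toGlobal m U w = x) :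
    0 ≤ Q A S (jet w) (jet w) ∧
      Q A S (jet w) (jet w) ≤ ‖hA.op‖ * ‖jetMap (cut S hS) x‖ ^ 2 := by
  subst hx
  rw [hA.Q_eq_form hS (jet_fst_ae hSU w) (jet_snd_ae hSU w) (jet_fst_ae hSU w) (jet_snd_ae hSU w)]
  refine ⟨hA.form_self_nonneg _, (le_abs_self _).trans ((hA.form_abs_le _ _).trans_eq ?_)⟩
  ring

theorem Q_sub_nonneg_le (hA : IsEllipticCoeff A) {S : Set (Space N)} (hS : MeasurableSet S)
    (hSU : S ⊆ U) (hSU' : S ⊆ U') (w : W m U) (v : W m U') {x y : GlobalJet N m}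
    (hx : toGlobal m U w = x) (hy : toGlobal m U' v = y) :
    0 ≤ Q A S (jet w - jet v) (jet w - jet v) ∧
      Q A S (jet w - jet v) (jet w - jet v) ≤ ‖hA.op‖ * ‖jetMap (cut S hS) (x - y)‖ ^ 2 := by
  have h1 : ∀ᵐ z ∂volume.restrict S, ((jet w - jet v) z).1 = (x - y).fst z := by
    filter_upwards [jet_fst_ae hSU w, jet_fst_ae hSU' v,
      ae_restrict_of_ae (Lp.coeFn_sub x.fst y.fst)] with z e1 e2 e3
    rw [hx] at e1
    rw [hy] at e2
    refine Eq.trans ?_ e3.symm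
    rw [Pi.sub_apply, Pi.sub_apply, Prod.fst_sub, e1, e2]
  have h2 : ∀ α, ∀ᵐ z ∂volume.restrict S, ((jet w - jet v) z).2 α = (x - y).snd α z := by
    intro α
    filter_upwards [jet_snd_ae hSU w α, jet_snd_ae hSU' v α,
      ae_restrict_of_ae (Lp.coeFn_sub (x.snd α) (y.snd α))] with z e1 e2 e3
    rw [hx] at e1
    rw [hy] at e2
    refine Eq.trans ?_ e3.symm
    rw [Pi.sub_apply, Pi.sub_apply, Prod.snd_sub, Pi.sub_apply, e1, e2]
  rw [hA.Q_eq_form hS h1 h2 h1 h2]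
  refine ⟨hA.form_self_nonneg _, (le_abs_self _).trans ((hA.form_abs_le _ _).trans_eq ?_)⟩
  ring

/-- The form bounds the Sobolev norm, with a constant that does not depend on the open set. -/
theorem exists_norm_toGlobal_le (hA : IsEllipticCoeff A) : ∃ C : ℝ, 0 ≤ C ∧
    ∀ (U : Opens (Space N)) (v : W m U), ‖toGlobal m U v‖ ≤ C * √(Q A U (jet v) (jet v)) := by
  obtain ⟨c, hc, h⟩ := hA.exists_coercive
  refine ⟨(√c)⁻¹, by positivity, fun U v => ?_⟩
  rw [hA.Q_jet, inv_mul_eq_div, le_div_iff₀ (Real.sqrt_pos.2 hc)]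
  refine Real.le_sqrt_of_sq_le ?_
  rw [mul_pow, Real.sq_sqrt hc.le, mul_comm]
  exact h _

theorem exists_bound (hA : IsEllipticCoeff A) {v : ∀ ε, W0 m (Ωε ε)}
    (h : ∃ M : ℝ, ∀ ε > 0, Q A (Ωε ε) (jet (v ε).1) (jet (v ε).1) ≤ M) :
    ∃ C : ℝ, ∀ ε > 0, ‖toGlobal m (Ωε ε) (v ε).1‖ ≤ C := by
  obtain ⟨C, hC, hle⟩ := hA.exists_norm_toGlobal_le
  obtain ⟨M, hM⟩ := h
  exact ⟨C * √M, fun ε hε => (hle _ _).trans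
    (mul_le_mul_of_nonneg_left (Real.sqrt_le_sqrt (hM ε hε)) hC)⟩

end IsEllipticCoeff

/-- To prove convergence as `ε → 0+` it suffices to find, in each sequence of positive numbers
tending to `0`, a subsequence along which it holds. -/
theorem tendsto_nhdsGT_zero_of_subseq {α : Type*} {f : ℝ → α} {l : Filter α}
    [l.IsCountablyGenerated]
    (h : ∀ e : ℕ → ℝ, (∀ n, 0 < e n) → Tendsto e atTop (𝓝 0) →
      ∃ k : ℕ → ℕ, Tendsto (fun n => f (e (k n))) atTop l) :
    Tendsto f (𝓝[>] 0) l := by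
  refine tendsto_of_subseq_tendsto fun e he => ?_
  have hpos : ∀ᶠ n in atTop, e n ∈ Set.Ioi (0 : ℝ) := he self_mem_nhdsWithin
  obtain ⟨n₀, hn₀⟩ := eventually_atTop.1 hpos
  obtain ⟨k, hk⟩ := h (fun n => e (n + n₀)) (fun n => hn₀ _ (Nat.le_add_left _ _))
    ((he.mono_right nhdsWithin_le_nhds).comp (tendsto_add_atTop_nat n₀))
  exact ⟨fun n => k n + n₀, hk⟩

theorem eLpNorm_restrict_eq (u : W m U) {S : Set (Space N)} (hS : MeasurableSet S) (hSU : S ⊆ U) :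
    eLpNorm (fn u) 2 (volume.restrict S) =
      ENNReal.ofReal ‖cut S hS (toGlobal m U u).fst‖ := by
  have h1 : fn u =ᵐ[volume.restrict S] (toGlobal m U u).fst := jet_fst_ae hSU u
  rw [eLpNorm_congr_ae h1, ← eLpNorm_indicator_eq_eLpNorm_restrict hS,
    ← eLpNorm_congr_ae (cut_ae hS (toGlobal m U u).fst), Lp.norm_def,
    ENNReal.ofReal_toReal (Lp.eLpNorm_ne_top _)]

variable {K : ℝ → Opens (Space N)}

theorem FillsSlowly.subset_left (hK : FillsSlowly m Ωε Ω K) (ε : ℝ) : (K ε : Set (Space N)) ⊆ Ω :=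
  fun _ hx => (hK.le ε hx).1

theorem FillsSlowly.subset_right (hK : FillsSlowly m Ωε Ω K) (ε : ℝ) : (K ε : Set (Space N)) ⊆ Ωε ε :=
  fun _ hx => (hK.le ε hx).2

theorem measurableSet_sdiff (U V : Opens (Space N)) : MeasurableSet ((U : Set (Space N)) \ V) :=
  U.isOpen.measurableSet.diff V.isOpen.measurableSet

/-- The energy of an element of `W^{m,2}_0(Ω)` outside `K_ε` tends to zero. -/
theorem FillsSlowly.tendsto_norm_cut (hK : FillsSlowly m Ωε Ω K) {x : GlobalJet N m}
    (hx : x ∈ globalW0 m Ω) :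
    Tendsto (fun ε => ‖jetMap (cut _ (measurableSet_sdiff (Ωε ε) (K ε))) x‖) (𝓝[>] 0) (𝓝 0) :=
  squeeze_zero (fun _ => norm_nonneg _)
    (fun ε => jetMap_cut_norm_le_of_mem _ (measurableSet_sdiff Ω (K ε))
      (fun _ hz => ⟨hz.2, hz.1.2⟩) hx)
    (tendsto_jetMap_cut_of_volume (fun ε => measurableSet_sdiff Ω (K ε)) hK.tendsto_volume x)

/-- Bounded `v_ε ∈ W^{m,2}_0(Ω_ε)` tend to zero in `L²` outside `K_ε`: along a subsequence they
converge in `L²` to an element of `W^{m,2}_0(Ω)`, which has little energy outside `K_ε`. -/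
theorem FillsSlowly.tendsto_eLpNorm (hK : FillsSlowly m Ωε Ω K) (hM : MoscoConverges m D Ωε Ω)
    (hm : 1 ≤ m) (hA : IsEllipticCoeff A) (hD : Bornology.IsBounded (D : Set (Space N)))
    (hΩ : Ω ≤ D) (hΩε : ∀ ε > 0, Ωε ε ≤ D) {v : ∀ ε, W0 m (Ωε ε)}
    (hv : ∃ M : ℝ, ∀ ε > 0, Q A (Ωε ε) (jet (v ε).1) (jet (v ε).1) ≤ M) :
    Tendsto
      (fun ε => eLpNorm (fn (v ε).1) 2 (volume.restrict ((Ωε ε : Set (Space N)) \ K ε)))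
      (𝓝[>] 0) (𝓝 0) := by
  obtain ⟨C, hC⟩ := hA.exists_bound (v := v) hv
  have hlim : Tendsto (fun ε => ‖cut _ (measurableSet_sdiff (Ωε ε) (K ε))
      (toGlobal m (Ωε ε) (v ε).1).fst‖) (𝓝[>] 0) (𝓝 0) := by
    refine tendsto_nhdsGT_zero_of_subseq fun e he0 he => ?_
    obtain ⟨k, hk, w, hwΩ, -, hlim⟩ := hM.exists_subseq hm hD hΩ hΩε he0 he
      (fun n => toGlobal_mem (v (e n)).2) (fun n => hC _ (he0 n))
    have hek : Tendsto (fun n => e (k n)) atTop (𝓝[>] 0) :=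
      tendsto_nhdsWithin_iff.2 ⟨he.comp hk.tendsto_atTop, Eventually.of_forall fun n => he0 _⟩
    refine ⟨k, squeeze_zero (fun _ => norm_nonneg _) (fun n => ?_)
      (tendsto_zero_add (tendsto_iff_norm_sub_tendsto_zero.1 hlim)
        ((hK.tendsto_norm_cut hwΩ).comp hek))⟩
    exact (norm_map_le_add (cut_norm_le _) _ w.fst).trans (add_le_add le_rfl
      (jet_norm_fst_le (jetMap (cut _ (measurableSet_sdiff _ _)) w)))
  have := ENNReal.tendsto_ofReal hlim
  rw [ENNReal.ofReal_zero] at this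
  exact this.congr fun ε =>
    (eLpNorm_restrict_eq _ (measurableSet_sdiff (Ωε ε) (K ε)) Set.sdiff_subset).symm

theorem MoscoConverges.tendsto_norm_transfer_sub (hM : MoscoConverges m D Ωε Ω) (hΩ : Ω ≤ D)
    (hΩε : ∀ ε > 0, Ωε ε ≤ D) (φ : W0 m Ω) :
    Tendsto (fun ε => ‖toGlobal m (Ωε ε) (transfer m Ω (Ωε ε) φ).1 - toGlobal m Ω φ.1‖)
      (𝓝[>] 0) (𝓝 0) :=
  (tendsto_iff_norm_sub_tendsto_zero.1
    (hM.tendsto_starProjection hΩ hΩε (toGlobal_mem φ.2))).congr fun _ =>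
      congrArg (fun z => ‖z - toGlobal m Ω φ.1‖) (toGlobal_transfer φ).symm

theorem FillsSlowly.tendsto_Q_transfer_sub (hK : FillsSlowly m Ωε Ω K)
    (hM : MoscoConverges m D Ωε Ω) (hA : IsEllipticCoeff A) (hΩ : Ω ≤ D)
    (hΩε : ∀ ε > 0, Ωε ε ≤ D) (φ : W0 m Ω) :
    Tendsto (fun ε => Q A (K ε) (jet (transfer m Ω (Ωε ε) φ).1 - jet φ.1)
      (jet (transfer m Ω (Ωε ε) φ).1 - jet φ.1)) (𝓝[>] 0) (𝓝 0) := by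
  have h3 := fun ε => hA.Q_sub_nonneg_le (K ε).isOpen.measurableSet
    (hK.subset_right ε) (hK.subset_left ε) (transfer m Ω (Ωε ε) φ).1 φ.1 rfl rfl
  exact tendsto_zero_of_le_mul_sq (fun ε => (h3 ε).1) (Eventually.of_forall fun ε =>
    (h3 ε).2.trans (mul_le_mul_of_nonneg_left (pow_le_pow_left₀ (norm_nonneg _)
      (jetMap_cut_norm_le _ _) 2) (norm_nonneg _)))
    (hM.tendsto_norm_transfer_sub hΩ hΩε φ)

theorem FillsSlowly.tendsto_Q_transfer (hK : FillsSlowly m Ωε Ω K)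
    (hM : MoscoConverges m D Ωε Ω) (hA : IsEllipticCoeff A) (hΩ : Ω ≤ D)
    (hΩε : ∀ ε > 0, Ωε ε ≤ D) (φ : W0 m Ω) :
    Tendsto (fun ε => Q A ((Ωε ε : Set (Space N)) \ K ε) (jet (transfer m Ω (Ωε ε) φ).1)
      (jet (transfer m Ω (Ωε ε) φ).1)) (𝓝[>] 0) (𝓝 0) := by
  have h2 := tendsto_zero_add (hM.tendsto_norm_transfer_sub hΩ hΩε φ)
    (hK.tendsto_norm_cut (toGlobal_mem φ.2))
  have h3 := fun ε => hA.Q_nonneg_le (measurableSet_sdiff (Ωε ε) (K ε))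
    Set.sdiff_subset (transfer m Ω (Ωε ε) φ).1 rfl
  refine tendsto_zero_of_le_mul_sq (fun ε => (h3 ε).1) (Eventually.of_forall fun ε =>
    (h3 ε).2.trans (mul_le_mul_of_nonneg_left (pow_le_pow_left₀ (norm_nonneg _)
      (jetMap_cut_norm_le_add _ _ (toGlobal m Ω φ.1)) 2)
        (norm_nonneg _))) h2

theorem norm_transfer_le (v : W0 m U) :
    ‖toGlobal m U' (transfer m U U' v).1‖ ≤ ‖toGlobal m U v.1‖ :=
  (congrArg norm (toGlobal_transfer v)).trans_le (Submodule.norm_starProjection_apply_le _ _)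

theorem FillsSlowly.conditionC2 (hK : FillsSlowly m Ωε Ω K) (hM : MoscoConverges m D Ωε Ω)
    (hA : IsEllipticCoeff A) (hΩ : Ω ≤ D) (hΩε : ∀ ε > 0, Ωε ε ≤ D) :
    ConditionC2 A (fun ε => W0 m (Ωε ε)) (W0 m Ω) K (fun ε => transfer m Ω (Ωε ε)) where
  i := hK.tendsto_Q_transfer_sub hM hA hΩ hΩε
  ii := hK.tendsto_Q_transfer hM hA hΩ hΩε
  iii φ := ⟨‖toGlobal m Ω φ.1‖, fun _ _ => (norm_fn_le _).trans (norm_transfer_le φ)⟩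

/-- Rellich's theorem for sequences in the space `W^{m,2}_0(Ω)`, `Ω` bounded. -/
theorem exists_subseq_tendsto_fn (hm : 1 ≤ m) (hD : Bornology.IsBounded (D : Set (Space N)))
    (hΩ : Ω ≤ D) {u : ℕ → W m Ω} (hu : ∀ n, u n ∈ W0 m Ω) {M : ℝ}
    (hbd : ∀ n, ‖toGlobal m Ω (u n)‖ ≤ M) :
    ∃ k : ℕ → ℕ, StrictMono k ∧ ∃ w ∈ W0 m Ω,
      Tendsto (fun n => fn (u (k n))) atTop (𝓝 (fn w)) := by
  have hmem : ∀ n, toGlobal m Ω (u n) ∈ globalW0 m Ω := fun n => toGlobal_mem (hu n)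
  obtain ⟨k, hk, x₀, hw⟩ := exists_weaklyTendsto_subseq hbd
  have hx₀ : x₀ ∈ globalW0 m Ω := hw.mem fun n => hmem (k n)
  refine ⟨k, hk, ofGlobal m Ω ⟨x₀, hx₀⟩, ofGlobal_mem _, ?_⟩
  have h := ((resL2 Ω).continuous.tendsto _).comp (tendsto_fst_of_weaklyTendsto hm hD
    (fun n => globalW0_mono hΩ (hmem (k n))) (fun n => hbd (k n)) hw)
  rw [fn_ofGlobal]
  exact h.congr fun n => (fn_eq_resL2 _).symm

/-- The energy of `E_ε v_ε - v_ε` on `K_ε` tends to zero for bounded `v_ε`. -/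
theorem FillsSlowly.tendsto_Q_transfer_sub_of_bounded (hK : FillsSlowly m Ωε Ω K)
    (hA : IsEllipticCoeff A) {v : ∀ ε, W0 m (Ωε ε)}
    (hv : ∃ M : ℝ, ∀ ε > 0, Q A (Ωε ε) (jet (v ε).1) (jet (v ε).1) ≤ M) :
    Tendsto (fun ε => Q A (K ε) (jet (transfer m (Ωε ε) Ω (v ε)).1 - jet (v ε).1)
      (jet (transfer m (Ωε ε) Ω (v ε)).1 - jet (v ε).1)) (𝓝[>] 0) (𝓝 0) := by
  refine hK.approx.elim fun δ hδ => (hA.exists_bound (v := v) hv).elim fun C hC => ?_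
  have h2 : Tendsto (fun ε => δ ε * C) (𝓝[>] 0) (𝓝 0) := by simpa using hδ.1.mul_const C
  have h3 := fun ε => hA.Q_sub_nonneg_le (K ε).isOpen.measurableSet
    (hK.subset_left ε) (hK.subset_right ε) (transfer m (Ωε ε) Ω (v ε)).1 (v ε).1
    (toGlobal_transfer (v ε)) rfl
  refine tendsto_zero_of_le_mul_sq (c := ‖hA.op‖) (fun ε => (h3 ε).1) ?_ h2
  filter_upwards [hδ.2.2, self_mem_nhdsWithin] with ε hε hε0
  refine (h3 ε).2.trans (mul_le_mul_of_nonneg_left (pow_le_pow_left₀ (norm_nonneg _)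
    (le_trans ?_ (mul_le_mul_of_nonneg_left (hC ε hε0) (hδ.2.1 ε))) 2) (norm_nonneg _))
  exact (jetMap_cut_norm_sub_rev _ _ _).trans_le (hε _ (toGlobal_mem (v ε).2))

theorem FillsSlowly.conditionC3 (hK : FillsSlowly m Ωε Ω K)
    (hm : 1 ≤ m) (hA : IsEllipticCoeff A) (hD : Bornology.IsBounded (D : Set (Space N)))
    (hΩ : Ω ≤ D) :
    ConditionC3 A (fun ε => W0 m (Ωε ε)) (W0 m Ω) K
      (fun ε => (W0 m Ω).subtype.comp (transfer m (Ωε ε) Ω)) where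
  compact e he0 v hv := by
    obtain ⟨M, hM⟩ := hv
    obtain ⟨k, hk, w, -, h⟩ := exists_subseq_tendsto_fn hm hD hΩ
      (fun n => (transfer m (Ωε (e n)) Ω (v n)).2) (M := M)
      (fun n => (norm_toGlobal _).trans_le (hM n))
    exact ⟨k, hk, fn w, h⟩
  i v hv := hK.tendsto_Q_transfer_sub_of_bounded hA hv
  ii := hA.exists_norm_toGlobal_le.elim fun C hC => ⟨C, fun ε _ v =>
    (norm_toGlobal _).symm.trans_le ((norm_transfer_le v).trans (hC.2 (Ωε ε) v.1))⟩
  iii v hv e he0 he w hw := by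
    obtain ⟨C, hC⟩ := hA.exists_bound (v := v) hv
    obtain ⟨k, hk, u, hu, h⟩ := exists_subseq_tendsto_fn hm hD hΩ
      (fun n => (transfer m (Ωε (e n)) Ω (v (e n))).2) (M := C)
      (fun n => (norm_transfer_le (v (e n))).trans (hC _ (he0 n)))
    exact ⟨u, hu, tendsto_nhds_unique h (hw.comp hk.tendsto_atTop)⟩

theorem MoscoConverges.conditionC (hM : MoscoConverges m D Ωε Ω) (hm : 1 ≤ m)
    (hA : IsEllipticCoeff A) (hD : Bornology.IsBounded (D : Set (Space N))) (hΩ : Ω ≤ D)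
    (hΩε : ∀ ε > 0, Ωε ε ≤ D) : ConditionC A (fun ε => W0 m (Ωε ε)) (W0 m Ω) := by
  obtain ⟨K, hK⟩ := hM.exists_fillsSlowly hm hD hΩ hΩε
  exact ⟨K, fun ε _ => hK.le ε, hK.tendsto_volume,
    fun v hv => hK.tendsto_eLpNorm hM hm hA hD hΩ hΩε hv,
    ⟨_, hK.conditionC2 hM hA hΩ hΩε⟩, ⟨_, hK.conditionC3 hm hA hD hΩ⟩⟩

end

section

/-! ### Compact convergence of the inverse operators -/

variable {N m : ℕ} {U U' D Ω : Opens (Space N)} {Ωε : ℝ → Opens (Space N)}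
  {A : MultiIndex N m → MultiIndex N m → Space N → ℝ}

theorem isCompactOperator_of_subseq {E F : Type*} [NormedAddCommGroup E] [NormedSpace ℝ E]
    [NormedAddCommGroup F] [NormedSpace ℝ F] (T : E →L[ℝ] F)
    (h : ∀ f : ℕ → E, (∀ n, ‖f n‖ ≤ 1) →
      ∃ k : ℕ → ℕ, StrictMono k ∧ ∃ w, Tendsto (fun n => T (f (k n))) atTop (𝓝 w)) :
    IsCompactOperator T := by
  refine (isCompactOperator_iff_isCompact_closure_image_closedBall T.toLinearMap one_pos).2 ?_
  refine IsSeqCompact.isCompact fun y hy => ?_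
  -- Approximate `y n` by the image of an element of the unit ball.
  have hex : ∀ n, ∃ f : E, ‖f‖ ≤ 1 ∧ dist (y n) (T f) < 1 / ((n : ℝ) + 1) := fun n => by
    obtain ⟨z, ⟨f, hf, rfl⟩, hz⟩ :=
      Metric.mem_closure_iff.1 (hy n) _ (Nat.one_div_pos_of_nat (n := n))
    exact ⟨f, mem_closedBall_zero_iff.1 hf, hz⟩
  choose f hf hyf using hex
  obtain ⟨k, hk, w, hw⟩ := h f hf
  have hlim : Tendsto (fun n => y (k n)) atTop (𝓝 w) := by
    refine (tendsto_iff_of_dist ?_).2 hw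
    exact squeeze_zero (fun _ => dist_nonneg) (fun n => (hyf (k n)).le)
      (tendsto_one_div_add_atTop_nhds_zero_nat.comp hk.tendsto_atTop)
  exact ⟨w, isClosed_closure.mem_of_tendsto hlim (Eventually.of_forall fun n => hy (k n)),
    k, hk, hlim⟩

theorem cut_symm {S : Set (Space N)} (hS : MeasurableSet S) (f g : GlobalL2 N) :
    inner ℝ (cut S hS f) g = inner ℝ f (cut S hS g) := mulOp_symm _ _ _

theorem norm_sub_zeroExt (u : L2 U') (w : L2 U) :
    ‖u - zeroExt U' w‖ = ‖extL2 U' u - cut U' U'.isOpen.measurableSet (extL2 U w)‖ := by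
  rw [← (extL2 U').norm_map, map_sub, zeroExt_eq, extL2_resL2]

theorem norm_sub_zeroExt_le (u : L2 U') (w : L2 U) :
    ‖u - zeroExt U' w‖ ≤ ‖extL2 U' u - extL2 U w‖ := by
  rw [norm_sub_zeroExt, ← cut_extL2 u, ← map_sub, cut_extL2]
  exact cut_norm_le _ _

namespace IsEllipticCoeff

variable (hA : IsEllipticCoeff A)

/-- The solution on `U` depends only on the values of the right-hand side in `U`. -/
theorem globalInverse_cut (f : GlobalL2 N) :
    hA.globalInverse U (cut U U.isOpen.measurableSet f) = hA.globalInverse U f := by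
  have h : (hA.solve U (cut U U.isOpen.measurableSet f) : GlobalJet N m) = hA.solve U f := by
    refine hA.eq_of_form_eq (hA.solve U _).2 (hA.solve U f).2 fun y hy => ?_
    rw [hA.form_solve _ hy, hA.form_solve _ hy, cut_symm, ← jetMap_fst, jetMap_cut_of_mem hy]
  exact congrArg WithLp.fst h

theorem exists_norm_globalInverse_le : ∃ C : ℝ, 0 ≤ C ∧
    ∀ (U : Opens (Space N)) (f : GlobalL2 N), ‖hA.globalInverse U f‖ ≤ C * ‖f‖ :=
  hA.exists_norm_solve_le.imp fun _ hC =>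
    ⟨hC.1, fun U f => (jet_norm_fst_le _).trans (hC.2 U f)⟩

theorem exists_norm_solve_le_one : ∃ C : ℝ, ∀ (U : Opens (Space N)) (f : GlobalL2 N), ‖f‖ ≤ 1 →
    ‖(hA.solve U f : GlobalJet N m)‖ ≤ C :=
  hA.exists_norm_solve_le.imp fun _ hC U f hf =>
    (hC.2 U f).trans (mul_le_of_le_one_right hC.1 hf)

theorem isCompactOperator_inverse (hm : 1 ≤ m) (hD : Bornology.IsBounded (D : Set (Space N)))
    (hU : U ≤ D) : IsCompactOperator (hA.inverse U) := by
  refine isCompactOperator_of_subseq _ fun f hf => ?_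
  obtain ⟨C, hC⟩ := hA.exists_norm_solve_le_one
  have hbd : ∀ n, ‖(hA.solve U (extL2 U (f n)) : GlobalJet N m)‖ ≤ C := fun n =>
    hC _ _ (((extL2 U).norm_map _).trans_le (hf n))
  obtain ⟨k, hk, x₀, hw⟩ := exists_weaklyTendsto_subseq hbd
  exact ⟨k, hk, resL2 U x₀.fst, ((resL2 U).continuous.tendsto _).comp
    (tendsto_fst_of_weaklyTendsto hm hD (fun n => globalW0_mono hU (hA.solve U _).2)
      (fun n => hbd (k n)) hw)⟩

/-- The limit of solutions of the equations on `Ω_ε` solves the equation on `Ω`: test the former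
with the projections of a test element for the latter. -/
theorem eq_solve_of_weaklyTendsto (hM : MoscoConverges m D Ωε Ω) (hΩ : Ω ≤ D)
    (hΩε : ∀ ε > 0, Ωε ε ≤ D) {e : ℕ → ℝ} (he : Tendsto e atTop (𝓝[>] 0)) {f : GlobalL2 N}
    {x₀ : GlobalJet N m} (hx₀ : x₀ ∈ globalW0 m Ω) {C : ℝ}
    (hC : ∀ n, ‖(hA.solve (Ωε (e n)) f : GlobalJet N m)‖ ≤ C)
    (hw : WeaklyTendsto (fun n => (hA.solve (Ωε (e n)) f : GlobalJet N m)) x₀) :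
    x₀ = hA.solve Ω f := by
  refine hA.eq_of_form_eq hx₀ (hA.solve Ω f).2 fun y hy => ?_
  rw [hA.form_solve f hy]
  have hy' : Tendsto (fun n => (globalW0 m (Ωε (e n))).starProjection y) atTop (𝓝 y) :=
    (hM.tendsto_starProjection hΩ hΩε hy).comp he
  have h1 := (hw.map hA.op).inner_tendsto (fun n => (hA.op.le_opNorm _).trans
    (mul_le_mul_of_nonneg_left (hC n) (norm_nonneg _))) hy'
  have h2 : Tendsto (fun n => inner ℝ f ((globalW0 m (Ωε (e n))).starProjection y).fst) atTop
      (𝓝 (inner ℝ f y.fst)) :=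
    tendsto_const_nhds.inner ((jetFst.continuous.tendsto y).comp hy')
  refine tendsto_nhds_unique h1 (h2.congr fun n => ?_)
  exact (hA.form_solve f (Submodule.starProjection_apply_mem _ _)).symm

/-- Strong resolvent convergence. -/
theorem tendsto_globalInverse (hM : MoscoConverges m D Ωε Ω) (hm : 1 ≤ m)
    (hD : Bornology.IsBounded (D : Set (Space N))) (hΩ : Ω ≤ D) (hΩε : ∀ ε > 0, Ωε ε ≤ D)
    (f : GlobalL2 N) :
    Tendsto (fun ε => hA.globalInverse (Ωε ε) f) (𝓝[>] 0) (𝓝 (hA.globalInverse Ω f)) := by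
  refine tendsto_nhdsGT_zero_of_subseq fun e he0 he => ?_
  obtain ⟨C, hC⟩ := hA.exists_norm_solve_le
  obtain ⟨k, hk, x₀, hx₀, hw, hlim⟩ := hM.exists_subseq hm hD hΩ hΩε he0 he
    (fun n => (hA.solve (Ωε (e n)) f).2) (fun n => hC.2 _ f)
  have hek : Tendsto (fun n => e (k n)) atTop (𝓝[>] 0) :=
    tendsto_nhdsWithin_iff.2 ⟨he.comp hk.tendsto_atTop, Eventually.of_forall fun n => he0 _⟩
  have hx := hA.eq_solve_of_weaklyTendsto hM hΩ hΩε hek hx₀ (fun n => hC.2 _ f) hw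
  refine ⟨k, ?_⟩
  rw [globalInverse_apply, ← hx]
  exact hlim

theorem eConverges_inverse (hM : MoscoConverges m D Ωε Ω) (hm : 1 ≤ m)
    (hD : Bornology.IsBounded (D : Set (Space N))) (hΩ : Ω ≤ D) (hΩε : ∀ ε > 0, Ωε ε ≤ D)
    {v' : ∀ ε, L2 (Ωε ε)} {v : L2 Ω} (hv : EConverges v' v) :
    EConverges (fun ε => hA.inverse (Ωε ε) (v' ε)) (hA.inverse Ω v) := by
  obtain ⟨C, -, hC⟩ := hA.exists_norm_globalInverse_le
  have h1 := tendsto_iff_norm_sub_tendsto_zero.1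
    (hA.tendsto_globalInverse hM hm hD hΩ hΩε (extL2 Ω v))
  have h2 : Tendsto (fun ε => C * ‖v' ε - zeroExt (Ωε ε) v‖) (𝓝[>] 0) (𝓝 0) := by
    simpa using Tendsto.const_mul C hv
  refine squeeze_zero (fun _ => norm_nonneg _) (fun ε => ?_) (tendsto_zero_add h2 h1)
  refine (norm_sub_zeroExt_le _ _).trans ?_
  rw [extL2_inverse, extL2_inverse, norm_sub_zeroExt]
  refine (norm_sub_le_norm_sub_add_norm_sub _ (hA.globalInverse (Ωε ε) (extL2 Ω v)) _).trans
    (add_le_add_left ?_ _)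
  rw [← hA.globalInverse_cut (extL2 Ω v), ← map_sub]
  exact hC _ _

theorem eCompactConverges_inverse (hM : MoscoConverges m D Ωε Ω) (hm : 1 ≤ m)
    (hD : Bornology.IsBounded (D : Set (Space N))) (hΩ : Ω ≤ D) (hΩε : ∀ ε > 0, Ωε ε ≤ D) :
    ECompactConverges (fun ε => hA.inverse (Ωε ε)) (hA.inverse Ω) where
  compact ε hε := hA.isCompactOperator_inverse hm hD (hΩε ε hε)
  convergence _ _ hv := hA.eConverges_inverse hM hm hD hΩ hΩε hv
  subsequence v' hv e he0 he := by
    obtain ⟨C, hC⟩ := hA.exists_norm_solve_le_one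
    obtain ⟨k, hk, x₀, hx₀, -, hlim⟩ := hM.exists_subseq hm hD hΩ hΩε he0 he
      (fun n => (hA.solve (Ωε (e n)) (extL2 _ (v' (e n)))).2)
      (fun n => hC _ _ (((extL2 _).norm_map _).trans_le (hv _ (he0 n))))
    have hw : extL2 Ω (fn (ofGlobal m Ω ⟨x₀, hx₀⟩)) = x₀.fst := by
      rw [← toGlobal_fst, toGlobal_ofGlobal]
    refine ⟨k, hk, fn (ofGlobal m Ω ⟨x₀, hx₀⟩), squeeze_zero (fun _ => norm_nonneg _)
      (fun n => ?_) (tendsto_iff_norm_sub_tendsto_zero.1 hlim)⟩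
    refine (norm_sub_zeroExt_le _ _).trans_eq ?_
    rw [hw, extL2_inverse, globalInverse_apply]

end IsEllipticCoeff

end

end DomainPerturbation

end

theorem mainTheorem6 {N m : ℕ} (hN : 1 ≤ N) (hm : 1 ≤ m)
    (A : DomainPerturbation.MultiIndex N m → DomainPerturbation.MultiIndex N m →
      DomainPerturbation.Space N → ℝ)
    (hA : DomainPerturbation.IsEllipticCoeff A)
    (D Ω : Opens (DomainPerturbation.Space N)) (Ωε : ℝ → Opens (DomainPerturbation.Space N))
    (hD : Bornology.IsBounded (D : Set (DomainPerturbation.Space N)))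
    (hΩ : Ω ≤ D) (hΩε : ∀ ε > 0, Ωε ε ≤ D)
    (hMosco : DomainPerturbation.MoscoConverges m D Ωε Ω) :
    DomainPerturbation.ConditionC A
        (fun ε => DomainPerturbation.W0 m (Ωε ε)) (DomainPerturbation.W0 m Ω) ∧
      ∃ (B' : ∀ ε, DomainPerturbation.L2 (Ωε ε) →L[ℝ] DomainPerturbation.L2 (Ωε ε))
        (B : DomainPerturbation.L2 Ω →L[ℝ] DomainPerturbation.L2 Ω),
        (∀ ε > 0,
          DomainPerturbation.IsInverseOperator A (DomainPerturbation.W0 m (Ωε ε)) (B' ε)) ∧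
        DomainPerturbation.IsInverseOperator A (DomainPerturbation.W0 m Ω) B ∧
        DomainPerturbation.ECompactConverges B' B :=
  ⟨hMosco.conditionC hm hA hD hΩ hΩε, fun ε => hA.inverse (Ωε ε), hA.inverse Ω,
    fun ε _ => hA.isInverseOperator_inverse (Ωε ε), hA.isInverseOperator_inverse Ω,
    hA.eCompactConverges_inverse hMosco hm hD hΩ hΩε⟩
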